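/- **Conventions.** A probability density is a measurable $f:\mathbb R\to[0,\infty)$ with $\int f=1$ (a density on an interval is extended by $0$). Integrals of nonnegative functions take values in $[0,\infty]$, with the usual conventions $0^{-a}=\infty$, $\infty^{-a}=0$ ($a>0$). For $p\neq1$ let $p^*=\frac p{p-1}$. Put - $\sigma_q[f]=\big(\int|x|^qf(x)\,dx\big)^{1/q}$ for $q\ne0$, $\ \sigma_0[f]=\exp\int f(x)\log|x|\,dx$, $\ \sigma^{(E)}_q[f]=\big(\int e^{-qx}f(x)\,dx\big)^{1/q}$ for $q\neq 0$; - $N_\lambda[f]=\big(\int_{\{f>0\}}f^\lambda\big)^{1/(1-\lambda)}$ for $\lambda\neq1$, $\ N_1[f]=\exp(-\int f\log f)$, $\ \phi_{p,\lambda}[f]=\big(\int_{\{f>0\}}|f^{\lambda-2}f'|^p f\big)^{1/(p\lambda)}$; - upper-moments $M_{p,\alpha}[f]=\int\big(\int_x^\infty w_\alpha(v)f(v)\,dv\big)^pf(x)\,dx$, where $w_\alpha(v)=|(\alpha-2)v|^{1/(\alpha-2)}$ if $\alpha\ne2$ and $w_2(v)=e^v$; upper-deviation $m_{p,\alpha}[f]=M_{p,\alpha}[f]^{(\alpha-2)/p}$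 for $\alpha\ne2$; - for $f$ strictly decreasing on the interval $\{f>0\}$ with $f'<0$ there, the down transform $\mathcal D_\alpha[f](s)=f(x)^\alpha/|f'(x)|$ at $s=s(x)$, where $s(x)=\frac{f(x)^{2-\alpha}}{\alpha-2}$ ($\alpha\ne2$), $s(x)=-\log f(x)$ ($\alpha=2$), $f(x)>0$; $\mathcal D_\alpha[f]=0$ off the range of $s$; - the half-line stretched deformed Gaussian $g_{p,\lambda}(x)=a_{p,\lambda}\big(1-(\lambda-1)x^{p^*}\big)_+^{1/(\lambda-1)}$ for $x>0$ and $\lambda\neq1$, $g_{p,1}(x)=a_{p,1}e^{-x^{p^*}}$ for $x>0$, and $g_{p,\lambda}(x)=0$ for $x\le 0$, normalised to be a density; the mirrored stretched Gaussian $\overline g_{p,\lambda}=\mathcal D_{1+p}[g_{1-\lambda,1-p}]$; $\widetilde g_{p,\lambda}=\overline g_{p,\lambda}$ if $\lambda<0$ and $\widetilde g_{p,\lambda}=g_{p,\lambda}$ otherwise; - $\theta_0(p,\lambda)=1$ and $\kappa^{(0)}_{p,\lambda}=\sigma_{p^*}[g_{p,\lambda}]/N_\lambda[g_{p,\lambda}]$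 if $\lambda>\frac1{1+p^*}$, $p^*>0$ (classical case); $\theta_0(p,\lambda)=p^*-1$ and $\kappa^{(0)}_{p,\lambda}=|p^*-1|^{p^*-1}\,\phi_{1-\lambda,1-p}[g_{1-\lambda,1-p}]\,N_{1-p}[g_{1-\lambda,1-p}]$ if $\lambda<0$ (mirrored case); - $\Theta_1(p,\alpha,q)=\frac{\theta_0(p,1+(2-\alpha)q)}{\alpha-2}$, $\ \kappa^{(-1)}_{p,\alpha,q}=|2-\alpha|^{\Theta_1(p,\alpha,q)}\,\kappa^{(0)}_{p,1+(2-\alpha)q}$. **Theorem 4.1.** (1) Let $p,\alpha,q\in\mathbb R$, $\alpha\neq2$, and suppose that either (classical case) $p\ne1$, $p^*>0$ and $(\alpha-2)q<\frac{p^*}{p^*+1}$, or (mirrored case) $p\ne0,1$, $1+q(2-\alpha)<0$ and $\operatorname{sign}[(2-\alpha)q(1+p^*)+p^*]=\operatorname{sign}(p^*-1)$. Then $0<\kappa^{(-1)}_{p,\alpha,q}<\infty$ and $$\left(\frac{m_{p^*,\alpha}[f]}{\sigma_q[f]}\right)^{\Theta_1(p,\alpha,q)}\ \geq\ \kappa^{(-1)}_{p,\alpha,q}$$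 for every probability density $f$ for which the quotient is not of the form $0/0$ or $\infty/\infty$ (and, if $q=0$, for which $f\log|x|$ is integrable). The constant is sharp. With $\lambda=1+(2-\alpha)q$, equality holds for the probability density $x\mapsto\mathcal D_\alpha[g_{p,\lambda}](-x)$ in the classical case and for $\mathcal D_\alpha[\overline g_{p,\lambda}]$ in the mirrored case (and if $q=0$ this density has an integrable logarithmic moment). If $q\ne0$, $\mathcal D_\alpha[\widetilde g_{p,\lambda}]$ is a generalized Beta density: for some $a\ne0$, $b,P,Q>0$, $c\in[0,1]$, for a.e. $s$, with $y=|s|$, it equals $$\frac{|a|\,y^{aP-1}\big(1-(1-c)(y/b)^a\big)^{Q-1}}{b^{aP}B(P,Q)\big(1+c(y/b)^a\big)^{P+Q}}$$ if $(\alpha-2)s>0$ and $(1-c)(y/b)^a<1$, and $0$ otherwise. (2) Let $\lambda\neq1$ and suppose that either (classical) $p\neq 1$, $p^*>0$, $\lambda>\frac1{1+p^*}$, or (mirrored) $p\ne0,1$, $\lambda<0$, $\operatorname{sign}\big(\frac{\lambda-1}\lambda+p^*\big)=\operatorname{sign}(1-p^*)$. Then $0<\kappa^{(0)}_{p,\lambda}<\infty$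 and $$\Big(M_{p^*,2}[f]^{1/p^*}\,\sigma^{(E)}_{\lambda-1}[f]\Big)^{\theta_0(p,\lambda)}\ \geq\ \kappa^{(0)}_{p,\lambda}$$ for every probability density $f$ for which the product is not of the form $0\cdot\infty$ or $\infty\cdot 0$. In the mirrored case equality holds for the probability density $\mathcal D_2[\overline g_{p,\lambda}]$. (3) If $\alpha\ne2$, $p\neq 1$, $p^*>0$, and $f$ is a probability density with $f\log|x|$ integrable, then $$\left(\frac{m_{p^*,\alpha}[f]}{\exp\int f(x)\log|x|\,dx}\right)^{\frac1{\alpha-2}}\geq\kappa^{(-1)}_{p,\alpha,0}.$$ (4) If $p\neq 1$, $p^*>0$, and $f$ is a probability density with $xf(x)$ integrable, then $$M_{p^*,2}[f]^{1/p^*}\ \geq\ \kappa^{(0)}_{p,1}\,e^{\int xf(x)\,dx}.$$ -/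

import Mathlib

open MeasureTheory Set
open scoped ENNReal

noncomputable section

/-- Probability density functions on the real line. A density on an interval is extended by `0`. -/
structure IsProbDensity (f : ℝ → ℝ) : Prop where
  measurable : Measurable f
  nonneg : ∀ x, 0 ≤ f x
  lintegral_eq_one : ∫⁻ x, ENNReal.ofReal (f x) = 1

/-- The conjugate exponent `p* = p / (p - 1)`. -/
def conjExp (p : ℝ) : ℝ := p / (p - 1)

/-! ### Classical functionals -/

/-- The typical deviation `σ_q[f] = (∫ |x|^q f)^(1/q)`, with `σ_0[f] = exp (∫ f log |x|)`. -/
def deviation (q : ℝ) (f : ℝ → ℝ) : ℝ≥0∞ :=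
  if q = 0 then ENNReal.ofReal (Real.exp (∫ x, f x * Real.log |x|))
  else (∫⁻ x, ENNReal.ofReal |x| ^ q * ENNReal.ofReal (f x)) ^ (1 / q)

/-- The exponential moment `σ^(E)_q[f] = (∫ exp (-q x) f)^(1/q)`. -/
def expDeviation (q : ℝ) (f : ℝ → ℝ) : ℝ≥0∞ :=
  (∫⁻ x, ENNReal.ofReal (Real.exp (-q * x)) * ENNReal.ofReal (f x)) ^ (1 / q)

/-- The Rényi entropy power `N_l[f] = (∫ f^l)^(1/(1-l))`, the integral being over the support of
`f`; for `l = 1` it is the exponential of the Shannon entropy. -/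
def renyiPower (l : ℝ) (f : ℝ → ℝ) : ℝ≥0∞ :=
  if l = 1 then ENNReal.ofReal (Real.exp (-∫ x, f x * Real.log (f x)))
  else (∫⁻ x in {x | 0 < f x}, ENNReal.ofReal (f x) ^ l) ^ (1 / (1 - l))

/-- The `(p, l)`-Fisher information, normalised by the power `1/(p l)`:
`φ_{p,l}[f] = (∫ |f^(l-2) f'|^p f)^(1/(p l))`, the integral being over the support of `f`. -/
def fisherDev (p l : ℝ) (f : ℝ → ℝ) : ℝ≥0∞ :=
  (∫⁻ x in {x | 0 < f x},
    ENNReal.ofReal |f x ^ (l - 2) * deriv f x| ^ p * ENNReal.ofReal (f x)) ^ (1 / (p * l))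

/-! ### Upper-moments -/

/-- The weight of the up transformation: `|(α-2) v|^(1/(α-2))`, and `exp v` when `α = 2`. -/
def upWeight (α v : ℝ) : ℝ :=
  if α = 2 then Real.exp v else |(α - 2) * v| ^ (1 / (α - 2))

/-- `u(x) = ∫_x^{x_f} w_α(v) f(v) dv`; since `f` vanishes beyond the upper edge `x_f` of its
support, the integral is taken up to `∞`. -/
def upVar (α : ℝ) (f : ℝ → ℝ) (x : ℝ) : ℝ≥0∞ :=
  ∫⁻ v in Ioi x, ENNReal.ofReal (upWeight α v) * ENNReal.ofReal (f v)

/-- The `(p, α)`-upper-moment `M_{p,α}[f] = ∫ |u(x)|^p f(x) dx`. -/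
def upperMoment (p α : ℝ) (f : ℝ → ℝ) : ℝ≥0∞ :=
  ∫⁻ x, upVar α f x ^ p * ENNReal.ofReal (f x)

/-- The `(p, α)`-upper-deviation `m_{p,α}[f] = M_{p,α}[f]^((α-2)/p)`. -/
def upperDeviation (p α : ℝ) (f : ℝ → ℝ) : ℝ≥0∞ :=
  upperMoment p α f ^ ((α - 2) / p)

/-! ### The down transformation -/

/-- The canonical change of variable of the down transformation, as a function of the value
`y = f(x)`: `y^(2-α)/(α-2)`, and `-log y` when `α = 2`. -/
def downVar (α y : ℝ) : ℝ :=
  if α = 2 then -Real.log y else y ^ (2 - α) / (α - 2)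

open Classical in
/-- The down transformation of a density `f` that is strictly decreasing on its support:
`D_α[f](s(x)) = f(x)^α |f'(x)|⁻¹` for `s(x) = downVar α (f x)`, and `0` outside the range
of `s`. -/
def downTransform (α : ℝ) (f : ℝ → ℝ) (s : ℝ) : ℝ :=
  if s ∈ (fun x => downVar α (f x)) '' {x | 0 < f x} then
    f (Function.invFunOn (fun x => downVar α (f x)) {x | 0 < f x} s) ^ α *
      |deriv f (Function.invFunOn (fun x => downVar α (f x)) {x | 0 < f x} s)|⁻¹
  else 0

/-! ### Stretched deformed Gaussians -/

/-- The Tsallis exponential `exp_l(x) = (1 + (1-l) x)_+^(1/(1-l))`, with `exp_1 = exp`. -/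
def tsallisExp (l x : ℝ) : ℝ :=
  if l = 1 then Real.exp x else (max 0 (1 + (1 - l) * x)) ^ (1 / (1 - l))

/-- `exp_{2-l}(-x^{p*})` on the half-line `x > 0`. -/
def gaussProfile (p l x : ℝ) : ℝ :=
  if 0 < x then tsallisExp (2 - l) (-(x ^ conjExp p)) else 0

/-- The stretched deformed Gaussian density
`g_{p,l}(x) = a_{p,l} exp_{2-l}(-x^{p*})` on the half-line `x > 0`, where it is decreasing. -/
def stretchedGauss (p l x : ℝ) : ℝ :=
  (∫ y, gaussProfile p l y)⁻¹ * gaussProfile p l x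

/-- The mirrored stretched Gaussian `D_{1+p}[g_{1-l,1-p}]`. -/
def mirroredGauss (p l : ℝ) : ℝ → ℝ :=
  downTransform (1 + p) (stretchedGauss (1 - l) (1 - p))

/-- The extremal density of the moment-entropy inequality: the stretched Gaussian in the classical
range, the mirrored stretched Gaussian in the mirrored range `l < 0`. -/
def extremalGauss (p l : ℝ) : ℝ → ℝ :=
  if l < 0 then mirroredGauss p l else stretchedGauss p l

/-- The minimizer of the upper-moment--moment inequality: `D_α` of the extremal Gaussian, composed
with `x ↦ -x` in the classical range (the primitive `∫_x^{x_f}` in the upper-moment reverses the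
orientation of the line). -/
def upperMinimizer (p α l : ℝ) (x : ℝ) : ℝ :=
  if l < 0 then downTransform α (extremalGauss p l) x
  else downTransform α (extremalGauss p l) (-x)

/-- The generalized Beta density (McDonald–Xu) on `y > 0`, with parameters `a ≠ 0`, `b > 0`,
`0 ≤ c ≤ 1`, `P > 0`, `Q > 0`. -/
def genBeta (a b c P Q y : ℝ) : ℝ :=
  if 0 < y ∧ (1 - c) * (y / b) ^ a < 1 then
    |a| * y ^ (a * P - 1) * (1 - (1 - c) * (y / b) ^ a) ^ (Q - 1) /
      (b ^ (a * P) * ProbabilityTheory.beta P Q * (1 + c * (y / b) ^ a) ^ (P + Q))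
  else 0

/-! ### Constants and exponents -/

/-- `θ₀(p,l)`: `1` in the classical range, `p* - 1` in the mirrored range `l < 0`. -/
def theta0 (p l : ℝ) : ℝ := if l < 0 then conjExp p - 1 else 1

/-- `κ⁽⁰⁾_{p,l}`: the quotient `σ_{p*}[g] / N_l[g]` for `g = g_{p,l}` in the classical range, and
`|p*-1|^(p*-1) φ_{1-l,1-p}[g] N_{1-p}[g]` for `g = g_{1-l,1-p}` in the mirrored range. -/
def kappa0 (p l : ℝ) : ℝ≥0∞ :=
  if l < 0 then
    ENNReal.ofReal (|conjExp p - 1| ^ (conjExp p - 1)) *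
      (fisherDev (1 - l) (1 - p) (stretchedGauss (1 - l) (1 - p)) *
        renyiPower (1 - p) (stretchedGauss (1 - l) (1 - p)))
  else deviation (conjExp p) (stretchedGauss p l) / renyiPower l (stretchedGauss p l)

/-- `Θ₁(p,α,q) = θ₀(p, 1 + (2-α) q) / (α-2)`. -/
def theta1 (p α q : ℝ) : ℝ := theta0 p (1 + (2 - α) * q) / (α - 2)

/-- `κ⁽⁻¹⁾_{p,α,q} = |2-α|^{Θ₁(p,α,q)} κ⁽⁰⁾_{p, 1 + (2-α) q}`. -/
def kappaUp (p α q : ℝ) : ℝ≥0∞ :=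
  ENNReal.ofReal (|2 - α| ^ theta1 p α q) * kappa0 p (1 + (2 - α) * q)

/-! ### Parameter ranges -/

/-- Classical range of the upper-moment--moment inequality. -/
def UpClassical (p α q : ℝ) : Prop :=
  0 < conjExp p ∧ (α - 2) * q < conjExp p / (conjExp p + 1)

/-- Mirrored range of the upper-moment--moment inequality (`p ≠ 1` and `p ≠ 0`: the exponent `p*`
is defined and nonzero). -/
def UpMirrored (p α q : ℝ) : Prop :=
  p ≠ 0 ∧ p ≠ 1 ∧ 1 + q * (2 - α) < 0 ∧
    SignType.sign ((2 - α) * q * (1 + conjExp p) + conjExp p) = SignType.sign (conjExp p - 1)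

/-- Classical range of the moment-entropy inequality (with `p* ≠ 0`). -/
def EntClassical (p l : ℝ) : Prop := 0 < conjExp p ∧ 1 / (1 + conjExp p) < l

/-- Mirrored range of the moment-entropy inequality (with `p*` defined and nonzero). -/
def EntMirrored (p l : ℝ) : Prop :=
  p ≠ 0 ∧ p ≠ 1 ∧ l < 0 ∧
    SignType.sign ((l - 1) / l + conjExp p) = SignType.sign (1 - conjExp p)

end

/-! Write dμ = f dx, w = w_α, r = p* and u(x) = ∫_x^∞ w dμ. The tail u carries w dμ to Lebesgue
measure, so μ seen in the variable u formally has density 1/w. The upper-moment ∫ u^r dμ is the r-th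
moment of that density and ∫ w^(1-l) dμ is the integral of its l-th power. For l = 1 + (2-α)q the
latter is a multiple of ∫ |x|^q f; for α = 2 it is an exponential moment; for l = 1 the geometric
mean of w takes its place. All the inequalities are therefore one moment-entropy inequality,
`kappa0_le`, stated for an atomless probability measure μ and an a.e. positive weight w, so that no
regularity or monotonicity of f enters.

It is proved by comparing w with 1/G(u), where G is the extremal density. The graph of t ↦ t^(1-l)
lies on one side of its tangent at t = 1/G(u); for l = 1 the inequality log t ≤ t - 1 is used
instead. Integrating against μ leaves three terms: ∫ w^(1-l) dμ; ∫ G(u)^l w dμ, which the change of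
variable by the tail compares with ∫ G^l (`lintegral_comp_tailInt_mul_le`,
`lintegral_comp_tailInt_mul`); and ∫ G(u)^(l-1) dμ, which depends on the moment alone because
G^(l-1) is affine in u^r on the support of G.

Both sides are homogeneous in w. In the classical range w is scaled so that its tail moment equals
that of G, and the claim follows at once (`deviation_div_renyiPower_le`). In the mirrored range l <
0 the profile G lives on a bounded interval (0, S) and the scaling is spent on giving w the mass S.
The moment remains free, so a suitable multiple yG is used as reference, and Bernoulli's inequality
`one_sub_mul_le_rpow_neg` finishes (`tailMoment_div_le`). This bounds the quotient from above; the
negative exponent p* - 1 turns it into a lower bound.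

The mirrored Gaussian is the down transform of order 1+p of g_{1-l,1-p}. This exchanges moments and
power integrals, so every constant reduces to Beta or Gamma integrals of stretched Gaussians
(`kappa0_eq`).

Equality rests on `upWeight_downVar`: w_α(s(x)) = 1/g(x). Hence the tail of D_α[g] at s(x) is the
length of the part of the support of g to the right of x. For the mirrored Gaussian, supported on
(-S, 0), this length is |x|. For the stretched Gaussian, supported to the right of 0, the line has
to be reflected first, which uses that w_α is even when α ≠ 2. Finally, the extremal densities
satisfy g' = -K|x|^(r-1) g^(2-l) with g^(l-1) affine in |x|^r, and this makes D_α[g] a generalized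
Beta density (`downTransform_eq_of_power`). -/

/-! ### Beta integrals -/

/-- The substitution `z = (y / b) ^ a` on the half-line. -/
lemma lintegral_Ioi_comp_div_rpow {a b : ℝ} (ha : a ≠ 0) (hb : 0 < b) (F : ℝ → ℝ≥0∞) :
    ∫⁻ z in Ioi 0, F z =
      ∫⁻ y in Ioi 0, ENNReal.ofReal (|a| / b * (y / b) ^ (a - 1)) * F ((y / b) ^ a) := by
  have himg : (fun y : ℝ => (y / b) ^ a) '' Ioi 0 = Ioi 0 := by
    ext z
    constructor
    · rintro ⟨y, hy, rfl⟩
      exact Real.rpow_pos_of_pos (div_pos hy hb) _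
    · intro hz
      refine ⟨b * z ^ a⁻¹, mul_pos hb (Real.rpow_pos_of_pos hz _), ?_⟩
      have : b * z ^ a⁻¹ / b = z ^ a⁻¹ := by field_simp
      simp only [this]
      rw [← Real.rpow_mul (le_of_lt hz), inv_mul_cancel₀ ha, Real.rpow_one]
  have hinj : InjOn (fun y : ℝ => (y / b) ^ a) (Ioi 0) := by
    intro x hx y hy hxy
    have := Real.rpow_left_injOn ha (div_pos hx hb).le (div_pos hy hb).le hxy
    field_simp at this
    exact this
  have hder : ∀ y ∈ Ioi (0 : ℝ), HasDerivWithinAt (fun y : ℝ => (y / b) ^ a)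
      (a / b * (y / b) ^ (a - 1)) (Ioi 0) y := by
    intro y hy
    have h1 : HasDerivAt (fun y : ℝ => y / b) (1 / b) y := (hasDerivAt_id y).div_const b
    have h2 := h1.rpow_const (p := a) (Or.inl (div_pos hy hb).ne')
    refine (h2.congr_deriv ?_).hasDerivWithinAt
    ring
  rw [← himg, lintegral_image_eq_lintegral_abs_deriv_mul measurableSet_Ioi hder hinj, himg]
  refine setLIntegral_congr_fun measurableSet_Ioi fun y hy => ?_
  have : 0 < (y / b) ^ (a - 1) := Real.rpow_pos_of_pos (div_pos hy hb) _
  simp only [abs_mul, abs_div, abs_of_pos this, abs_of_pos hb]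

/-- The Beta kernel on the half-line: of the first kind for `c = 0`, of the second kind for
`c = 1`. -/
noncomputable def betaKernel (c P Q z : ℝ) : ℝ :=
  if (1 - c) * z < 1 then z ^ (P - 1) * (1 - (1 - c) * z) ^ (Q - 1) / (1 + c * z) ^ (P + Q) else 0

lemma lintegral_Ioo_beta {P Q : ℝ} (hP : 0 < P) (hQ : 0 < Q) :
    ∫⁻ z in Ioo (0 : ℝ) 1, ENNReal.ofReal (z ^ (P - 1) * (1 - z) ^ (Q - 1)) =
      ENNReal.ofReal (ProbabilityTheory.beta P Q) := by
  have h := ProbabilityTheory.lintegral_betaPDF_eq_one hP hQ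
  have hb := ProbabilityTheory.beta_pos hP hQ
  rw [ProbabilityTheory.lintegral_betaPDF] at h
  simp_rw [mul_assoc, ENNReal.ofReal_mul (one_div_pos.2 hb).le] at h
  rw [lintegral_const_mul' _ _ ENNReal.ofReal_ne_top] at h
  calc _ = ENNReal.ofReal (ProbabilityTheory.beta P Q) *
        (ENNReal.ofReal (1 / ProbabilityTheory.beta P Q) *
          ∫⁻ z in Ioo (0 : ℝ) 1, ENNReal.ofReal (z ^ (P - 1) * (1 - z) ^ (Q - 1))) := by
        rw [← mul_assoc, ← ENNReal.ofReal_mul hb.le, mul_one_div_cancel hb.ne']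
        simp
    _ = _ := by rw [h, mul_one]

lemma lintegral_Ioi_betaKernel {c P Q : ℝ} (hc : c = 0 ∨ c = 1) (hP : 0 < P) (hQ : 0 < Q) :
    ∫⁻ z in Ioi (0 : ℝ), ENNReal.ofReal (betaKernel c P Q z) =
      ENNReal.ofReal (ProbabilityTheory.beta P Q) := by
  rw [← lintegral_Ioo_beta hP hQ]
  rcases hc with rfl | rfl
  · rw [← Iio_inter_Ioi, ← setLIntegral_indicator measurableSet_Iio]
    refine lintegral_congr fun z => ?_
    unfold betaKernel
    by_cases hz : z < 1
    · simp [hz]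
    · simp [hz]
  -- The second kind reduces to the first through t = z/(1+z), for which 1 - t = 1/(1+z) and dt =
  -- dz/(1+z)².
  · have himg : (fun z : ℝ => z / (1 + z)) '' Ioi 0 = Ioo 0 1 := by
      ext t
      constructor
      · rintro ⟨z, hz, rfl⟩
        have hz' : 0 < z := hz
        exact ⟨by positivity, by simp only; rw [div_lt_one (by positivity)]; linarith⟩
      · rintro ⟨h0, h1⟩
        have : 0 < 1 - t := by linarith
        refine ⟨t / (1 - t), div_pos h0 this, ?_⟩
        simp only
        field_simp
        ring
    have hinj : InjOn (fun z : ℝ => z / (1 + z)) (Ioi 0) := by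
      intro x hx y hy hxy
      have hx' : 0 < x := hx
      have hy' : 0 < y := hy
      simp only at hxy
      field_simp at hxy
      linarith
    have hder : ∀ z ∈ Ioi (0 : ℝ), HasDerivWithinAt (fun z : ℝ => z / (1 + z))
        (1 / (1 + z) ^ 2) (Ioi 0) z := by
      intro z hz
      have hz' : 0 < z := hz
      have h2 := (hasDerivAt_id z).div ((hasDerivAt_id z).const_add 1) (by simp; positivity)
      refine (h2.congr_deriv ?_).hasDerivWithinAt
      simp
    rw [← himg, lintegral_image_eq_lintegral_abs_deriv_mul measurableSet_Ioi hder hinj]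
    refine setLIntegral_congr_fun measurableSet_Ioi fun z hz => ?_
    have hz' : 0 < z := hz
    have h1 : 0 < 1 + z := by positivity
    simp only [betaKernel]
    rw [← ENNReal.ofReal_mul (abs_nonneg _)]
    congr 1
    have e1 : 1 - z / (1 + z) = (1 + z)⁻¹ := by field_simp; ring
    rw [e1, abs_of_pos (by positivity), Real.div_rpow hz'.le h1.le, Real.inv_rpow h1.le]
    have e2 : (1 + z) ^ (P + Q) = (1 + z) ^ (P - 1) * (1 + z) ^ (Q - 1) * (1 + z) ^ (2 : ℕ) := by
      rw [← Real.rpow_natCast, ← Real.rpow_add h1, ← Real.rpow_add h1]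
      congr 1
      push_cast
      ring
    simp only [sub_self, zero_mul, zero_lt_one, if_true, sub_zero, Real.one_rpow, one_mul, mul_one]
    rw [e2]
    field_simp

lemma lintegral_Ioi_mul_betaKernel {a b c P Q : ℝ} (ha : a ≠ 0) (hb : 0 < b)
    (hc : c = 0 ∨ c = 1) (hP : 0 < P) (hQ : 0 < Q) :
    ∫⁻ y in Ioi (0 : ℝ), ENNReal.ofReal (|a| / b * (y / b) ^ (a - 1) *
      betaKernel c P Q ((y / b) ^ a)) = ENNReal.ofReal (ProbabilityTheory.beta P Q) := by
  rw [← lintegral_Ioi_betaKernel hc hP hQ,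
    lintegral_Ioi_comp_div_rpow ha hb fun z => ENNReal.ofReal (betaKernel c P Q z)]
  refine setLIntegral_congr_fun measurableSet_Ioi fun y hy => ?_
  have : 0 < y / b := div_pos hy hb
  refine ENNReal.ofReal_mul ?_
  exact mul_nonneg (div_nonneg (abs_nonneg a) hb.le) (Real.rpow_nonneg this.le _)

lemma genBeta_eq_mul_betaKernel {a b c P Q y : ℝ} (hb : 0 < b) (hy : 0 < y) :
    genBeta a b c P Q y = (ProbabilityTheory.beta P Q)⁻¹ *
      (|a| / b * (y / b) ^ (a - 1) * betaKernel c P Q ((y / b) ^ a)) := by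
  unfold genBeta betaKernel
  have hyb : 0 < y / b := div_pos hy hb
  by_cases h : (1 - c) * (y / b) ^ a < 1
  · rw [if_pos ⟨hy, h⟩, if_pos h]
    have e : y ^ (a * P - 1) = b ^ (a * P) / b * ((y / b) ^ (a - 1) * ((y / b) ^ a) ^ (P - 1)) := by
      rw [← Real.rpow_mul hyb.le, ← Real.rpow_add hyb, Real.div_rpow hy.le hb.le]
      have : a - 1 + a * (P - 1) = a * P - 1 := by ring
      rw [this, Real.rpow_sub_one hb.ne']
      have := Real.rpow_pos_of_pos hb (a * P)
      field_simp
    rw [e]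
    have := Real.rpow_pos_of_pos hb (a * P)
    field_simp
  · rw [if_neg (fun h' => h h'.2), if_neg h]
    simp

lemma lintegral_genBeta {a b c P Q : ℝ} (ha : a ≠ 0) (hb : 0 < b)
    (hc : c = 0 ∨ c = 1) (hP : 0 < P) (hQ : 0 < Q) :
    ∫⁻ y in Ioi (0 : ℝ), ENNReal.ofReal (genBeta a b c P Q y) = 1 := by
  have hbeta := ProbabilityTheory.beta_pos hP hQ
  rw [setLIntegral_congr_fun measurableSet_Ioi (g := fun y => ENNReal.ofReal
    (ProbabilityTheory.beta P Q)⁻¹ * ENNReal.ofReal (|a| / b * (y / b) ^ (a - 1) *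
      betaKernel c P Q ((y / b) ^ a))) fun y hy => by
        simp only [genBeta_eq_mul_betaKernel hb hy, ENNReal.ofReal_mul (inv_pos.2 hbeta).le],
    lintegral_const_mul' _ _ ENNReal.ofReal_ne_top, lintegral_Ioi_mul_betaKernel ha hb hc hP hQ,
    ← ENNReal.ofReal_mul (inv_pos.2 hbeta).le, inv_mul_cancel₀ hbeta.ne', ENNReal.ofReal_one]

lemma beta_add_one_left {P Q : ℝ} (hP : 0 < P) (hQ : 0 < Q) :
    ProbabilityTheory.beta (P + 1) Q = P / (P + Q) * ProbabilityTheory.beta P Q := by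
  unfold ProbabilityTheory.beta
  rw [Real.Gamma_add_one hP.ne', show P + 1 + Q = P + Q + 1 by ring,
    Real.Gamma_add_one (by positivity)]
  have := Real.Gamma_pos_of_pos (add_pos hP hQ)
  field_simp

/-- Multiplying a kernel of the second kind by its variable moves one unit from the second parameter
to the first while their sum stays fixed; this is the resulting ratio of masses. -/
lemma beta_add_one_sub_one {P Q : ℝ} (hP : 0 < P) (hQ : 0 < Q) :
    ProbabilityTheory.beta (P + 1) Q = P / Q * ProbabilityTheory.beta P (Q + 1) := by
  unfold ProbabilityTheory.beta
  rw [Real.Gamma_add_one hP.ne', show P + 1 + Q = P + (Q + 1) by ring,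
    Real.Gamma_add_one hQ.ne']
  field_simp

/-! ### The down transformation as a change of variables -/

/-- Nonnegative functions that are strictly decreasing on their support, an interval. -/
structure IsDecreasingProfile (g : ℝ → ℝ) : Prop where
  measurable : Measurable g
  nonneg : ∀ x, 0 ≤ g x
  ordConnected : OrdConnected {x | 0 < g x}
  deriv_neg : ∀ x, 0 < g x → deriv g x < 0

lemma hasDerivAt_downVar (α : ℝ) {y : ℝ} (hy : 0 < y) :
    HasDerivAt (downVar α) (-(y ^ (1 - α))) y := by
  unfold downVar
  split_ifs with h
  · subst h
    have := (Real.hasDerivAt_log hy.ne').neg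
    refine this.congr_deriv ?_
    norm_num [Real.rpow_neg_one]
  · have h2 : α - 2 ≠ 0 := sub_ne_zero.2 h
    have := (Real.hasDerivAt_rpow_const (p := 2 - α) (Or.inl hy.ne')).div_const (α - 2)
    refine this.congr_deriv ?_
    rw [show 2 - α - 1 = 1 - α by ring]
    field_simp
    ring

lemma strictAntiOn_downVar (α : ℝ) : StrictAntiOn (downVar α) (Ioi 0) := by
  refine strictAntiOn_of_deriv_neg (convex_Ioi 0)
    (fun y hy => (hasDerivAt_downVar α hy).continuousAt.continuousWithinAt) fun y hy => ?_
  rw [interior_Ioi] at hy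
  rw [(hasDerivAt_downVar α hy).deriv]
  exact neg_neg_of_pos (Real.rpow_pos_of_pos hy _)

lemma downVar_of_ne {α : ℝ} (hα : α ≠ 2) (y : ℝ) : downVar α y = y ^ (2 - α) / (α - 2) := by
  rw [downVar, if_neg hα]

/-- This is why the two transformations are inverse: the measure D_α[g] ds is the image of g dx, and
the weight cancels the factor g and leaves Lebesgue measure. -/
lemma upWeight_downVar (α : ℝ) {y : ℝ} (hy : 0 < y) : upWeight α (downVar α y) = y⁻¹ := by
  unfold upWeight downVar
  split_ifs with h
  · rw [Real.exp_neg, Real.exp_log hy]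
  · have h2 : α - 2 ≠ 0 := sub_ne_zero.2 h
    rw [mul_div_cancel₀ _ h2, abs_of_pos (Real.rpow_pos_of_pos hy _), ← Real.rpow_mul hy.le,
      ← Real.rpow_neg_one]
    congr 1
    field_simp
    ring

/-- Evenness permits reflecting the minimizer of the classical range. The weight exp of α = 2 is not
even. -/
lemma upWeight_neg {α : ℝ} (hα : α ≠ 2) (x : ℝ) : upWeight α (-x) = upWeight α x := by
  simp [upWeight, hα]

lemma measurable_upWeight (α : ℝ) : Measurable (upWeight α) := by
  unfold upWeight
  split_ifs
  · exact Real.measurable_exp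
  · fun_prop

namespace IsDecreasingProfile

variable {g : ℝ → ℝ} (hg : IsDecreasingProfile g)
include hg

lemma measurableSet_support : MeasurableSet {x | 0 < g x} :=
  measurableSet_lt measurable_const hg.measurable

/-- Since `deriv` is 0 at points of non-differentiability, the strict sign condition already
contains differentiability on the support. -/
lemma hasDerivAt {x : ℝ} (hx : 0 < g x) : HasDerivAt g (deriv g x) x :=
  (differentiableAt_of_deriv_ne_zero (hg.deriv_neg x hx).ne).hasDerivAt

lemma strictAntiOn : StrictAntiOn g {x | 0 < g x} :=
  strictAntiOn_of_deriv_neg hg.ordConnected.convex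
    (fun _ hx => (hg.hasDerivAt hx).continuousAt.continuousWithinAt)
    fun x hx => hg.deriv_neg x (interior_subset (s := {x | 0 < g x}) hx)

lemma strictMonoOn_downVar (α : ℝ) : StrictMonoOn (fun x => downVar α (g x)) {x | 0 < g x} :=
  fun _ hx _ hy hxy => strictAntiOn_downVar α hy hx (hg.strictAntiOn hx hy hxy)

lemma hasDerivAt_downVar_comp (α : ℝ) {x : ℝ} (hx : 0 < g x) :
    HasDerivAt (fun x => downVar α (g x)) (-(g x ^ (1 - α)) * deriv g x) x :=
  (hasDerivAt_downVar α hx).comp x (hg.hasDerivAt hx)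

lemma downTransform_downVar (α : ℝ) {x : ℝ} (hx : 0 < g x) :
    downTransform α g (downVar α (g x)) = g x ^ α * |deriv g x|⁻¹ := by
  have hmem : downVar α (g x) ∈ (fun x => downVar α (g x)) '' {x | 0 < g x} := ⟨x, hx, rfl⟩
  have hinv := (hg.strictMonoOn_downVar α).injOn.leftInvOn_invFunOn hx
  beta_reduce at hinv
  rw [downTransform, if_pos hmem, hinv]

omit hg in
lemma downTransform_of_notMem (α : ℝ) {s : ℝ}
    (hs : s ∉ (fun x => downVar α (g x)) '' {x | 0 < g x}) : downTransform α g s = 0 := by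
  rw [downTransform, if_neg hs]

omit hg in
lemma downTransform_nonneg' (hg : ∀ x, 0 ≤ g x) (α s : ℝ) : 0 ≤ downTransform α g s := by
  rw [downTransform]
  split_ifs
  · exact mul_nonneg (Real.rpow_nonneg (hg _) _) (inv_nonneg.2 (abs_nonneg _))
  · exact le_rfl

lemma continuousOn_downVar_comp (α : ℝ) :
    ContinuousOn (fun x => downVar α (g x)) {x | 0 < g x} :=
  fun _ hx => (hg.hasDerivAt_downVar_comp α hx).continuousAt.continuousWithinAt

lemma measurableSet_image (α : ℝ) {T : Set ℝ} (hT : MeasurableSet T) :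
    MeasurableSet ((fun x => downVar α (g x)) '' ({x | 0 < g x} ∩ T)) :=
  (hg.measurableSet_support.inter hT).image_of_continuousOn_injOn
    ((hg.continuousOn_downVar_comp α).mono inter_subset_left)
    ((hg.strictMonoOn_downVar α).injOn.mono inter_subset_left)

lemma measurable_downTransform (α : ℝ) : Measurable (downTransform α g) := by
  have hφ : Measurable fun x => g x ^ α * |deriv g x|⁻¹ :=
    (hg.measurable.pow_const α).mul (measurable_deriv g).abs.inv
  intro B hB
  have himg : MeasurableSet ((fun x => downVar α (g x)) '' {x | 0 < g x}) := by
    simpa using hg.measurableSet_image α MeasurableSet.univ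
  -- Inside the range of s the preimage is the injective continuous image of a measurable set, hence
  -- measurable; outside the range the transform is 0.
  have key : downTransform α g ⁻¹' B =
      (fun x => downVar α (g x)) '' ({x | 0 < g x} ∩ (fun x => g x ^ α * |deriv g x|⁻¹) ⁻¹' B) ∪
      (((fun x => downVar α (g x)) '' {x | 0 < g x})ᶜ ∩ {_s | (0 : ℝ) ∈ B}) := by
    ext s
    by_cases hs : s ∈ (fun x => downVar α (g x)) '' {x | 0 < g x}
    · obtain ⟨x, hx, rfl⟩ := hs
      have h1 : (fun x => downVar α (g x)) x ∈ (fun x => downVar α (g x)) '' {x | 0 < g x} :=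
        ⟨x, hx, rfl⟩
      simp only [mem_union, mem_inter_iff, mem_compl_iff, h1, not_true, false_and, or_false,
        mem_preimage]
      rw [hg.downTransform_downVar α hx]
      constructor
      · exact fun h => ⟨x, ⟨hx, h⟩, rfl⟩
      · rintro ⟨y, ⟨hy, hyB⟩, hxy⟩
        rwa [← (hg.strictMonoOn_downVar α).injOn hy hx hxy]
    · have h2 : s ∉ (fun x => downVar α (g x)) ''
          ({x | 0 < g x} ∩ (fun x => g x ^ α * |deriv g x|⁻¹) ⁻¹' B) :=
        fun h => hs (image_mono inter_subset_left h)
      simp only [mem_union, mem_inter_iff, mem_compl_iff, h2, hs, not_false_iff, true_and,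
        false_or, mem_preimage, mem_ofPred_eq, downTransform_of_notMem α hs]
  rw [key]
  exact (hg.measurableSet_image α (hφ hB)).union (himg.compl.inter (MeasurableSet.const _))

/-- Change of variables for the down transformation. -/
lemma lintegral_mul_downTransform (α : ℝ) (H : ℝ → ℝ≥0∞) :
    ∫⁻ s, H s * ENNReal.ofReal (downTransform α g s) =
      ∫⁻ x in {x | 0 < g x}, H (downVar α (g x)) * ENNReal.ofReal (g x) := by
  have himg : MeasurableSet ((fun x => downVar α (g x)) '' {x | 0 < g x}) := by
    simpa using hg.measurableSet_image α MeasurableSet.univ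
  have h0 : ∫⁻ s, H s * ENNReal.ofReal (downTransform α g s) =
      ∫⁻ s in (fun x => downVar α (g x)) '' {x | 0 < g x},
        H s * ENNReal.ofReal (downTransform α g s) := by
    rw [← lintegral_indicator himg]
    refine lintegral_congr fun s => ?_
    by_cases hs : s ∈ (fun x => downVar α (g x)) '' {x | 0 < g x}
    · rw [indicator_of_mem hs]
    · rw [indicator_of_notMem hs, downTransform_of_notMem α hs]
      simp
  rw [h0, lintegral_image_eq_lintegral_abs_deriv_mul hg.measurableSet_support
    (fun x hx => (hg.hasDerivAt_downVar_comp α hx).hasDerivWithinAt)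
    (hg.strictMonoOn_downVar α).injOn]
  refine setLIntegral_congr_fun hg.measurableSet_support fun x hx => ?_
  have hx' : 0 < g x := hx
  have hd := hg.deriv_neg x hx
  rw [hg.downTransform_downVar α hx, mul_left_comm, ← ENNReal.ofReal_mul (abs_nonneg _)]
  congr 2
  rw [abs_mul, abs_neg, abs_of_pos (Real.rpow_pos_of_pos hx' _)]
  -- The Jacobian is s' = g^(1-α) |g'|, so it cancels |g'| in g^α/|g'| and exactly g remains.
  have e : g x ^ (1 - α) * g x ^ α = g x := by
    rw [← Real.rpow_add hx', sub_add_cancel, Real.rpow_one]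
  have : |deriv g x| ≠ 0 := abs_ne_zero.2 hd.ne
  calc _ = (g x ^ (1 - α) * g x ^ α) * (|deriv g x| * |deriv g x|⁻¹) := by ring
    _ = _ := by rw [e, mul_inv_cancel₀ this, mul_one]

lemma lintegral_downTransform (α : ℝ) :
    ∫⁻ s, ENNReal.ofReal (downTransform α g s) = ∫⁻ x, ENNReal.ofReal (g x) := by
  have h := hg.lintegral_mul_downTransform α 1
  simp only [Pi.one_apply, one_mul] at h
  rw [h, ← lintegral_indicator hg.measurableSet_support]
  refine lintegral_congr fun x => ?_
  by_cases hx : 0 < g x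
  · rw [indicator_of_mem (by exact hx)]
  · rw [indicator_of_notMem (by exact hx), ENNReal.ofReal_of_nonpos (not_lt.1 hx)]

/-- Mass of a region for the density `w_α D_α[g]`: the down transformation is inverse to the up
transformation. -/
lemma lintegral_upWeight_mul_downTransform (α : ℝ) {T : Set ℝ} (hT : MeasurableSet T) :
    ∫⁻ s in T, ENNReal.ofReal (upWeight α s) * ENNReal.ofReal (downTransform α g s) =
      volume ({x | 0 < g x} ∩ {x | downVar α (g x) ∈ T}) := by
  rw [← lintegral_indicator hT]
  have h := hg.lintegral_mul_downTransform α (T.indicator fun s => ENNReal.ofReal (upWeight α s))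
  have e : ∀ s, T.indicator (fun s => ENNReal.ofReal (upWeight α s) *
      ENNReal.ofReal (downTransform α g s)) s =
      T.indicator (fun s => ENNReal.ofReal (upWeight α s)) s *
        ENNReal.ofReal (downTransform α g s) := fun s => by
    by_cases hs : s ∈ T <;> simp [hs]
  have hT' : MeasurableSet {x | downVar α (g x) ∈ T} := by
    have : Measurable (downVar α) := by
      unfold downVar
      split_ifs
      · fun_prop
      · fun_prop
    exact (this.comp hg.measurable) hT
  rw [lintegral_congr e, h, inter_comm, ← setLIntegral_one,
    ← Measure.restrict_restrict hT', ← lintegral_indicator hT']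
  refine setLIntegral_congr_fun hg.measurableSet_support fun x hx => ?_
  have hx' : 0 < g x := hx
  by_cases hs : downVar α (g x) ∈ T
  · have h1 : x ∈ {x | downVar α (g x) ∈ T} := hs
    simp only [indicator_of_mem hs, indicator_of_mem h1]
    rw [upWeight_downVar α hx', ← ENNReal.ofReal_mul (inv_pos.2 hx').le, inv_mul_cancel₀ hx'.ne',
      ENNReal.ofReal_one]
  · have h1 : x ∉ {x | downVar α (g x) ∈ T} := hs
    simp only [indicator_of_notMem hs, indicator_of_notMem h1, zero_mul]

lemma isProbDensity_downTransform (α : ℝ) (h1 : ∫⁻ x, ENNReal.ofReal (g x) = 1) :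
    IsProbDensity (downTransform α g) :=
  ⟨hg.measurable_downTransform α, downTransform_nonneg' hg.nonneg α,
    (hg.lintegral_downTransform α).trans h1⟩

end IsDecreasingProfile

lemma lintegral_neg_arg (F : ℝ → ℝ≥0∞) : ∫⁻ x, F (-x) = ∫⁻ x, F x :=
  (Measure.measurePreserving_neg volume).lintegral_comp_emb
    (MeasurableEquiv.neg ℝ).measurableEmbedding F

lemma IsProbDensity.comp_neg {f : ℝ → ℝ} (hf : IsProbDensity f) :
    IsProbDensity fun x => f (-x) :=
  ⟨hf.measurable.comp measurable_neg, fun x => hf.nonneg _, by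
    rw [← hf.lintegral_eq_one]
    exact lintegral_neg_arg fun x => ENNReal.ofReal (f x)⟩

/-! ### The tail of a measure as a change of variables -/

/-- Dominated convergence: for y ≠ x₀ the indicator of (x, ∞) at y is locally constant in x near x₀,
and the exceptional point has no mass. -/
lemma continuous_measureReal_Ioi (ν : Measure ℝ) [IsFiniteMeasure ν] [NullSingletonClass ν] :
    Continuous fun x => ν.real (Ioi x) := by
  have h : ∀ x, ν.real (Ioi x) = ∫ y, (Ioi x).indicator (fun _ => (1 : ℝ)) y ∂ν := fun x => by
    rw [integral_indicator measurableSet_Ioi]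
    simp
  simp_rw [h]
  refine continuous_iff_continuousAt.2 fun x₀ => ?_
  refine continuousAt_of_dominated (bound := fun _ => (1 : ℝ))
    (Filter.Eventually.of_forall fun x => ?_) (Filter.Eventually.of_forall fun x => ?_)
    (integrable_const 1) ?_
  · exact (aestronglyMeasurable_const.indicator measurableSet_Ioi)
  · refine Filter.Eventually.of_forall fun y => ?_
    by_cases hy : y ∈ Ioi x <;> simp [hy]
  · have : ∀ᵐ y ∂ν, y ≠ x₀ := by
      simp [ae_iff]
    filter_upwards [this] with y hy
    rcases lt_or_gt_of_ne hy with hlt | hgt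
    · refine (continuousAt_const (y := (0 : ℝ))).congr ?_
      filter_upwards [Ioi_mem_nhds hlt] with x hx
      rw [indicator_of_notMem (by simpa using le_of_lt hx)]
    · refine (continuousAt_const (y := (1 : ℝ))).congr ?_
      filter_upwards [Iio_mem_nhds hgt] with x hx
      rw [indicator_of_mem (by simpa using hx)]

lemma antitone_measureReal_Ioi (ν : Measure ℝ) [IsFiniteMeasure ν] :
    Antitone fun x => ν.real (Ioi x) :=
  fun _ _ hxy => measureReal_mono (Ioi_subset_Ioi hxy)

/-- A finite atomless measure on the line is pushed to Lebesgue measure by its tail function. -/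
lemma map_measureReal_Ioi (ν : Measure ℝ) [IsFiniteMeasure ν] [NullSingletonClass ν] :
    ν.map (fun x => ν.real (Ioi x)) = volume.restrict (Ioo 0 (ν.real univ)) := by
  have hc := continuous_measureReal_Ioi ν
  have hanti := antitone_measureReal_Ioi ν
  refine Measure.ext_of_Ici _ _ fun t => ?_
  rw [Measure.map_apply hc.measurable measurableSet_Ici, Measure.restrict_apply measurableSet_Ici]
  set L := ν.real univ with hL
  have hUL : ∀ x, ν.real (Ioi x) ≤ L := fun x => measureReal_mono (subset_univ _)
  have hLof : ν univ = ENNReal.ofReal L := by simp [hL, Measure.real]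
  rcases le_or_gt t 0 with ht | ht
  · have e1 : (fun x => ν.real (Ioi x)) ⁻¹' Ici t = univ :=
      eq_univ_of_forall fun x => ht.trans measureReal_nonneg
    have e2 : Ici t ∩ Ioo 0 L = Ioo 0 L :=
      inter_eq_right.2 fun x hx => ht.trans hx.1.le
    rw [e1, e2, Real.volume_Ioo, sub_zero, hLof]
  have e2 : Ici t ∩ Ioo 0 L = Ico t L := by
    ext x
    simp only [mem_inter_iff, mem_Ici, mem_Ioo, mem_Ico]
    exact ⟨fun h => ⟨h.1, h.2.2⟩, fun h => ⟨h.1, ht.trans_le h.1, h.2⟩⟩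
  rw [e2, Real.volume_Ico]
  have hsplit : ∀ x, ν.real (Ioi x) + ν.real (Iic x) = L := fun x => by
    have h := measureReal_add_measureReal_compl (μ := ν) (s := Ioi x) measurableSet_Ioi
    rwa [compl_Ioi] at h
  set E := (fun x => ν.real (Ioi x)) ⁻¹' Ici t with hE
  have hclosed : IsClosed E := isClosed_Ici.preimage hc
  rcases eq_empty_or_nonempty E with h | hne
  -- If no tail reaches t, letting x tend to -∞ gives L ≤ t, so both measures of [t, ∞) vanish.
  · have hlt : ∀ x, ν.real (Ioi x) < t := fun x => by
      by_contra hx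
      exact (h ▸ (show x ∈ E from not_lt.1 hx) : x ∈ (∅ : Set ℝ))
    have h2 := (ENNReal.tendsto_toReal (measure_ne_top ν univ)).comp (tendsto_measure_Ici_atBot ν)
    have h3 : L ≤ t := le_of_tendsto' h2 fun x => by
      have := (hlt x).le
      rw [Measure.real, Ioi_ae_eq_Ici.measure_eq] at this
      exact this
    rw [h, measure_empty, ENNReal.ofReal_of_nonpos (by linarith)]
  · obtain ⟨b, hb⟩ : ∃ b, ν.real (Ioi b) < t := by
      have h2 := (ENNReal.tendsto_toReal (measure_ne_top ν univ)).comp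
        (tendsto_measure_Iic_atTop ν)
      have h3 : L - t < (ν univ).toReal := by change L - t < L; linarith
      obtain ⟨b, hb⟩ := (h2.eventually (lt_mem_nhds h3)).exists
      have : L - t < ν.real (Iic b) := hb
      exact ⟨b, by linarith [hsplit b]⟩
    have hbdd : BddAbove E := ⟨b, fun x hx => le_of_not_gt fun hbx =>
      absurd (hanti hbx.le) (not_le.2 (hb.trans_le hx))⟩
    have hmem : sSup E ∈ E := hclosed.csSup_mem hne hbdd
    have hEq : E = Iic (sSup E) := by
      ext x
      exact ⟨fun hx => le_csSup hbdd hx, fun hx => le_trans (show t ≤ _ from hmem) (hanti hx)⟩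
    -- Just to the right of sup E the tail is below t, so by continuity the tail at sup E is exactly
    -- t.
    have hval : ν.real (Ioi (sSup E)) = t := by
      refine le_antisymm ?_ hmem
      refine le_of_tendsto (x := nhdsWithin (sSup E) (Ioi (sSup E)))
        (hc.continuousAt.continuousWithinAt) ?_
      filter_upwards [self_mem_nhdsWithin] with x hx
      by_contra hcon
      exact absurd (le_csSup hbdd (show x ∈ E from (not_le.1 hcon).le)) (not_le.2 hx)
    have hreal : ν.real (Iic (sSup E)) = L - t := by linarith [hsplit (sSup E)]
    rw [hEq, ← hreal, Measure.real, ENNReal.ofReal_toReal (measure_ne_top _ _)]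

lemma lintegral_comp_measureReal_Ioi (ν : Measure ℝ) [IsFiniteMeasure ν] [NullSingletonClass ν]
    {H : ℝ → ℝ≥0∞} (hH : Measurable H) :
    ∫⁻ x, H (ν.real (Ioi x)) ∂ν = ∫⁻ u in Ioo 0 (ν.real univ), H u := by
  rw [← map_measureReal_Ioi, lintegral_map hH (continuous_measureReal_Ioi ν).measurable]

/-- Up to a null set, an upper set is the union of the half-lines `(q, ∞)` with `q` a rational
element of it. -/
lemma measure_sdiff_iUnion_Ioi (ν : Measure ℝ) [NullSingletonClass ν] {S : ℝ → Prop}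
    (hS : ∀ x y, x ≤ y → S x → S y) :
    ν ({x | S x} \ ⋃ q : {q : ℚ // S (q : ℝ)}, Ioi (q.1 : ℝ)) = 0 := by
  -- The difference has at most one point: a rational strictly between two of its points would put
  -- the larger one in the union.
  have key : ∀ x ∈ {x | S x} \ ⋃ q : {q : ℚ // S (q : ℝ)}, Ioi (q.1 : ℝ),
      ∀ y ∈ {x | S x} \ ⋃ q : {q : ℚ // S (q : ℝ)}, Ioi (q.1 : ℝ), ¬ x < y := by
    rintro x ⟨hx, -⟩ y ⟨-, hy⟩ hxy
    obtain ⟨q, hxq, hqy⟩ := exists_rat_btwn hxy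
    exact hy (mem_iUnion.2 ⟨⟨q, hS x q hxq.le hx⟩, hqy⟩)
  exact Subsingleton.measure_zero (fun x hx y hy =>
    le_antisymm (not_lt.1 (key y hy x hx)) (not_lt.1 (key x hx y hy))) ν

/-- For a measure whose tails are almost everywhere finite, the image under the tail function is
dominated by Lebesgue measure on the half-line. -/
lemma lintegral_comp_tail_le (ν : Measure ℝ) [NullSingletonClass ν]
    (hfin : ∀ᵐ x ∂ν, ν (Ioi x) < ∞) {H : ℝ → ℝ≥0∞} (hH : Measurable H) :
    ∫⁻ x, H ((ν (Ioi x)).toReal) ∂ν ≤ ∫⁻ u in Ioi 0, H u := by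
  -- finite tails
  have hstep : ∀ a, ν (Ioi a) < ∞ →
      ∫⁻ x in Ioi a, H ((ν (Ioi x)).toReal) ∂ν ≤ ∫⁻ u in Ioi 0, H u := by
    intro a ha
    have : IsFiniteMeasure (ν.restrict (Ioi a)) := ⟨by simpa using ha⟩
    have h := lintegral_comp_measureReal_Ioi (ν.restrict (Ioi a)) hH
    -- For x > a the tail does not see the restriction to (a, ∞), so the finite-measure statement
    -- applies.
    have e : ∫⁻ x in Ioi a, H ((ν (Ioi x)).toReal) ∂ν =
        ∫⁻ x in Ioi a, H ((ν.restrict (Ioi a)).real (Ioi x)) ∂ν := by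
      refine setLIntegral_congr_fun measurableSet_Ioi fun x hx => ?_
      have hx' : a < x := hx
      simp only [Measure.real]
      rw [Measure.restrict_apply measurableSet_Ioi, Ioi_inter_Ioi, sup_eq_left.2 hx'.le]
    rw [e, h]
    exact lintegral_mono_set Ioo_subset_Ioi_self
  -- Rational half-lines of finite mass form a directed family that exhausts ν up to a null set.
  let s : {q : ℚ // ν (Ioi (q : ℝ)) < ∞} → Set ℝ := fun q => Ioi (q.1 : ℝ)
  have hdir : Directed (· ⊆ ·) s := by
    intro p q
    rcases le_total p.1 q.1 with h | h
    · exact ⟨p, subset_rfl, Ioi_subset_Ioi (by exact_mod_cast h)⟩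
    · exact ⟨q, Ioi_subset_Ioi (by exact_mod_cast h), subset_rfl⟩
  have hnull : ν (⋃ q, s q)ᶜ = 0 := by
    refine measure_mono_null (t := ({x | ν (Ioi x) < ∞} \ ⋃ q, s q) ∪ {x | ν (Ioi x) < ∞}ᶜ)
      (fun x hx => ?_) (measure_union_null (measure_sdiff_iUnion_Ioi ν
        fun x y hxy hx => (measure_mono (Ioi_subset_Ioi hxy)).trans_lt hx) hfin)
    by_cases h : ν (Ioi x) < ∞
    · exact Or.inl ⟨h, hx⟩
    · exact Or.inr h
  have hU : ∫⁻ x, H ((ν (Ioi x)).toReal) ∂ν =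
      ∫⁻ x in ⋃ q, s q, H ((ν (Ioi x)).toReal) ∂ν := by
    rw [← lintegral_add_compl _ (MeasurableSet.iUnion fun q => measurableSet_Ioi :
      MeasurableSet (⋃ q, s q)), setLIntegral_measure_zero _ _ hnull, add_zero]
  rw [hU, setLIntegral_iUnion_of_directed _ hdir]
  exact iSup_le fun q => hstep _ q.2

lemma ENNReal.ofReal_mul_rpow {c : ℝ} (hc : 0 < c) (a : ℝ≥0∞) (z : ℝ) :
    (ENNReal.ofReal c * a) ^ z = ENNReal.ofReal (c ^ z) * a ^ z := by
  rw [ENNReal.mul_rpow_eq_ite, if_neg, ENNReal.ofReal_rpow_of_pos hc]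
  simp [hc]

/-! ### Weighted tails -/

/-- The tail `∫_x^∞ w dμ`. -/
noncomputable def tailInt (μ : Measure ℝ) (w : ℝ → ℝ) (x : ℝ) : ℝ≥0∞ :=
  ∫⁻ v in Ioi x, ENNReal.ofReal (w v) ∂μ

/-- The power mean `(∫ w^(1-l) dμ)^(1/(1-l))` of a weight; the geometric mean for `l = 1`. -/
noncomputable def weightPower (μ : Measure ℝ) (l : ℝ) (w : ℝ → ℝ) : ℝ≥0∞ :=
  if l = 1 then ENNReal.ofReal (Real.exp (∫ x, Real.log (w x) ∂μ))
  else (∫⁻ x, ENNReal.ofReal (w x) ^ (1 - l) ∂μ) ^ (1 / (1 - l))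

/-- The moment of order `r` of the tail. -/
noncomputable def tailMoment (μ : Measure ℝ) (r : ℝ) (w : ℝ → ℝ) : ℝ≥0∞ :=
  ∫⁻ x, tailInt μ w x ^ r ∂μ

lemma tailInt_const_mul (μ : Measure ℝ) (w : ℝ → ℝ) {c : ℝ} (hc : 0 < c) (x : ℝ) :
    tailInt μ (fun v => c * w v) x = ENNReal.ofReal c * tailInt μ w x := by
  simp_rw [tailInt, ENNReal.ofReal_mul hc.le]
  exact lintegral_const_mul' _ _ ENNReal.ofReal_ne_top

lemma tailMoment_const_mul (μ : Measure ℝ) (r : ℝ) (w : ℝ → ℝ) {c : ℝ} (hc : 0 < c) :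
    tailMoment μ r (fun v => c * w v) = ENNReal.ofReal (c ^ r) * tailMoment μ r w := by
  simp_rw [tailMoment, tailInt_const_mul μ w hc, ENNReal.ofReal_mul_rpow hc]
  exact lintegral_const_mul' _ _ ENNReal.ofReal_ne_top

lemma weightPower_const_mul (μ : Measure ℝ) [IsProbabilityMeasure μ] (l : ℝ) {w : ℝ → ℝ}
    (hpos : ∀ᵐ x ∂μ, 0 < w x) (hlog : l = 1 → Integrable (fun x => Real.log (w x)) μ)
    {c : ℝ} (hc : 0 < c) :
    weightPower μ l (fun v => c * w v) = ENNReal.ofReal c * weightPower μ l w := by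
  unfold weightPower
  split_ifs with h
  · have e : ∫ x, Real.log (c * w x) ∂μ = ∫ x, (Real.log c + Real.log (w x)) ∂μ :=
      integral_congr_ae (hpos.mono fun x hx => Real.log_mul hc.ne' hx.ne')
    rw [e, integral_add (integrable_const _) (hlog h), integral_const, Real.exp_add,
      ← ENNReal.ofReal_mul hc.le]
    simp [Real.exp_log hc]
  · have h1 : 1 - l ≠ 0 := sub_ne_zero.2 (Ne.symm h)
    simp_rw [ENNReal.ofReal_mul hc.le, ENNReal.ofReal_mul_rpow hc]
    rw [lintegral_const_mul' _ _ ENNReal.ofReal_ne_top,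
      ENNReal.ofReal_mul_rpow (Real.rpow_pos_of_pos hc _), ← Real.rpow_mul hc.le,
      mul_one_div_cancel h1, Real.rpow_one]

section Tail

variable {μ : Measure ℝ} [NullSingletonClass μ] {w : ℝ → ℝ}

lemma measurable_tailInt (μ : Measure ℝ) (w : ℝ → ℝ) : Measurable (tailInt μ w) :=
  Antitone.measurable fun _ _ hxy => lintegral_mono_set (Ioi_subset_Ioi hxy)

lemma tailInt_eq_withDensity (μ : Measure ℝ) (w : ℝ → ℝ) (x : ℝ) :
    tailInt μ w x = (μ.withDensity fun v => ENNReal.ofReal (w v)) (Ioi x) :=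
  (withDensity_apply _ measurableSet_Ioi).symm

omit [NullSingletonClass μ] in
lemma lintegral_withDensity_ofReal (hw : Measurable w) {F : ℝ → ℝ≥0∞} (hF : Measurable F) :
    ∫⁻ x, F x ∂(μ.withDensity fun v => ENNReal.ofReal (w v)) =
      ∫⁻ x, F x * ENNReal.ofReal (w x) ∂μ := by
  rw [lintegral_withDensity_eq_lintegral_mul _ hw.ennreal_ofReal hF]
  exact lintegral_congr fun x => mul_comm _ _

lemma nullSingletonClass_withDensity (μ : Measure ℝ) [NullSingletonClass μ] (W : ℝ → ℝ≥0∞) :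
    NullSingletonClass (μ.withDensity W) :=
  ⟨fun _ => withDensity_absolutelyContinuous _ _ (measure_singleton _)⟩

omit [NullSingletonClass μ] in
lemma ae_of_ae_withDensity (hw : Measurable w) (hpos : ∀ᵐ x ∂μ, 0 < w x) {S : ℝ → Prop}
    (h : ∀ᵐ x ∂(μ.withDensity fun v => ENNReal.ofReal (w v)), S x) : ∀ᵐ x ∂μ, S x := by
  rw [ae_withDensity_iff hw.ennreal_ofReal] at h
  filter_upwards [h, hpos] with x h1 h2
  exact h1 (by simpa using h2)

/-- The points with vanishing tail form an upper set. The half-lines starting at its rational points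
are null for w dμ, and the rest is null as well; positivity of w transfers this to μ. -/
lemma tailInt_pos (hw : Measurable w) (hpos : ∀ᵐ x ∂μ, 0 < w x) :
    ∀ᵐ x ∂μ, 0 < tailInt μ w x := by
  refine ae_of_ae_withDensity hw hpos ?_
  set ν := μ.withDensity fun v => ENNReal.ofReal (w v) with hν
  have : NullSingletonClass ν := nullSingletonClass_withDensity _ _
  have h1 := measure_sdiff_iUnion_Ioi ν (S := fun x => ν (Ioi x) = 0)
    fun x y hxy hx => measure_mono_null (Ioi_subset_Ioi hxy) hx
  have h2 : ν (⋃ q : {q : ℚ // ν (Ioi (q : ℝ)) = 0}, Ioi (q.1 : ℝ)) = 0 :=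
    measure_iUnion_null fun q => q.2
  refine measure_mono_null (fun x hx => ?_) (measure_union_null h1 h2)
  have hx' : ν (Ioi x) = 0 := by
    have : ¬ 0 < tailInt μ w x := hx
    rw [tailInt_eq_withDensity] at this
    exact nonpos_iff_eq_zero.1 (not_lt.1 this)
  by_cases h : x ∈ ⋃ q : {q : ℚ // ν (Ioi (q : ℝ)) = 0}, Ioi (q.1 : ℝ)
  · exact Or.inr h
  · exact Or.inl ⟨hx', h⟩

/-- The substitution u = tail, |du| = w dμ. Only an inequality, because the tails need not reach all
of (0, ∞). -/
lemma lintegral_comp_tailInt_mul_le (hw : Measurable w) (hfin : ∀ᵐ x ∂μ, tailInt μ w x < ∞)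
    {H : ℝ → ℝ≥0∞} (hH : Measurable H) :
    ∫⁻ x, H (tailInt μ w x).toReal * ENNReal.ofReal (w x) ∂μ ≤ ∫⁻ u in Ioi 0, H u := by
  have : NullSingletonClass (μ.withDensity fun v => ENNReal.ofReal (w v)) :=
    nullSingletonClass_withDensity _ _
  rw [← lintegral_withDensity_ofReal hw
    (F := fun x => H (tailInt μ w x).toReal) (hH.comp (measurable_tailInt μ w).ennreal_toReal)]
  simp_rw [tailInt_eq_withDensity]
  refine lintegral_comp_tail_le _ ?_ hH
  simp_rw [tailInt_eq_withDensity] at hfin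
  exact (withDensity_absolutelyContinuous _ _).ae_le hfin

/-- For finite total mass L the substitution is exact on (0, L). The mirrored range needs a lower
bound here, which the general inequality does not give. -/
lemma lintegral_comp_tailInt_mul (hw : Measurable w) {L : ℝ} (hL0 : 0 ≤ L)
    (hL : ∫⁻ x, ENNReal.ofReal (w x) ∂μ = ENNReal.ofReal L)
    {H : ℝ → ℝ≥0∞} (hH : Measurable H) :
    ∫⁻ x, H (tailInt μ w x).toReal * ENNReal.ofReal (w x) ∂μ = ∫⁻ u in Ioo 0 L, H u := by
  set ν := μ.withDensity fun v => ENNReal.ofReal (w v) with hν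
  have : NullSingletonClass ν := nullSingletonClass_withDensity _ _
  have huniv : ν univ = ENNReal.ofReal L := by rw [hν, withDensity_apply _ MeasurableSet.univ]; simpa
  have : IsFiniteMeasure ν := ⟨by rw [huniv]; exact ENNReal.ofReal_lt_top⟩
  rw [← lintegral_withDensity_ofReal hw
    (F := fun x => H (tailInt μ w x).toReal) (hH.comp (measurable_tailInt μ w).ennreal_toReal)]
  simp_rw [tailInt_eq_withDensity]
  have h := lintegral_comp_measureReal_Ioi ν hH
  rwa [Measure.real, huniv, ENNReal.toReal_ofReal hL0] at h

lemma tailInt_mem_Ioo (hw : Measurable w) (hpos : ∀ᵐ x ∂μ, 0 < w x) {L : ℝ} (hL0 : 0 ≤ L)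
    (hL : ∫⁻ x, ENNReal.ofReal (w x) ∂μ = ENNReal.ofReal L) :
    ∀ᵐ x ∂μ, (tailInt μ w x).toReal ∈ Ioo 0 L := by
  -- Testing with the indicator of the complement of (0, L) shows that the tail lies there only on a
  -- null set.
  have h := lintegral_comp_tailInt_mul hw hL0 hL
    (H := (Ioo 0 L)ᶜ.indicator fun _ => 1) (measurable_const.indicator measurableSet_Ioo.compl)
  rw [setLIntegral_congr_fun measurableSet_Ioo (g := fun _ => 0) (fun u hu => by simp [hu]),
    lintegral_zero, lintegral_eq_zero_iff] at h
  · filter_upwards [h, hpos] with x h1 h2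
    by_contra hx
    simp only [Pi.zero_apply, mul_eq_zero] at h1
    rcases h1 with h1 | h1
    · rw [indicator_of_mem hx] at h1
      simp at h1
    · simp at h1
      linarith
  · exact ((measurable_const.indicator measurableSet_Ioo.compl).comp
      (measurable_tailInt μ w).ennreal_toReal).mul hw.ennreal_ofReal

/-! ### Tangent inequalities -/

/-- The tangent at t = 1/G to t ↦ t^(1-l), convex for l > 1, in the form of weighted AM-GM. The
value G = 0 is allowed because the reference profile has bounded support when l > 1. -/
lemma rpow_tangent_of_one_lt {l w G : ℝ} (hl : 1 < l) (hw : 0 < w) (hG : 0 ≤ G) :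
    l * G ^ (l - 1) ≤ w ^ (1 - l) + (l - 1) * (G ^ l * w) := by
  have h0 : 0 < l := by linarith
  have hx : 0 ≤ w ^ (1 - l) := Real.rpow_nonneg hw.le _
  have hy : 0 ≤ G ^ l * w := mul_nonneg (Real.rpow_nonneg hG _) hw.le
  have h := Real.geom_mean_le_arith_mean2_weighted (w₁ := 1 / l) (w₂ := (l - 1) / l)
    (by positivity) (div_nonneg (by linarith) h0.le) hx hy (by field_simp; ring)
  have e : (w ^ (1 - l)) ^ (1 / l) * (G ^ l * w) ^ ((l - 1) / l) = G ^ (l - 1) := by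
    rw [Real.mul_rpow (Real.rpow_nonneg hG _) hw.le, ← Real.rpow_mul hw.le, ← Real.rpow_mul hG,
      mul_left_comm, ← Real.rpow_add hw]
    rw [show l * ((l - 1) / l) = l - 1 by field_simp,
      show (1 - l) * (1 / l) + (l - 1) / l = 0 by field_simp; ring]
    simp
  rw [e] at h
  calc l * G ^ (l - 1) ≤ l * (1 / l * w ^ (1 - l) + (l - 1) / l * (G ^ l * w)) := by gcongr
    _ = _ := by field_simp

/-- The same tangent with t ↦ t^(1-l) concave, so the inequality is reversed. -/
lemma rpow_tangent_of_lt_one {l w G : ℝ} (hl0 : 0 < l) (hl : l < 1) (hw : 0 < w) (hG : 0 < G) :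
    w ^ (1 - l) ≤ (1 - l) * (G ^ l * w) + l * G ^ (l - 1) := by
  have h := Real.geom_mean_le_arith_mean2_weighted (w₁ := 1 - l) (w₂ := l)
    (by linarith) hl0.le (mul_nonneg (Real.rpow_nonneg hG.le l) hw.le)
    (Real.rpow_nonneg hG.le (l - 1)) (by ring)
  have e : (G ^ l * w) ^ (1 - l) * (G ^ (l - 1)) ^ l = w ^ (1 - l) := by
    rw [Real.mul_rpow (Real.rpow_nonneg hG.le _) hw.le, ← Real.rpow_mul hG.le,
      ← Real.rpow_mul hG.le, mul_right_comm, ← Real.rpow_add hG,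
      show l * (1 - l) + (l - 1) * l = 0 by ring]
    simp
  rwa [e] at h

/-- The same tangent, convex again; the term in G^(l-1) changes sides because its coefficient l is
negative. -/
lemma rpow_tangent_of_neg {l w G : ℝ} (hl : l < 0) (hw : 0 < w) (hG : 0 < G) :
    (1 - l) * (G ^ l * w) ≤ w ^ (1 - l) + -l * G ^ (l - 1) := by
  have h0 : 0 < 1 - l := by linarith
  have h := Real.geom_mean_le_arith_mean2_weighted (w₁ := 1 / (1 - l)) (w₂ := -l / (1 - l))
    (by positivity) (div_nonneg (by linarith) h0.le) (Real.rpow_nonneg hw.le (1 - l))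
    (Real.rpow_nonneg hG.le (l - 1)) (by field_simp; ring)
  have e : (w ^ (1 - l)) ^ (1 / (1 - l)) * (G ^ (l - 1)) ^ (-l / (1 - l)) = G ^ l * w := by
    rw [← Real.rpow_mul hw.le, ← Real.rpow_mul hG.le, mul_one_div_cancel h0.ne', Real.rpow_one,
      show (l - 1) * (-l / (1 - l)) = l by field_simp; ring, mul_comm]
  rw [e] at h
  calc (1 - l) * (G ^ l * w)
      ≤ (1 - l) * (1 / (1 - l) * w ^ (1 - l) + -l / (1 - l) * G ^ (l - 1)) := by gcongr
    _ = _ := by field_simp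

end Tail

/-! ### Tangent inequalities integrated along the tail -/

section Normalized

variable {μ : Measure ℝ} [IsProbabilityMeasure μ] [NullSingletonClass μ] {w : ℝ → ℝ}
  {l r k X : ℝ} {G : ℝ → ℝ}

omit [IsProbabilityMeasure μ] [NullSingletonClass μ] in
lemma tailInt_lt_top_of_tailMoment (hr : 0 < r) (hB : tailMoment μ r w ≠ ∞) :
    ∀ᵐ x ∂μ, tailInt μ w x < ∞ := by
  filter_upwards [ae_lt_top ((measurable_tailInt μ w).pow_const r) hB] with x hx
  exact (ENNReal.rpow_lt_top_iff_of_pos hr).1 hx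

lemma ENNReal.rpow_eq_ofReal_toReal_rpow {a : ℝ≥0∞} (h0 : 0 < a) (h : a < ∞) (z : ℝ) :
    a ^ z = ENNReal.ofReal (a.toReal ^ z) := by
  rw [← ENNReal.ofReal_rpow_of_pos (ENNReal.toReal_pos h0.ne' h.ne), ENNReal.ofReal_toReal h.ne]

/-- With A = k(1 - (l-1)X), the tangent inequality integrates to l·A ≤ ∫ w^(1-l) dμ + (l-1)·A: the
mean of the affine minorant of G(u)^(l-1) is fixed by the tail moment X, and ∫ G(u)^l w dμ ≤ A. The
hypothesis `hG` is an inequality since the affine function is negative beyond the support of G. -/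
lemma lintegral_rpow_ge_of_one_lt (hw : Measurable w) (hpos : ∀ᵐ x ∂μ, 0 < w x)
    (hl : 1 < l) (hr : 0 < r) (hk : 0 ≤ k) (hX : 0 ≤ X)
    (hGm : Measurable G) (hG0 : ∀ u, 0 ≤ G u)
    (hG : ∀ u, 0 < u → k * (1 - (l - 1) * u ^ r) ≤ G u ^ (l - 1))
    (hA0 : 0 ≤ k * (1 - (l - 1) * X))
    (hA : ∫⁻ u in Ioi 0, ENNReal.ofReal (G u ^ l) = ENNReal.ofReal (k * (1 - (l - 1) * X)))
    (hB : tailMoment μ r w = ENNReal.ofReal X) :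
    ENNReal.ofReal (k * (1 - (l - 1) * X)) ≤ ∫⁻ x, ENNReal.ofReal (w x) ^ (1 - l) ∂μ := by
  have hfin := tailInt_lt_top_of_tailMoment (μ := μ) (w := w) hr (by rw [hB]; simp)
  have hl1 : 0 ≤ l - 1 := by linarith
  -- The negative part of the affine minorant is moved to the right, so that every integrand is
  -- nonnegative.
  have h1 : ENNReal.ofReal (l * k) ≤ ∫⁻ x, (ENNReal.ofReal (w x) ^ (1 - l) +
      (ENNReal.ofReal (l - 1) * (ENNReal.ofReal (G (tailInt μ w x).toReal ^ l) *
        ENNReal.ofReal (w x)) + ENNReal.ofReal (l * k * (l - 1)) * tailInt μ w x ^ r)) ∂μ := by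
    calc ENNReal.ofReal (l * k) = ∫⁻ _x, ENNReal.ofReal (l * k) ∂μ := by simp
      _ ≤ _ := by
        refine lintegral_mono_ae ?_
        filter_upwards [hpos, hfin, tailInt_pos hw hpos] with x hx hf h0
        have hu : 0 < (tailInt μ w x).toReal := ENNReal.toReal_pos h0.ne' hf.ne
        rw [ENNReal.rpow_eq_ofReal_toReal_rpow h0 hf, ENNReal.ofReal_rpow_of_pos hx]
        set u := (tailInt μ w x).toReal
        have hGl : 0 ≤ G u ^ l := Real.rpow_nonneg (hG0 _) _
        have hw1 : 0 ≤ w x ^ (1 - l) := Real.rpow_nonneg hx.le _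
        have hur : 0 ≤ u ^ r := Real.rpow_nonneg hu.le _
        rw [← ENNReal.ofReal_mul hGl, ← ENNReal.ofReal_mul hl1,
          ← ENNReal.ofReal_mul (by positivity), ← ENNReal.ofReal_add (by positivity) (by positivity),
          ← ENNReal.ofReal_add (by positivity) (by positivity)]
        refine ENNReal.ofReal_le_ofReal ?_
        have := rpow_tangent_of_one_lt hl hx (hG0 u)
        have h2 := hG u hu
        have h3 : l * (k * (1 - (l - 1) * u ^ r)) ≤ l * G u ^ (l - 1) := by gcongr
        linarith
  have hI := lintegral_comp_tailInt_mul_le hw hfin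
    (H := fun u => ENNReal.ofReal (G u ^ l)) (hGm.pow_const l).ennreal_ofReal
  rw [hA] at hI
  have m1 : Measurable fun x => ENNReal.ofReal (w x) ^ (1 - l) :=
    hw.ennreal_ofReal.pow_const _
  have m2 : Measurable fun x => ENNReal.ofReal (l - 1) *
      (ENNReal.ofReal (G (tailInt μ w x).toReal ^ l) * ENNReal.ofReal (w x)) :=
    ((((hGm.comp (measurable_tailInt μ w).ennreal_toReal).pow_const l).ennreal_ofReal).mul
      hw.ennreal_ofReal).const_mul _
  rw [lintegral_add_left m1, lintegral_add_left m2, lintegral_const_mul' _ _ ENNReal.ofReal_ne_top,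
    lintegral_const_mul' _ _ ENNReal.ofReal_ne_top] at h1
  change _ ≤ _ + (_ + _ * tailMoment μ r w) at h1
  rw [hB] at h1
  by_cases hAtop : ∫⁻ x, ENNReal.ofReal (w x) ^ (1 - l) ∂μ = ∞
  · rw [hAtop]; exact le_top
  have h2 : ENNReal.ofReal (l * k) ≤ (∫⁻ x, ENNReal.ofReal (w x) ^ (1 - l) ∂μ) +
      (ENNReal.ofReal (l - 1) * ENNReal.ofReal (k * (1 - (l - 1) * X)) +
        ENNReal.ofReal (l * k * (l - 1)) * ENNReal.ofReal X) := by
    refine h1.trans ?_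
    gcongr
  rw [← ENNReal.ofReal_toReal hAtop] at h2 ⊢
  have hl0 : 0 < l := by linarith
  rw [← ENNReal.ofReal_mul hl1, ← ENNReal.ofReal_mul (by positivity),
    ← ENNReal.ofReal_add (by positivity) (by positivity),
    ← ENNReal.ofReal_add ENNReal.toReal_nonneg (by positivity),
    ENNReal.ofReal_le_ofReal_iff (by positivity)] at h2
  refine ENNReal.ofReal_le_ofReal ?_
  nlinarith

/-- The concave counterpart: with the same A, the tangent inequality integrates to ∫ w^(1-l) dμ ≤
(1-l)·A + l·A. -/
lemma lintegral_rpow_le_of_lt_one (hw : Measurable w) (hpos : ∀ᵐ x ∂μ, 0 < w x)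
    (hl0 : 0 < l) (hl : l < 1) (hr : 0 < r) (hk : 0 ≤ k) (hX : 0 ≤ X)
    (hGm : Measurable G) (hG0 : ∀ u, 0 < u → 0 < G u)
    (hG : ∀ u, 0 < u → G u ^ (l - 1) = k * (1 - (l - 1) * u ^ r))
    (hA : ∫⁻ u in Ioi 0, ENNReal.ofReal (G u ^ l) = ENNReal.ofReal (k * (1 - (l - 1) * X)))
    (hB : tailMoment μ r w = ENNReal.ofReal X) :
    ∫⁻ x, ENNReal.ofReal (w x) ^ (1 - l) ∂μ ≤ ENNReal.ofReal (k * (1 - (l - 1) * X)) := by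
  have hfin := tailInt_lt_top_of_tailMoment (μ := μ) (w := w) hr (by rw [hB]; simp)
  have hl1 : 0 ≤ 1 - l := by linarith
  have h1 : ∫⁻ x, ENNReal.ofReal (w x) ^ (1 - l) ∂μ ≤ ∫⁻ x, (
      (ENNReal.ofReal (1 - l) * (ENNReal.ofReal (G (tailInt μ w x).toReal ^ l) *
        ENNReal.ofReal (w x)) + (ENNReal.ofReal (l * k) +
          ENNReal.ofReal (l * k * (1 - l)) * tailInt μ w x ^ r))) ∂μ := by
    refine lintegral_mono_ae ?_
    filter_upwards [hpos, hfin, tailInt_pos hw hpos] with x hx hf h0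
    have hu : 0 < (tailInt μ w x).toReal := ENNReal.toReal_pos h0.ne' hf.ne
    rw [ENNReal.rpow_eq_ofReal_toReal_rpow h0 hf, ENNReal.ofReal_rpow_of_pos hx]
    set u := (tailInt μ w x).toReal
    have hGl : 0 ≤ G u ^ l := Real.rpow_nonneg (hG0 _ hu).le _
    have hur : 0 ≤ u ^ r := Real.rpow_nonneg hu.le _
    rw [← ENNReal.ofReal_mul hGl, ← ENNReal.ofReal_mul hl1,
      ← ENNReal.ofReal_mul (by positivity), ← ENNReal.ofReal_add (by positivity) (by positivity),
      ← ENNReal.ofReal_add (by positivity) (by positivity)]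
    refine ENNReal.ofReal_le_ofReal ?_
    have := rpow_tangent_of_lt_one hl0 hl hx (hG0 u hu)
    rw [hG u hu] at this
    linarith
  have hI := lintegral_comp_tailInt_mul_le hw hfin
    (H := fun u => ENNReal.ofReal (G u ^ l)) (hGm.pow_const l).ennreal_ofReal
  rw [hA] at hI
  have m2 : Measurable fun x => ENNReal.ofReal (1 - l) *
      (ENNReal.ofReal (G (tailInt μ w x).toReal ^ l) * ENNReal.ofReal (w x)) :=
    ((((hGm.comp (measurable_tailInt μ w).ennreal_toReal).pow_const l).ennreal_ofReal).mul
      hw.ennreal_ofReal).const_mul _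
  rw [lintegral_add_left m2, lintegral_add_left measurable_const,
    lintegral_const_mul' _ _ ENNReal.ofReal_ne_top,
    lintegral_const_mul' _ _ ENNReal.ofReal_ne_top] at h1
  change _ ≤ _ + (_ + _ * tailMoment μ r w) at h1
  rw [hB, lintegral_const, measure_univ, mul_one] at h1
  have hA0 : 0 ≤ k * (1 - (l - 1) * X) := by
    have : 0 ≤ (1 - l) * X := by positivity
    refine mul_nonneg hk ?_
    linarith
  calc _ ≤ _ := h1
    _ ≤ ENNReal.ofReal (1 - l) * ENNReal.ofReal (k * (1 - (l - 1) * X)) +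
      (ENNReal.ofReal (l * k) + ENNReal.ofReal (l * k * (1 - l)) * ENNReal.ofReal X) := by gcongr
    _ = _ := by
      rw [← ENNReal.ofReal_mul hl1, ← ENNReal.ofReal_mul (by positivity),
        ← ENNReal.ofReal_add (by positivity) (by positivity),
        ← ENNReal.ofReal_add (by positivity) (by positivity)]
      congr 1
      ring

/-- Gibbs' inequality: log F ≤ F - 1 for F = k·exp(-u^r)·w, whose integral is at most 1 by the
change of variable. -/
lemma integral_log_le (hw : Measurable w) (hpos : ∀ᵐ x ∂μ, 0 < w x)
    (hr : 0 < r) (hk : 0 < k) (hX : 0 ≤ X)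
    (hlog : Integrable (fun x => Real.log (w x)) μ)
    (hA : ∫⁻ u in Ioi (0 : ℝ), ENNReal.ofReal (k * Real.exp (-(u ^ r))) = 1)
    (hB : tailMoment μ r w = ENNReal.ofReal X) :
    ∫ x, Real.log (w x) ∂μ ≤ X - Real.log k := by
  have hfin := tailInt_lt_top_of_tailMoment (μ := μ) (w := w) hr (by rw [hB]; simp)
  have mu : Measurable fun x => (tailInt μ w x).toReal := (measurable_tailInt μ w).ennreal_toReal
  have hI := lintegral_comp_tailInt_mul_le hw hfin
    (H := fun u => ENNReal.ofReal (k * Real.exp (-(u ^ r)))) (by fun_prop)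
  rw [hA] at hI
  set F : ℝ → ℝ := fun x => k * Real.exp (-((tailInt μ w x).toReal ^ r)) * w x with hF
  have mF : Measurable F := by
    refine Measurable.mul ?_ hw
    exact ((mu.pow_const r).neg.exp).const_mul k
  have hF0 : 0 ≤ᵐ[μ] F := by
    filter_upwards [hpos] with x hx
    simp only [Pi.zero_apply, hF]
    positivity
  have hFl : ∫⁻ x, ENNReal.ofReal (F x) ∂μ ≤ 1 := by
    refine le_trans (le_of_eq ?_) hI
    refine lintegral_congr fun x => ?_
    rw [← ENNReal.ofReal_mul (by positivity)]
  have hFi : Integrable F μ := by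
    refine (lintegral_ofReal_ne_top_iff_integrable mF.aestronglyMeasurable hF0).1 ?_
    exact (hFl.trans_lt ENNReal.one_lt_top).ne
  have hF1 : ∫ x, F x ∂μ ≤ 1 := by
    rw [integral_eq_lintegral_of_nonneg_ae hF0 mF.aestronglyMeasurable]
    exact ENNReal.toReal_le_of_le_ofReal zero_le_one (by simpa using hFl)
  set V : ℝ → ℝ := fun x => (tailInt μ w x).toReal ^ r with hV
  have hV0 : 0 ≤ᵐ[μ] V := Filter.Eventually.of_forall fun x =>
    Real.rpow_nonneg ENNReal.toReal_nonneg _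
  have mV : Measurable V := mu.pow_const r
  have hVl : ∫⁻ x, ENNReal.ofReal (V x) ∂μ = ENNReal.ofReal X := by
    rw [← hB]
    refine lintegral_congr_ae ?_
    filter_upwards [hfin, tailInt_pos hw hpos] with x hf h0
    exact (ENNReal.rpow_eq_ofReal_toReal_rpow h0 hf r).symm
  have hVi : Integrable V μ := by
    refine (lintegral_ofReal_ne_top_iff_integrable mV.aestronglyMeasurable hV0).1 ?_
    rw [hVl]; exact ENNReal.ofReal_ne_top
  have hV1 : ∫ x, V x ∂μ = X := by
    rw [integral_eq_lintegral_of_nonneg_ae hV0 mV.aestronglyMeasurable, hVl,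
      ENNReal.toReal_ofReal hX]
  have hle : ∫ x, Real.log (w x) ∂μ ≤ ∫ x, (F x + V x + (-1 - Real.log k)) ∂μ := by
    refine integral_mono_ae hlog ((hFi.add hVi).add (integrable_const _)) ?_
    filter_upwards [hpos] with x hx
    have h1 : 0 < F x := by simp only [hF]; positivity
    have h2 := Real.log_le_sub_one_of_pos h1
    have h3 : Real.log (F x) = Real.log k - V x + Real.log (w x) := by
      simp only [hF, hV]
      rw [Real.log_mul (by positivity) hx.ne', Real.log_mul hk.ne' (Real.exp_pos _).ne',
        Real.log_exp]
      ring
    linarith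
  have hFV : Integrable (fun x => F x + V x) μ := hFi.add hVi
  rw [integral_add hFV (integrable_const _), integral_add hFi hVi, hV1,
    integral_const] at hle
  simp at hle
  linarith

-- Here the mass of w is prescribed and the moment is not, so the mean of G(u)^(l-1) is kept as an
-- integral.
omit [IsProbabilityMeasure μ] in
lemma lintegral_rpow_ge_of_neg (hw : Measurable w) (hpos : ∀ᵐ x ∂μ, 0 < w x)
    (hl : l < 0) {L : ℝ} (hL0 : 0 ≤ L)
    (hL : ∫⁻ x, ENNReal.ofReal (w x) ∂μ = ENNReal.ofReal L)
    (hGm : Measurable G) (hG0 : ∀ u ∈ Ioo 0 L, 0 < G u) :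
    ENNReal.ofReal (1 - l) * ∫⁻ u in Ioo 0 L, ENNReal.ofReal (G u ^ l) ≤
      ∫⁻ x, ENNReal.ofReal (w x) ^ (1 - l) ∂μ +
        ENNReal.ofReal (-l) * ∫⁻ x, ENNReal.ofReal (G (tailInt μ w x).toReal ^ (l - 1)) ∂μ := by
  have hl1 : 0 ≤ 1 - l := by linarith
  have hl2 : 0 ≤ -l := by linarith
  rw [← lintegral_comp_tailInt_mul hw hL0 hL
    (H := fun u => ENNReal.ofReal (G u ^ l)) (hGm.pow_const l).ennreal_ofReal,
    ← lintegral_const_mul' _ _ ENNReal.ofReal_ne_top,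
    ← lintegral_const_mul' _ _ ENNReal.ofReal_ne_top,
    ← lintegral_add_left (hw.ennreal_ofReal.pow_const _)]
  refine lintegral_mono_ae ?_
  filter_upwards [hpos, tailInt_mem_Ioo hw hpos hL0 hL] with x hx hu
  have hG := hG0 _ hu
  have hGl : 0 ≤ G (tailInt μ w x).toReal ^ l := Real.rpow_nonneg hG.le _
  have hGl' : 0 ≤ G (tailInt μ w x).toReal ^ (l - 1) := Real.rpow_nonneg hG.le _
  rw [ENNReal.ofReal_rpow_of_pos hx, ← ENNReal.ofReal_mul hGl, ← ENNReal.ofReal_mul hl1,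
    ← ENNReal.ofReal_mul hl2, ← ENNReal.ofReal_add (Real.rpow_nonneg hx.le _) (by positivity)]
  exact ENNReal.ofReal_le_ofReal (rpow_tangent_of_neg hl hx hG)

end Normalized

/-! ### Removal of the normalisations by homogeneity -/

section Abstract

variable {μ : Measure ℝ} [IsProbabilityMeasure μ] [NullSingletonClass μ] {w : ℝ → ℝ} {l r : ℝ}

lemma tailMoment_pos (hw : Measurable w) (hpos : ∀ᵐ x ∂μ, 0 < w x) (hr : 0 < r) :
    tailMoment μ r w ≠ 0 := by
  intro h
  rw [tailMoment, lintegral_eq_zero_iff ((measurable_tailInt μ w).pow_const r)] at h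
  have : ∀ᵐ _x ∂μ, False := by
    filter_upwards [h, tailInt_pos hw hpos] with x h1 h2
    simp only [Pi.zero_apply, ENNReal.rpow_eq_zero_iff] at h1
    rcases h1 with h1 | h1
    · exact h2.ne' h1.1
    · linarith [h1.2]
  exact this.exists.elim fun _ h => h

/-- Reduction of the moment-entropy inequality to normalised weights. -/
lemma mul_weightPower_le_of_normalized {X : ℝ} {N : ℝ≥0∞} (hX : 0 < X) (hr : 0 < r)
    (H : ∀ v : ℝ → ℝ, Measurable v → (∀ᵐ x ∂μ, 0 < v x) →
      (l = 1 → Integrable (fun x => Real.log (v x)) μ) →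
      tailMoment μ r v = ENNReal.ofReal X → weightPower μ l v ≤ N)
    (hw : Measurable w) (hpos : ∀ᵐ x ∂μ, 0 < w x)
    (hlog : l = 1 → Integrable (fun x => Real.log (w x)) μ) (hB : tailMoment μ r w ≠ ∞) :
    ENNReal.ofReal X ^ (1 / r) * weightPower μ l w ≤ tailMoment μ r w ^ (1 / r) * N := by
  have hB0 := tailMoment_pos hw hpos hr
  set b := (tailMoment μ r w).toReal with hb
  have hb0 : 0 < b := ENNReal.toReal_pos hB0 hB
  have hBb : tailMoment μ r w = ENNReal.ofReal b := (ENNReal.ofReal_toReal hB).symm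
  -- The tail moment has degree r in the weight, so this c brings its value b to X.
  set c := (X / b) ^ (1 / r) with hc
  have hc0 : 0 < c := Real.rpow_pos_of_pos (div_pos hX hb0) _
  have hcr : c ^ r = X / b := by
    rw [hc, ← Real.rpow_mul (div_pos hX hb0).le, one_div_mul_cancel hr.ne', Real.rpow_one]
  have h := H (fun x => c * w x) (hw.const_mul c) (hpos.mono fun x hx => mul_pos hc0 hx)
    (fun h1 => by
      refine ((integrable_const (Real.log c)).add (hlog h1)).congr ?_
      filter_upwards [hpos] with x hx
      rw [Real.log_mul hc0.ne' hx.ne', Pi.add_apply])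
    (by
      rw [tailMoment_const_mul μ r w hc0, hcr, hBb, ← ENNReal.ofReal_mul (div_pos hX hb0).le,
        div_mul_cancel₀ _ hb0.ne'])
  rw [weightPower_const_mul μ l hpos hlog hc0] at h
  have e : ENNReal.ofReal X ^ (1 / r) = tailMoment μ r w ^ (1 / r) * ENNReal.ofReal c := by
    rw [hBb, ENNReal.ofReal_rpow_of_pos hb0, ENNReal.ofReal_rpow_of_pos hX,
      ← ENNReal.ofReal_mul (Real.rpow_nonneg hb0.le _), hc, Real.div_rpow hX.le hb0.le,
      mul_div_cancel₀ _ (Real.rpow_pos_of_pos hb0 _).ne']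
  rw [e, mul_assoc]
  gcongr

/-- An infinite moment makes the right side infinite unless the form is ∞/∞, which is excluded;
otherwise the product form can be divided out. -/
lemma div_le_tailMoment_div {σ N : ℝ≥0∞} (hw : Measurable w) (hpos : ∀ᵐ x ∂μ, 0 < w x)
    (hr : 0 < r) (hN0 : N ≠ 0) (hN : N ≠ ∞)
    (H : tailMoment μ r w ≠ ∞ →
      σ * weightPower μ l w ≤ tailMoment μ r w ^ (1 / r) * N)
    (hex : ¬ (tailMoment μ r w ^ (1 / r) = ∞ ∧ weightPower μ l w = ∞)) :
    σ / N ≤ tailMoment μ r w ^ (1 / r) / weightPower μ l w := by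
  have hr' : 0 < 1 / r := one_div_pos.2 hr
  have hB0 : tailMoment μ r w ^ (1 / r) ≠ 0 := by
    simp [ENNReal.rpow_eq_zero_iff, tailMoment_pos hw hpos hr, hr.le]
  by_cases hB : tailMoment μ r w = ∞
  · have h1 : tailMoment μ r w ^ (1 / r) = ∞ := by rw [hB, ENNReal.top_rpow_of_pos hr']
    have h2 : weightPower μ l w ≠ ∞ := fun h => hex ⟨h1, h⟩
    rw [h1, ENNReal.top_div_of_ne_top h2]
    exact le_top
  · have h1 : tailMoment μ r w ^ (1 / r) ≠ ∞ := ENNReal.rpow_ne_top_of_nonneg hr'.le hB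
    rw [ENNReal.le_div_iff_mul_le (Or.inr hB0) (Or.inr h1), ENNReal.mul_comm_div, ← mul_div_assoc,
      ENNReal.div_le_iff hN0 hN]
    exact H hB

/-- The Bernoulli inequality for negative exponents. -/
lemma one_sub_mul_le_rpow_neg {b t : ℝ} (hb : 0 < b) (ht : 0 < t ∨ t ≤ -1) :
    1 + t * (1 - b) ≤ b ^ (-t) := by
  rcases ht with ht | ht
  · rw [Real.rpow_def_of_pos hb]
    have h1 := Real.add_one_le_exp (Real.log b * -t)
    have h2 := Real.log_le_sub_one_of_pos hb
    nlinarith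
  · have := one_add_mul_self_le_rpow_one_add (s := b - 1) (by linarith) (p := -t) (by linarith)
    rw [add_sub_cancel] at this
    linarith

-- Since 1 - l > 1, w ≤ 1 + w^(1-l), and the constant 1 has finite integral. Weights of infinite
-- mass, which cannot be normalised, are handled this way.
omit [NullSingletonClass μ] in
lemma lintegral_rpow_eq_top (hl : l < 0)
    (h : ∫⁻ x, ENNReal.ofReal (w x) ∂μ = ∞) : ∫⁻ x, ENNReal.ofReal (w x) ^ (1 - l) ∂μ = ∞ := by
  by_contra hcon
  have : ∫⁻ x, ENNReal.ofReal (w x) ∂μ ≤ ∫⁻ x, (1 + ENNReal.ofReal (w x) ^ (1 - l)) ∂μ := by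
    refine lintegral_mono fun x => ?_
    rcases le_total (ENNReal.ofReal (w x)) 1 with h1 | h1
    · exact h1.trans le_self_add
    · calc ENNReal.ofReal (w x) = ENNReal.ofReal (w x) ^ (1 : ℝ) := (ENNReal.rpow_one _).symm
        _ ≤ ENNReal.ofReal (w x) ^ (1 - l) := ENNReal.rpow_le_rpow_of_exponent_le h1 (by linarith)
        _ ≤ _ := le_add_self
  rw [h, lintegral_add_left measurable_const, top_le_iff] at this
  simp [hcon] at this

/-- The moment-entropy inequality in the mirrored range, for normalised weights. -/
lemma tailMoment_mul_le_of_normalized {S k p B₀ A₀ : ℝ} {G : ℝ → ℝ}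
    (hl : l < 0) (hr : r ≠ 0) (hrl : 0 < r ∨ r + (l - 1) / l > 0)
    (hS : 0 < S) (hk : 0 < k) (hB₀ : B₀ / S ^ r = ((l - 1) / l) / ((l - 1) / l + r))
    (hA₀ : A₀ = k * ((B₀ / S ^ r - 1) / p)) (hA₀' : 0 < A₀)
    (he : ∀ u ∈ Ioo 0 S, 0 < ((u / S) ^ r - 1) / p)
    (hGm : Measurable G) (hG0 : ∀ u ∈ Ioo 0 S, 0 < G u)
    (hG : ∀ u ∈ Ioo 0 S, G u ^ (l - 1) = k * (((u / S) ^ r - 1) / p))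
    (hA : ∫⁻ u in Ioo 0 S, ENNReal.ofReal (G u ^ l) = ENNReal.ofReal A₀)
    (hw : Measurable w) (hpos : ∀ᵐ x ∂μ, 0 < w x)
    (hL : ∫⁻ x, ENNReal.ofReal (w x) ∂μ = ENNReal.ofReal S) (hB : tailMoment μ r w ≠ ∞) :
    tailMoment μ r w ^ (1 / r) * ENNReal.ofReal A₀ ^ (1 / (1 - l)) ≤
      ENNReal.ofReal B₀ ^ (1 / r) * weightPower μ l w := by
  have hm : 0 < (l - 1) / l := div_pos_of_neg_of_neg (by linarith) hl
  set m := (l - 1) / l with hm_def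
  have hmr : 0 < m + r := by rcases hrl with h | h <;> linarith
  have hSr : 0 < S ^ r := Real.rpow_pos_of_pos hS _
  have hB₀' : 0 < B₀ := by
    have : 0 < B₀ / S ^ r := by rw [hB₀]; positivity
    exact (div_pos_iff_of_pos_right hSr).1 this
  have hl1 : l ≠ 1 := by linarith
  rw [weightPower, if_neg hl1]
  by_cases hAtop : ∫⁻ x, ENNReal.ofReal (w x) ^ (1 - l) ∂μ = ∞
  · rw [hAtop, ENNReal.top_rpow_of_pos (one_div_pos.2 (by linarith)), ENNReal.mul_top]
    · exact le_top
    · rw [ENNReal.ofReal_rpow_of_pos hB₀']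
      simpa using Real.rpow_pos_of_pos hB₀' _
  set a := (∫⁻ x, ENNReal.ofReal (w x) ^ (1 - l) ∂μ).toReal with ha
  have hAa : ∫⁻ x, ENNReal.ofReal (w x) ^ (1 - l) ∂μ = ENNReal.ofReal a :=
    (ENNReal.ofReal_toReal hAtop).symm
  have hmem := tailInt_mem_Ioo hw hpos hS.le hL
  have mu : Measurable fun x => (tailInt μ w x).toReal := (measurable_tailInt μ w).ennreal_toReal
  set V : ℝ → ℝ := fun x => (tailInt μ w x).toReal ^ r with hV
  have hV0 : 0 ≤ᵐ[μ] V := Filter.Eventually.of_forall fun x =>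
    Real.rpow_nonneg ENNReal.toReal_nonneg _
  have mV : Measurable V := mu.pow_const r
  have hVl : ∫⁻ x, ENNReal.ofReal (V x) ∂μ = tailMoment μ r w := by
    refine lintegral_congr_ae ?_
    filter_upwards [hmem] with x hx
    have h0 := ENNReal.toReal_pos_iff.1 hx.1
    exact (ENNReal.rpow_eq_ofReal_toReal_rpow h0.1 h0.2 r).symm
  have hVi : Integrable V μ :=
    (lintegral_ofReal_ne_top_iff_integrable mV.aestronglyMeasurable hV0).1 (by rwa [hVl])
  set β := ∫ x, V x ∂μ with hβ
  have hBβ : tailMoment μ r w = ENNReal.ofReal β := by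
    rw [hβ, ofReal_integral_eq_lintegral_ofReal hVi hV0, hVl]
  -- the mean of the reference profile along the tail
  set E := (β / S ^ r - 1) / p with hE
  set E₀ := (B₀ / S ^ r - 1) / p with hE₀
  have hE₀' : 0 < E₀ := by
    rw [hA₀] at hA₀'
    exact (mul_pos_iff_of_pos_left hk).1 hA₀'
  have hei : Integrable (fun x => (((tailInt μ w x).toReal / S) ^ r - 1) / p) μ := by
    refine (((hVi.div_const (S ^ r)).sub (integrable_const 1)).div_const p).congr ?_
    filter_upwards [hmem] with x hx
    simp only [hV, Pi.sub_apply]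
    rw [Real.div_rpow hx.1.le hS.le]
  have heE : ∫ x, (((tailInt μ w x).toReal / S) ^ r - 1) / p ∂μ = E := by
    have : ∫ x, (((tailInt μ w x).toReal / S) ^ r - 1) / p ∂μ =
        ∫ x, (V x / S ^ r - 1) / p ∂μ := by
      refine integral_congr_ae ?_
      filter_upwards [hmem] with x hx
      simp only [hV]
      rw [Real.div_rpow hx.1.le hS.le]
    rw [this, integral_div, integral_sub (hVi.div_const _) (integrable_const _), integral_div]
    simp [hE, hβ]
  have hepos : ∀ᵐ x ∂μ, 0 < (((tailInt μ w x).toReal / S) ^ r - 1) / p :=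
    hmem.mono fun x hx => he _ hx
  have hE' : 0 < E := by
    rw [← heE, integral_pos_iff_support_of_nonneg_ae (hepos.mono fun x hx => hx.le) hei]
    have : μ (Function.support fun x => (((tailInt μ w x).toReal / S) ^ r - 1) / p) = μ univ := by
      refine measure_congr ?_
      filter_upwards [hepos] with x hx
      exact propext ⟨fun _ => trivial, fun _ => hx.ne'⟩
    rw [this, measure_univ]
    exact one_pos
  -- The tangent inequality is applied to yG. For this y the mean k·E·y^(l-1) of (yG)^(l-1) along
  -- the tail equals y^l·A₀, the integral of (yG)^l, and what remains is y^l·A₀ ≤ ∫ w^(1-l) dμ.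
  set y := E / E₀ with hy
  have hy0 : 0 < y := div_pos hE' hE₀'
  have hyl := Real.rpow_pos_of_pos hy0 l
  have hyl1 := Real.rpow_pos_of_pos hy0 (l - 1)
  have key := lintegral_rpow_ge_of_neg (G := fun u => y * G u) hw hpos hl hS.le hL
    (hGm.const_mul y) fun u hu => mul_pos hy0 (hG0 u hu)
  have e1 : ∫⁻ u in Ioo 0 S, ENNReal.ofReal ((y * G u) ^ l) = ENNReal.ofReal (y ^ l * A₀) := by
    rw [ENNReal.ofReal_mul hyl.le, ← hA, ← lintegral_const_mul' _ _ ENNReal.ofReal_ne_top]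
    refine setLIntegral_congr_fun measurableSet_Ioo fun u hu => ?_
    rw [Real.mul_rpow hy0.le (hG0 u hu).le, ENNReal.ofReal_mul hyl.le]
  have e2 : ∫⁻ x, ENNReal.ofReal ((y * G (tailInt μ w x).toReal) ^ (l - 1)) ∂μ =
      ENNReal.ofReal (y ^ (l - 1) * (k * E)) := by
    rw [ENNReal.ofReal_mul hyl1.le, ENNReal.ofReal_mul hk.le, ← heE,
      ofReal_integral_eq_lintegral_ofReal hei (hepos.mono fun x hx => hx.le),
      ← lintegral_const_mul' _ _ ENNReal.ofReal_ne_top,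
      ← lintegral_const_mul' _ _ ENNReal.ofReal_ne_top]
    refine lintegral_congr_ae ?_
    filter_upwards [hmem] with x hx
    rw [Real.mul_rpow hy0.le (hG0 _ hx).le, hG _ hx, ENNReal.ofReal_mul hyl1.le,
      ENNReal.ofReal_mul hk.le]
  have hl2 : 0 ≤ 1 - l := by linarith
  have hl3 : 0 ≤ -l := by linarith
  rw [e1, e2, hAa, ← ENNReal.ofReal_mul hl2, ← ENNReal.ofReal_mul hl3,
    ← ENNReal.ofReal_add ENNReal.toReal_nonneg (by positivity),
    ENNReal.ofReal_le_ofReal_iff (add_nonneg ENNReal.toReal_nonneg (by positivity))] at key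
  have hkE : y ^ (l - 1) * (k * E) = y ^ l * A₀ := by
    have h1 : y ^ l = y ^ (l - 1) * y := by
      rw [Real.rpow_sub_one hy0.ne', div_mul_cancel₀ _ hy0.ne']
    rw [h1, hA₀, hy]
    field_simp
  rw [hkE] at key
  have ha_ge : y ^ l * A₀ ≤ a := by linarith
  -- comparison of the moments
  have hβ0 : 0 < β := by
    have : 0 < ENNReal.ofReal β := by
      rw [← hBβ]
      refine pos_iff_ne_zero.2 fun h => ?_
      rw [tailMoment, lintegral_eq_zero_iff ((measurable_tailInt μ w).pow_const r)] at h
      have : ∀ᵐ _x ∂μ, False := by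
        filter_upwards [h, hmem] with x h1 h2
        have h0 := ENNReal.toReal_pos_iff.1 h2.1
        rw [Pi.zero_apply, ENNReal.rpow_eq_ofReal_toReal_rpow h0.1 h0.2] at h1
        exact absurd (ENNReal.ofReal_eq_zero.1 h1) (not_le.2 (Real.rpow_pos_of_pos h2.1 _))
      exact this.exists.elim fun _ h => h
    exact ENNReal.ofReal_pos.1 this
  set b := β / B₀ with hb
  have hb0 : 0 < b := div_pos hβ0 hB₀'
  have hp : p ≠ 0 := by
    rintro rfl
    simp [hE] at hE'
  -- By `hB₀`, y is affine in the moment ratio b = β/B₀ and equals 1 at b = 1: precisely the left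
  -- side of Bernoulli's inequality with t = m/r.
  have hyb : y = 1 + m / r * (1 - b) := by
    have h1 : β / S ^ r = b * (m / (m + r)) := by
      rw [← hB₀, hb]
      field_simp
    have h2 : E₀ = (-r / (m + r)) / p := by
      rw [hE₀, hB₀]
      congr 1
      field_simp
      ring
    rw [hy, h2, hE, h1]
    field_simp
    ring
  have ht : 0 < m / r ∨ m / r ≤ -1 := by
    rcases lt_or_gt_of_ne hr with h | h
    · right
      rw [div_le_iff_of_neg h]
      linarith
    · exact Or.inl (div_pos hm h)
  have hbern := one_sub_mul_le_rpow_neg hb0 ht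
  rw [← hyb] at hbern
  -- Since l/(1-l) = -1/m is negative, raising y ≤ b^(-m/r) to this power reverses it.
  have hfin : b ^ (1 / r) ≤ (y ^ l) ^ (1 / (1 - l)) := by
    have h1 : (y ^ l) ^ (1 / (1 - l)) = y ^ (-(1 / m)) := by
      rw [← Real.rpow_mul hy0.le]
      congr 1
      have : l - 1 ≠ 0 := by linarith
      have : 1 - l ≠ 0 := by linarith
      rw [hm_def]
      field_simp
      ring
    have h2 : b ^ (1 / r) = (b ^ (-(m / r))) ^ (-(1 / m)) := by
      rw [← Real.rpow_mul hb0.le]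
      congr 1
      field_simp
    rw [h1, h2]
    exact Real.rpow_le_rpow_of_nonpos hy0 hbern (neg_nonpos.2 (one_div_pos.2 hm).le)
  have ha0 : 0 < a := lt_of_lt_of_le (by positivity) ha_ge
  rw [hBβ, hAa, ENNReal.ofReal_rpow_of_pos hβ0, ENNReal.ofReal_rpow_of_pos hA₀',
    ENNReal.ofReal_rpow_of_pos hB₀', ENNReal.ofReal_rpow_of_pos ha0,
    ← ENNReal.ofReal_mul (Real.rpow_nonneg hβ0.le _),
    ← ENNReal.ofReal_mul (Real.rpow_nonneg hB₀'.le _)]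
  refine ENNReal.ofReal_le_ofReal ?_
  have hβb : β = B₀ * b := by rw [hb]; field_simp
  have hl4 : 0 ≤ 1 / (1 - l) := one_div_nonneg.2 hl2
  calc β ^ (1 / r) * A₀ ^ (1 / (1 - l))
      = B₀ ^ (1 / r) * (b ^ (1 / r) * A₀ ^ (1 / (1 - l))) := by
        rw [hβb, Real.mul_rpow hB₀'.le hb0.le, mul_assoc]
    _ ≤ B₀ ^ (1 / r) * ((y ^ l) ^ (1 / (1 - l)) * A₀ ^ (1 / (1 - l))) := by gcongr
    _ = B₀ ^ (1 / r) * (y ^ l * A₀) ^ (1 / (1 - l)) := by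
        rw [Real.mul_rpow hyl.le hA₀'.le]
    _ ≤ B₀ ^ (1 / r) * a ^ (1 / (1 - l)) := by gcongr

/-- The moment-entropy inequality in the mirrored range. -/
lemma tailMoment_div_le {S k p B₀ A₀ : ℝ} {G : ℝ → ℝ}
    (hl : l < 0) (hr : r ≠ 0) (hrl : 0 < r ∨ r + (l - 1) / l > 0)
    (hS : 0 < S) (hk : 0 < k) (hB₀ : B₀ / S ^ r = ((l - 1) / l) / ((l - 1) / l + r))
    (hA₀ : A₀ = k * ((B₀ / S ^ r - 1) / p)) (hA₀' : 0 < A₀)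
    (he : ∀ u ∈ Ioo 0 S, 0 < ((u / S) ^ r - 1) / p)
    (hGm : Measurable G) (hG0 : ∀ u ∈ Ioo 0 S, 0 < G u)
    (hG : ∀ u ∈ Ioo 0 S, G u ^ (l - 1) = k * (((u / S) ^ r - 1) / p))
    (hA : ∫⁻ u in Ioo 0 S, ENNReal.ofReal (G u ^ l) = ENNReal.ofReal A₀)
    (hw : Measurable w) (hpos : ∀ᵐ x ∂μ, 0 < w x)
    (hex : ¬ (tailMoment μ r w ^ (1 / r) = ∞ ∧ weightPower μ l w = ∞)) :
    tailMoment μ r w ^ (1 / r) / weightPower μ l w ≤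
      ENNReal.ofReal B₀ ^ (1 / r) / ENNReal.ofReal A₀ ^ (1 / (1 - l)) := by
  have hl1 : l ≠ 1 := by linarith
  have hl2 : 0 < 1 / (1 - l) := one_div_pos.2 (by linarith)
  -- Infinite mass makes the power mean infinite and the quotient 0, the form ∞/∞ being excluded.
  by_cases hL : ∫⁻ x, ENNReal.ofReal (w x) ∂μ = ∞
  · have h1 : weightPower μ l w = ∞ := by
      rw [weightPower, if_neg hl1, lintegral_rpow_eq_top hl hL,
        ENNReal.top_rpow_of_pos hl2]
    have h2 : tailMoment μ r w ^ (1 / r) ≠ ∞ := fun h => hex ⟨h, h1⟩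
    rw [h1, ENNReal.div_top]
    exact zero_le
  have hL0 : ∫⁻ x, ENNReal.ofReal (w x) ∂μ ≠ 0 := by
    intro h
    rw [lintegral_eq_zero_iff hw.ennreal_ofReal] at h
    have : ∀ᵐ _x ∂μ, False := by
      filter_upwards [h, hpos] with x h1 h2
      simp at h1
      linarith
    exact this.exists.elim fun _ h => h
  set L := (∫⁻ x, ENNReal.ofReal (w x) ∂μ).toReal with hLdef
  have hLpos : 0 < L := ENNReal.toReal_pos hL0 hL
  have hLL : ∫⁻ x, ENNReal.ofReal (w x) ∂μ = ENNReal.ofReal L := (ENNReal.ofReal_toReal hL).symm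
  by_cases hB : tailMoment μ r w = ∞
  · rcases lt_or_gt_of_ne hr with h | h
    · rw [hB, ENNReal.top_rpow_of_neg (one_div_neg.2 h), ENNReal.zero_div]
      exact zero_le
    -- For r > 0 the tail is at most L, so its moment is finite.
    · exfalso
      have : tailMoment μ r w ≤ ∫⁻ _x, ENNReal.ofReal L ^ r ∂μ := by
        refine lintegral_mono fun x => ENNReal.rpow_le_rpow ?_ h.le
        rw [← hLL]
        exact setLIntegral_le_lintegral _ _
      rw [hB, lintegral_const, measure_univ, mul_one, top_le_iff] at this
      exact ENNReal.rpow_ne_top_of_nonneg h.le ENNReal.ofReal_ne_top this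
  -- This gives the weight the mass S; both sides have degree one in w, so c cancels.
  set c := S / L with hc
  have hc0 : 0 < c := div_pos hS hLpos
  have h := tailMoment_mul_le_of_normalized (w := fun x => c * w x) hl hr hrl hS hk hB₀ hA₀ hA₀' he
    hGm hG0 hG hA (hw.const_mul c) (hpos.mono fun x hx => mul_pos hc0 hx)
    (by
      simp_rw [ENNReal.ofReal_mul hc0.le]
      rw [lintegral_const_mul' _ _ ENNReal.ofReal_ne_top, hLL, ← ENNReal.ofReal_mul hc0.le, hc,
        div_mul_cancel₀ _ hLpos.ne'])
    (by
      rw [tailMoment_const_mul μ r w hc0]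
      exact ENNReal.mul_ne_top ENNReal.ofReal_ne_top hB)
  rw [tailMoment_const_mul μ r w hc0, weightPower_const_mul μ l hpos (fun h => absurd h hl1) hc0,
    ENNReal.ofReal_mul_rpow (Real.rpow_pos_of_pos hc0 _), ← Real.rpow_mul hc0.le,
    mul_one_div_cancel hr, Real.rpow_one, mul_assoc, mul_left_comm _ (ENNReal.ofReal c)] at h
  have h' := (ENNReal.mul_le_mul_iff_right (a := ENNReal.ofReal c) (by simpa using hc0)
    ENNReal.ofReal_ne_top).1 h
  have hN0 : ENNReal.ofReal A₀ ^ (1 / (1 - l)) ≠ 0 := by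
    rw [ENNReal.ofReal_rpow_of_pos hA₀']
    simpa using Real.rpow_pos_of_pos hA₀' _
  have hN : ENNReal.ofReal A₀ ^ (1 / (1 - l)) ≠ ∞ :=
    ENNReal.rpow_ne_top_of_nonneg hl2.le ENNReal.ofReal_ne_top
  by_cases hwp : weightPower μ l w = ∞
  · rw [hwp, ENNReal.div_top]
    exact zero_le
  have hwp0 : weightPower μ l w ≠ 0 := by
    rw [weightPower, if_neg hl1]
    intro h0
    rw [ENNReal.rpow_eq_zero_iff] at h0
    rcases h0 with ⟨h0, -⟩ | ⟨-, h0⟩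
    · rw [lintegral_eq_zero_iff (hw.ennreal_ofReal.pow_const _)] at h0
      have : ∀ᵐ _x ∂μ, False := by
        filter_upwards [h0, hpos] with x h1 h2
        rw [Pi.zero_apply, ENNReal.ofReal_rpow_of_pos h2] at h1
        exact absurd (ENNReal.ofReal_eq_zero.1 h1) (not_le.2 (Real.rpow_pos_of_pos h2 _))
      exact this.exists.elim fun _ h => h
    · linarith
  rw [ENNReal.div_le_iff hwp0 hwp, ENNReal.mul_comm_div, ← mul_div_assoc]
  rw [ENNReal.le_div_iff_mul_le (Or.inl hN0) (Or.inl hN)]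
  exact h'

end Abstract

/-! ### The stretched deformed Gaussians -/

section Gauss

variable {p l : ℝ}

lemma EntClassical.pos (h : EntClassical p l) : 0 < l :=
  lt_trans (one_div_pos.2 (by linarith [h.1])) h.2

lemma EntClassical.one_lt_mul (h : EntClassical p l) : 1 < l * (1 + conjExp p) := by
  have h1 : 0 < 1 + conjExp p := by linarith [h.1]
  have := h.2
  rwa [div_lt_iff₀ h1] at this

lemma EntClassical.den_pos (h : EntClassical p l) : 0 < l - 1 + l * conjExp p := by
  linarith [h.one_lt_mul]

lemma gaussProfile_of_ne (hl : l ≠ 1) {x : ℝ} (hx : 0 < x) :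
    gaussProfile p l x = (max 0 (1 - (l - 1) * x ^ conjExp p)) ^ (1 / (l - 1)) := by
  have h : ¬ (2 - l = 1) := fun h => hl (by linarith)
  rw [gaussProfile, if_pos hx, tsallisExp, if_neg h, show 1 - (2 - l) = l - 1 by ring]
  congr 2
  ring

lemma gaussProfile_one {x : ℝ} (hx : 0 < x) :
    gaussProfile p 1 x = Real.exp (-(x ^ conjExp p)) := by
  rw [gaussProfile, if_pos hx, tsallisExp, if_pos (by norm_num)]

lemma gaussProfile_of_nonpos {x : ℝ} (hx : x ≤ 0) : gaussProfile p l x = 0 := by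
  rw [gaussProfile, if_neg (not_lt.2 hx)]

lemma gaussProfile_nonneg (x : ℝ) : 0 ≤ gaussProfile p l x := by
  rw [gaussProfile, tsallisExp]
  split_ifs <;> positivity

lemma measurable_gaussProfile : Measurable (gaussProfile p l) := by
  unfold gaussProfile tsallisExp
  refine Measurable.ite measurableSet_Ioi ?_ measurable_const
  split_ifs
  · fun_prop
  · fun_prop

lemma gaussProfile_pos_iff {x : ℝ} :
    0 < gaussProfile p l x ↔ 0 < x ∧ 0 < 1 - (l - 1) * x ^ conjExp p := by
  rcases le_or_gt x 0 with hx | hx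
  · simp [gaussProfile_of_nonpos hx, hx.not_gt]
  · by_cases hl : l = 1
    · subst hl
      simp [gaussProfile_one hx, hx, Real.exp_pos]
    · rw [gaussProfile_of_ne hl hx]
      constructor
      · intro h
        refine ⟨hx, ?_⟩
        by_contra hcon
        rw [max_eq_left (not_lt.1 hcon), Real.zero_rpow] at h
        · exact lt_irrefl _ h
        · exact one_div_ne_zero (sub_ne_zero.2 hl)
      · rintro ⟨-, h⟩
        exact Real.rpow_pos_of_pos (lt_max_of_lt_right h) _

/-- In z = (l-1)x^r the profile is a Beta kernel of the first kind with parameters 1/r and l/(l-1);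
the factor x^r raises the first parameter by one. -/
lemma lintegral_gaussProfile_of_one_lt (hr : 0 < conjExp p) (hl : 1 < l) :
    ∃ Z : ℝ, 0 < Z ∧ ∫⁻ x in Ioi 0, ENNReal.ofReal (gaussProfile p l x) = ENNReal.ofReal Z ∧
      ∫⁻ x in Ioi 0, ENNReal.ofReal (x ^ conjExp p * gaussProfile p l x) =
        ENNReal.ofReal (Z / (l - 1 + l * conjExp p)) := by
  set r := conjExp p with hr_def
  have hl1 : 0 < l - 1 := by linarith
  have hl0 : 0 < l := by linarith
  set b := (l - 1) ^ (-(1 / r)) with hb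
  have hb0 : 0 < b := Real.rpow_pos_of_pos hl1 _
  have hbr : b ^ r = (l - 1)⁻¹ := by
    rw [hb, ← Real.rpow_mul hl1.le, ← Real.rpow_neg_one]
    congr 1
    field_simp
  have hz : ∀ x : ℝ, 0 < x → (x / b) ^ r = (l - 1) * x ^ r := fun x hx => by
    rw [Real.div_rpow hx.le hb0.le, hbr]
    field_simp
  have hP : 0 < 1 / r := one_div_pos.2 hr
  have hQ : 0 < l / (l - 1) := by positivity
  have hbeta := ProbabilityTheory.beta_pos hP hQ
  have hprof : ∀ x : ℝ, 0 < x → gaussProfile p l x =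
      b / r * (|r| / b * (x / b) ^ (r - 1) * betaKernel 0 (1 / r) (l / (l - 1)) ((x / b) ^ r)) := by
    intro x hx
    have hxb : 0 < x / b := div_pos hx hb0
    rw [gaussProfile_of_ne hl.ne' hx, ← hz x hx, betaKernel, abs_of_pos hr]
    simp only [sub_zero, one_mul, zero_mul, add_zero, Real.one_rpow, div_one]
    split_ifs with h
    · have e1 : l / (l - 1) - 1 = 1 / (l - 1) := by field_simp; ring
      have e2 : (x / b) ^ (r - 1) * ((x / b) ^ r) ^ (1 / r - 1) = 1 := by
        rw [← Real.rpow_mul hxb.le, ← Real.rpow_add hxb,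
          show r - 1 + r * (1 / r - 1) = 0 by field_simp; ring, Real.rpow_zero]
      rw [max_eq_right (by linarith), e1]
      calc _ = b / r * (r / b) * ((x / b) ^ (r - 1) * ((x / b) ^ r) ^ (1 / r - 1)) *
            (1 - (x / b) ^ r) ^ (1 / (l - 1)) := by rw [e2]; field_simp
        _ = _ := by ring
    · rw [max_eq_left (by linarith), Real.zero_rpow (one_div_ne_zero hl1.ne')]
      ring
  have hprof2 : ∀ x : ℝ, 0 < x → x ^ r * gaussProfile p l x = b ^ r * (b / r) *
      (|r| / b * (x / b) ^ (r - 1) * betaKernel 0 (1 / r + 1) (l / (l - 1)) ((x / b) ^ r)) := by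
    intro x hx
    have hxb : 0 < x / b := div_pos hx hb0
    have hzpos : 0 < (x / b) ^ r := Real.rpow_pos_of_pos hxb _
    have hbrpos := Real.rpow_pos_of_pos hb0 r
    rw [hprof x hx, betaKernel, betaKernel]
    simp only [sub_zero, one_mul, zero_mul, add_zero, Real.one_rpow, div_one]
    split_ifs with h
    · rw [add_sub_cancel_right, show x ^ r = b ^ r * (x / b) ^ r by
        rw [Real.div_rpow hx.le hb0.le]; field_simp, Real.rpow_sub_one hzpos.ne']
      field_simp
    · ring
  refine ⟨b / r * ProbabilityTheory.beta (1 / r) (l / (l - 1)), by positivity, ?_, ?_⟩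
  · rw [ENNReal.ofReal_mul (by positivity), ← lintegral_Ioi_mul_betaKernel hr.ne' hb0 (Or.inl rfl)
      hP hQ, ← lintegral_const_mul' _ _ ENNReal.ofReal_ne_top]
    refine setLIntegral_congr_fun measurableSet_Ioi fun x hx => ?_
    rw [hprof x hx, ENNReal.ofReal_mul (by positivity)]
  · have e : b / r * ProbabilityTheory.beta (1 / r) (l / (l - 1)) / (l - 1 + l * r) =
        b ^ r * (b / r) * ProbabilityTheory.beta (1 / r + 1) (l / (l - 1)) := by
      rw [beta_add_one_left hP hQ, hbr]
      field_simp
    rw [e, ENNReal.ofReal_mul (by positivity), ← lintegral_Ioi_mul_betaKernel hr.ne' hb0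
      (Or.inl rfl) (by positivity) hQ, ← lintegral_const_mul' _ _ ENNReal.ofReal_ne_top]
    refine setLIntegral_congr_fun measurableSet_Ioi fun x hx => ?_
    rw [hprof2 x hx, ENNReal.ofReal_mul (by positivity)]

/-- In z = (1-l)x^r the profile is a Beta kernel of the second kind with parameters 1/r and Q + 1,
and the factor x^r turns them into 1/r + 1 and Q. Positivity of Q, hence finiteness of the moment,
is the condition l(1+r) > 1. -/
lemma lintegral_gaussProfile_of_lt_one (h : EntClassical p l) (hl : l < 1) :
    ∃ Z : ℝ, 0 < Z ∧ ∫⁻ x in Ioi 0, ENNReal.ofReal (gaussProfile p l x) = ENNReal.ofReal Z ∧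
      ∫⁻ x in Ioi 0, ENNReal.ofReal (x ^ conjExp p * gaussProfile p l x) =
        ENNReal.ofReal (Z / (l - 1 + l * conjExp p)) := by
  have hr := h.1
  have hden := h.den_pos
  set r := conjExp p with hr_def
  have hl1 : 0 < 1 - l := by linarith
  have hl0 : 0 < l := h.pos
  set b := (1 - l) ^ (-(1 / r)) with hb
  have hb0 : 0 < b := Real.rpow_pos_of_pos hl1 _
  have hbr : b ^ r = (1 - l)⁻¹ := by
    rw [hb, ← Real.rpow_mul hl1.le, ← Real.rpow_neg_one]
    congr 1
    field_simp
  have hz : ∀ x : ℝ, 0 < x → (x / b) ^ r = (1 - l) * x ^ r := fun x hx => by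
    rw [Real.div_rpow hx.le hb0.le, hbr]
    field_simp
  have hP : 0 < 1 / r := one_div_pos.2 hr
  set Q := 1 / (1 - l) - 1 / r - 1 with hQdef
  have hQ : 0 < Q := by
    have : Q = (l - 1 + l * r) / ((1 - l) * r) := by
      rw [hQdef]
      field_simp
      ring
    rw [this]
    positivity
  have hprof : ∀ x : ℝ, 0 < x → gaussProfile p l x =
      b / r * (|r| / b * (x / b) ^ (r - 1) * betaKernel 1 (1 / r) (Q + 1) ((x / b) ^ r)) := by
    intro x hx
    have hxb : 0 < x / b := div_pos hx hb0
    have hzpos : 0 < (x / b) ^ r := Real.rpow_pos_of_pos hxb _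
    have e0 : 1 - (l - 1) * x ^ r = 1 + (x / b) ^ r := by rw [hz x hx]; ring
    rw [gaussProfile_of_ne hl.ne hx, e0, betaKernel, abs_of_pos hr, max_eq_right (by positivity)]
    simp only [sub_self, zero_mul, zero_lt_one, if_true, sub_zero, Real.one_rpow, one_mul, mul_one]
    have e2 : (x / b) ^ (r - 1) * ((x / b) ^ r) ^ (1 / r - 1) = 1 := by
      rw [← Real.rpow_mul hxb.le, ← Real.rpow_add hxb,
        show r - 1 + r * (1 / r - 1) = 0 by field_simp; ring, Real.rpow_zero]
    have e3 : (1 + (x / b) ^ r) ^ (1 / (l - 1)) = ((1 + (x / b) ^ r) ^ (1 / r + (Q + 1)))⁻¹ := by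
      rw [← Real.rpow_neg (by positivity)]
      congr 1
      have : l - 1 ≠ 0 := by linarith
      rw [hQdef]
      field_simp
      ring
    rw [e3]
    calc _ = b / r * (r / b) * ((x / b) ^ (r - 1) * ((x / b) ^ r) ^ (1 / r - 1)) *
          ((1 + (x / b) ^ r) ^ (1 / r + (Q + 1)))⁻¹ := by rw [e2]; field_simp
      _ = _ := by ring
  have hprof2 : ∀ x : ℝ, 0 < x → x ^ r * gaussProfile p l x = b ^ r * (b / r) *
      (|r| / b * (x / b) ^ (r - 1) * betaKernel 1 (1 / r + 1) Q ((x / b) ^ r)) := by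
    intro x hx
    have hxb : 0 < x / b := div_pos hx hb0
    have hzpos : 0 < (x / b) ^ r := Real.rpow_pos_of_pos hxb _
    have hbrpos := Real.rpow_pos_of_pos hb0 r
    rw [hprof x hx, betaKernel, betaKernel]
    simp only [sub_self, zero_mul, zero_lt_one, if_true, sub_zero, Real.one_rpow, one_mul, mul_one]
    rw [add_sub_cancel_right, show x ^ r = b ^ r * (x / b) ^ r by
      rw [Real.div_rpow hx.le hb0.le]; field_simp, Real.rpow_sub_one hzpos.ne',
      show 1 / r + 1 + Q = 1 / r + (Q + 1) by ring]
    field_simp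
  have hbeta := ProbabilityTheory.beta_pos hP (show 0 < Q + 1 by positivity)
  refine ⟨b / r * ProbabilityTheory.beta (1 / r) (Q + 1), by positivity, ?_, ?_⟩
  · rw [ENNReal.ofReal_mul (by positivity), ← lintegral_Ioi_mul_betaKernel hr.ne' hb0 (Or.inr rfl)
      hP (by positivity), ← lintegral_const_mul' _ _ ENNReal.ofReal_ne_top]
    refine setLIntegral_congr_fun measurableSet_Ioi fun x hx => ?_
    rw [hprof x hx, ENNReal.ofReal_mul (by positivity)]
  · have e : b / r * ProbabilityTheory.beta (1 / r) (Q + 1) / (l - 1 + l * r) =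
        b ^ r * (b / r) * ProbabilityTheory.beta (1 / r + 1) Q := by
      have hQ' : Q = (l - 1 + l * r) / ((1 - l) * r) := by
        rw [hQdef]
        field_simp
        ring
      rw [beta_add_one_sub_one hP hQ, hbr]
      generalize ProbabilityTheory.beta (1 / r) (Q + 1) = β
      rw [hQ']
      field_simp
    rw [e, ENNReal.ofReal_mul (by positivity), ← lintegral_Ioi_mul_betaKernel hr.ne' hb0
      (Or.inr rfl) (by positivity) hQ, ← lintegral_const_mul' _ _ ENNReal.ofReal_ne_top]
    refine setLIntegral_congr_fun measurableSet_Ioi fun x hx => ?_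
    rw [hprof2 x hx, ENNReal.ofReal_mul (by positivity)]

lemma lintegral_gaussProfile_one (hr : 0 < conjExp p) :
    ∃ Z : ℝ, 0 < Z ∧ ∫⁻ x in Ioi 0, ENNReal.ofReal (gaussProfile p 1 x) = ENNReal.ofReal Z ∧
      ∫⁻ x in Ioi 0, ENNReal.ofReal (x ^ conjExp p * gaussProfile p 1 x) =
        ENNReal.ofReal (Z / (1 - 1 + 1 * conjExp p)) := by
  set r := conjExp p
  have key : ∀ q : ℝ, -1 < q → ∫⁻ x in Ioi 0, ENNReal.ofReal (x ^ q * gaussProfile p 1 x) =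
      ENNReal.ofReal (1 / r * Real.Gamma ((q + 1) / r)) := by
    intro q hq
    rw [← integral_rpow_mul_exp_neg_rpow hr hq, ofReal_integral_eq_lintegral_ofReal]
    · refine setLIntegral_congr_fun measurableSet_Ioi fun x hx => ?_
      rw [gaussProfile_one hx]
    · exact integrableOn_rpow_mul_exp_neg_rpow hq hr
    · refine (ae_restrict_iff' measurableSet_Ioi).2 (Filter.Eventually.of_forall fun x hx => ?_)
      have hx' : 0 < x := hx
      simp only [Pi.zero_apply]
      positivity
  have hG := Real.Gamma_pos_of_pos (one_div_pos.2 hr)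
  refine ⟨1 / r * Real.Gamma (1 / r), by positivity, ?_, ?_⟩
  · have := key 0 (by norm_num)
    simpa using this
  · rw [key r (by linarith)]
    congr 1
    rw [show (r + 1) / r = 1 / r + 1 by field_simp; ring, Real.Gamma_add_one (by positivity)]
    field_simp
    ring

lemma lintegral_gaussProfile (h : EntClassical p l) :
    ∃ Z : ℝ, 0 < Z ∧ ∫⁻ x in Ioi 0, ENNReal.ofReal (gaussProfile p l x) = ENNReal.ofReal Z ∧
      ∫⁻ x in Ioi 0, ENNReal.ofReal (x ^ conjExp p * gaussProfile p l x) =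
        ENNReal.ofReal (Z / (l - 1 + l * conjExp p)) := by
  rcases lt_trichotomy l 1 with hl | rfl | hl
  · exact lintegral_gaussProfile_of_lt_one h hl
  · exact lintegral_gaussProfile_one h.1
  · exact lintegral_gaussProfile_of_one_lt h.1 hl

end Gauss

lemma ENNReal.rpow_le_rpow_of_exponent_nonpos {a b : ℝ≥0∞} {z : ℝ} (hz : z ≤ 0) (hab : a ≤ b) :
    b ^ z ≤ a ^ z := by
  obtain ⟨y, rfl⟩ : ∃ y, z = -y := ⟨-z, (neg_neg z).symm⟩
  rw [ENNReal.rpow_neg, ENNReal.rpow_neg, ENNReal.inv_le_inv]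
  exact ENNReal.rpow_le_rpow hab (by linarith)

/-! ### Moment and entropy of the normalised stretched Gaussian -/

section Stretched

variable {p l : ℝ}

/-- The normalising constant of the stretched deformed Gaussian. -/
noncomputable def gaussConst (p l : ℝ) : ℝ := (∫ y, gaussProfile p l y)⁻¹

lemma stretchedGauss_eq (x : ℝ) : stretchedGauss p l x = gaussConst p l * gaussProfile p l x := rfl

lemma lintegral_Ioi_eq_of_nonpos {F : ℝ → ℝ≥0∞} (hF : ∀ x ≤ 0, F x = 0) :
    ∫⁻ x, F x = ∫⁻ x in Ioi 0, F x := by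
  rw [← lintegral_indicator measurableSet_Ioi]
  refine lintegral_congr fun x => ?_
  by_cases hx : 0 < x
  · rw [indicator_of_mem (by exact hx)]
  · rw [indicator_of_notMem (by exact hx), hF x (not_lt.1 hx)]

lemma gaussConst_spec (h : EntClassical p l) : 0 < gaussConst p l ∧
    ∫⁻ x in Ioi 0, ENNReal.ofReal (gaussProfile p l x) = ENNReal.ofReal (gaussConst p l)⁻¹ := by
  obtain ⟨Z, hZ, h1, -⟩ := lintegral_gaussProfile h
  have : ∫ y, gaussProfile p l y = Z := by
    rw [integral_eq_lintegral_of_nonneg_ae (Filter.Eventually.of_forall gaussProfile_nonneg)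
      measurable_gaussProfile.aestronglyMeasurable,
      lintegral_Ioi_eq_of_nonpos fun x hx => by rw [gaussProfile_of_nonpos hx, ENNReal.ofReal_zero],
      h1, ENNReal.toReal_ofReal hZ.le]
  rw [gaussConst, this, inv_inv]
  exact ⟨inv_pos.2 hZ, h1⟩

lemma gaussConst_pos (h : EntClassical p l) : 0 < gaussConst p l := (gaussConst_spec h).1

/-- The moment of order `p*` of the stretched deformed Gaussian. -/
noncomputable def gaussMoment (p l : ℝ) : ℝ := 1 / (l - 1 + l * conjExp p)

lemma gaussMoment_pos (h : EntClassical p l) : 0 < gaussMoment p l := one_div_pos.2 h.den_pos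

lemma stretchedGauss_of_nonpos {x : ℝ} (hx : x ≤ 0) : stretchedGauss p l x = 0 := by
  rw [stretchedGauss_eq, gaussProfile_of_nonpos hx, mul_zero]

lemma stretchedGauss_nonneg (h : EntClassical p l) (x : ℝ) : 0 ≤ stretchedGauss p l x :=
  mul_nonneg (gaussConst_pos h).le (gaussProfile_nonneg x)

lemma measurable_stretchedGauss : Measurable (stretchedGauss p l) :=
  measurable_gaussProfile.const_mul _

lemma stretchedGauss_pos_iff (h : EntClassical p l) {x : ℝ} :
    0 < stretchedGauss p l x ↔ 0 < x ∧ 0 < 1 - (l - 1) * x ^ conjExp p := by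
  rw [stretchedGauss_eq, mul_pos_iff_of_pos_left (gaussConst_pos h), gaussProfile_pos_iff]

lemma lintegral_stretchedGauss (h : EntClassical p l) :
    ∫⁻ x, ENNReal.ofReal (stretchedGauss p l x) = 1 := by
  obtain ⟨ha, h1⟩ := gaussConst_spec h
  simp_rw [stretchedGauss_eq, ENNReal.ofReal_mul ha.le]
  rw [lintegral_const_mul' _ _ ENNReal.ofReal_ne_top, lintegral_Ioi_eq_of_nonpos fun x hx => by
    rw [gaussProfile_of_nonpos hx, ENNReal.ofReal_zero], h1, ← ENNReal.ofReal_mul ha.le,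
    mul_inv_cancel₀ ha.ne', ENNReal.ofReal_one]

lemma lintegral_rpow_mul_stretchedGauss (h : EntClassical p l) :
    ∫⁻ x in Ioi 0, ENNReal.ofReal (x ^ conjExp p * stretchedGauss p l x) =
      ENNReal.ofReal (gaussMoment p l) := by
  obtain ⟨Z, hZ, h1, h2⟩ := lintegral_gaussProfile h
  obtain ⟨ha, h1'⟩ := gaussConst_spec h
  have hZa : Z = (gaussConst p l)⁻¹ := by
    rw [h1] at h1'
    rwa [ENNReal.ofReal_eq_ofReal_iff hZ.le (inv_pos.2 ha).le] at h1'
  simp_rw [stretchedGauss_eq, mul_left_comm _ (gaussConst p l), ENNReal.ofReal_mul ha.le]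
  rw [lintegral_const_mul' _ _ ENNReal.ofReal_ne_top, h2, ← ENNReal.ofReal_mul ha.le, gaussMoment,
    hZa]
  congr 1
  field_simp

lemma lintegral_abs_rpow_mul_stretchedGauss (h : EntClassical p l) :
    ∫⁻ x, ENNReal.ofReal |x| ^ conjExp p * ENNReal.ofReal (stretchedGauss p l x) =
      ENNReal.ofReal (gaussMoment p l) := by
  rw [← lintegral_rpow_mul_stretchedGauss h, lintegral_Ioi_eq_of_nonpos fun x hx => by
    rw [stretchedGauss_of_nonpos hx, ENNReal.ofReal_zero, mul_zero]]
  refine setLIntegral_congr_fun measurableSet_Ioi fun x hx => ?_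
  have hx' : 0 < x := hx
  rw [abs_of_pos hx', ENNReal.ofReal_rpow_of_pos hx', ← ENNReal.ofReal_mul (by positivity)]

lemma deviation_stretchedGauss (h : EntClassical p l) :
    deviation (conjExp p) (stretchedGauss p l) =
      ENNReal.ofReal (gaussMoment p l) ^ (1 / conjExp p) := by
  rw [deviation, if_neg h.1.ne', lintegral_abs_rpow_mul_stretchedGauss h]

/-- Affinity in x^r is the property that makes this density a reference profile for the tangent
inequalities. -/
lemma stretchedGauss_rpow (h : EntClassical p l) {x : ℝ} (hx : 0 < stretchedGauss p l x) :
    stretchedGauss p l x ^ (l - 1) =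
      gaussConst p l ^ (l - 1) * (1 - (l - 1) * x ^ conjExp p) := by
  have ha := gaussConst_pos h
  have hx' := (stretchedGauss_pos_iff h).1 hx
  by_cases hl : l = 1
  · subst hl
    simp
  · rw [stretchedGauss_eq, Real.mul_rpow ha.le (gaussProfile_nonneg x),
      gaussProfile_of_ne hl hx'.1, max_eq_right hx'.2.le, ← Real.rpow_mul hx'.2.le,
      one_div_mul_cancel (sub_ne_zero.2 hl), Real.rpow_one]

lemma integrable_stretchedGauss (h : EntClassical p l) : Integrable (stretchedGauss p l) := by
  refine (lintegral_ofReal_ne_top_iff_integrable measurable_stretchedGauss.aestronglyMeasurable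
    (Filter.Eventually.of_forall (stretchedGauss_nonneg h))).1 ?_
  rw [lintegral_stretchedGauss h]
  exact ENNReal.one_ne_top

lemma integral_stretchedGauss (h : EntClassical p l) : ∫ x, stretchedGauss p l x = 1 := by
  rw [integral_eq_lintegral_of_nonneg_ae (Filter.Eventually.of_forall (stretchedGauss_nonneg h))
    measurable_stretchedGauss.aestronglyMeasurable, lintegral_stretchedGauss h, ENNReal.toReal_one]

lemma integrable_rpow_mul_stretchedGauss (h : EntClassical p l) :
    Integrable fun x => |x| ^ conjExp p * stretchedGauss p l x := by
  have m : Measurable fun x => |x| ^ conjExp p * stretchedGauss p l x := by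
    have := measurable_stretchedGauss (p := p) (l := l)
    fun_prop
  refine (lintegral_ofReal_ne_top_iff_integrable m.aestronglyMeasurable
    (Filter.Eventually.of_forall fun x => mul_nonneg (Real.rpow_nonneg (abs_nonneg _) _)
      (stretchedGauss_nonneg h x))).1 ?_
  have e : ∀ x, ENNReal.ofReal (|x| ^ conjExp p * stretchedGauss p l x) =
      ENNReal.ofReal |x| ^ conjExp p * ENNReal.ofReal (stretchedGauss p l x) := fun x => by
    rw [ENNReal.ofReal_mul (Real.rpow_nonneg (abs_nonneg _) _),
      ENNReal.ofReal_rpow_of_nonneg (abs_nonneg _) h.1.le]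
  simp_rw [e]
  rw [lintegral_abs_rpow_mul_stretchedGauss h]
  exact ENNReal.ofReal_ne_top

lemma integral_rpow_mul_stretchedGauss (h : EntClassical p l) :
    ∫ x, |x| ^ conjExp p * stretchedGauss p l x = gaussMoment p l := by
  rw [integral_eq_lintegral_of_nonneg_ae (Filter.Eventually.of_forall fun x =>
    mul_nonneg (Real.rpow_nonneg (abs_nonneg _) _) (stretchedGauss_nonneg h x))
    (integrable_rpow_mul_stretchedGauss h).aestronglyMeasurable]
  have e : ∀ x, ENNReal.ofReal (|x| ^ conjExp p * stretchedGauss p l x) =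
      ENNReal.ofReal |x| ^ conjExp p * ENNReal.ofReal (stretchedGauss p l x) := fun x => by
    rw [ENNReal.ofReal_mul (Real.rpow_nonneg (abs_nonneg _) _),
      ENNReal.ofReal_rpow_of_nonneg (abs_nonneg _) h.1.le]
  simp_rw [e]
  rw [lintegral_abs_rpow_mul_stretchedGauss h, ENNReal.toReal_ofReal (gaussMoment_pos h).le]

/-- The integral `∫ g^l` for the stretched deformed Gaussian. -/
noncomputable def gaussPowerInt (p l : ℝ) : ℝ :=
  gaussConst p l ^ (l - 1) * (1 - (l - 1) * gaussMoment p l)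

lemma gaussPowerInt_pos (h : EntClassical p l) : 0 < gaussPowerInt p l := by
  refine mul_pos (Real.rpow_pos_of_pos (gaussConst_pos h) _) ?_
  have h1 := h.den_pos
  have h2 := h.pos
  have h3 := h.1
  have : 1 - (l - 1) * gaussMoment p l = l * conjExp p / (l - 1 + l * conjExp p) := by
    rw [gaussMoment]
    field_simp
    ring
  rw [this]
  positivity

/-- Multiplying the affine relation for g^(l-1) by g expresses g^l through g and x^r g, so mass and
moment suffice. -/
lemma lintegral_stretchedGauss_rpow (h : EntClassical p l) :
    ∫⁻ x in {x | 0 < stretchedGauss p l x}, ENNReal.ofReal (stretchedGauss p l x) ^ l =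
      ENNReal.ofReal (gaussPowerInt p l) := by
  have hS : MeasurableSet {x | 0 < stretchedGauss p l x} :=
    measurableSet_lt measurable_const measurable_stretchedGauss
  have hint : Integrable fun x => gaussConst p l ^ (l - 1) *
      (stretchedGauss p l x - (l - 1) * (|x| ^ conjExp p * stretchedGauss p l x)) :=
    ((integrable_stretchedGauss h).sub
      ((integrable_rpow_mul_stretchedGauss h).const_mul _)).const_mul _
  have heq : ∀ x, 0 < stretchedGauss p l x → gaussConst p l ^ (l - 1) *
      (stretchedGauss p l x - (l - 1) * (|x| ^ conjExp p * stretchedGauss p l x)) =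
        stretchedGauss p l x ^ l := by
    intro x hx
    have hx' := (stretchedGauss_pos_iff h).1 hx
    have h1 := stretchedGauss_rpow h hx
    rw [Real.rpow_sub_one hx.ne', div_eq_iff hx.ne'] at h1
    rw [h1, abs_of_pos hx'.1]
    ring
  have heq0 : ∀ x, ¬ 0 < stretchedGauss p l x → gaussConst p l ^ (l - 1) *
      (stretchedGauss p l x - (l - 1) * (|x| ^ conjExp p * stretchedGauss p l x)) = 0 := by
    intro x hx
    have : stretchedGauss p l x = 0 := le_antisymm (not_lt.1 hx) (stretchedGauss_nonneg h x)
    simp [this]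
  have hval : ∫ x, gaussConst p l ^ (l - 1) *
      (stretchedGauss p l x - (l - 1) * (|x| ^ conjExp p * stretchedGauss p l x)) =
        gaussPowerInt p l := by
    rw [integral_const_mul, integral_sub (integrable_stretchedGauss h)
      ((integrable_rpow_mul_stretchedGauss h).const_mul _), integral_const_mul,
      integral_stretchedGauss h, integral_rpow_mul_stretchedGauss h, gaussPowerInt]
  rw [← hval, ofReal_integral_eq_lintegral_ofReal hint, ← lintegral_indicator hS]
  · refine lintegral_congr fun x => ?_
    by_cases hx : 0 < stretchedGauss p l x
    · rw [indicator_of_mem (by exact hx), heq x hx, ENNReal.ofReal_rpow_of_pos hx]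
    · rw [indicator_of_notMem (by exact hx), heq0 x hx, ENNReal.ofReal_zero]
  · refine Filter.Eventually.of_forall fun x => ?_
    beta_reduce
    by_cases hx : 0 < stretchedGauss p l x
    · rw [heq x hx]
      exact Real.rpow_nonneg hx.le _
    · rw [heq0 x hx]
      exact le_rfl

lemma lintegral_Ioi_stretchedGauss_rpow (h : EntClassical p l) :
    ∫⁻ x in Ioi 0, ENNReal.ofReal (stretchedGauss p l x ^ l) =
      ENNReal.ofReal (gaussPowerInt p l) := by
  have hS : MeasurableSet {x | 0 < stretchedGauss p l x} :=
    measurableSet_lt measurable_const measurable_stretchedGauss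
  rw [← lintegral_stretchedGauss_rpow h, ← lintegral_indicator hS,
    ← lintegral_indicator measurableSet_Ioi]
  refine lintegral_congr fun x => ?_
  by_cases hx : 0 < stretchedGauss p l x
  · have hx' := ((stretchedGauss_pos_iff h).1 hx).1
    rw [indicator_of_mem (show x ∈ {x | 0 < stretchedGauss p l x} from hx),
      indicator_of_mem (show x ∈ Ioi 0 from hx'), ENNReal.ofReal_rpow_of_pos hx]
  · have h0 : stretchedGauss p l x = 0 := le_antisymm (not_lt.1 hx) (stretchedGauss_nonneg h x)
    rw [indicator_of_notMem (show x ∉ {x | 0 < stretchedGauss p l x} from hx)]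
    by_cases hx' : 0 < x
    -- Off the support 0^l = 0 because l > 0.
    · rw [indicator_of_mem (show x ∈ Ioi 0 from hx'), h0, Real.zero_rpow h.pos.ne',
        ENNReal.ofReal_zero]
    · rw [indicator_of_notMem (show x ∉ Ioi 0 from hx')]

lemma stretchedGauss_one_mul_log (h : EntClassical p 1) (x : ℝ) :
    stretchedGauss p 1 x * Real.log (stretchedGauss p 1 x) =
      Real.log (gaussConst p 1) * stretchedGauss p 1 x -
        |x| ^ conjExp p * stretchedGauss p 1 x := by
  have ha := gaussConst_pos h
  rcases le_or_gt x 0 with hx | hx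
  · simp [stretchedGauss_of_nonpos hx]
  · have e : stretchedGauss p 1 x = gaussConst p 1 * Real.exp (-(x ^ conjExp p)) := by
      rw [stretchedGauss_eq, gaussProfile_one hx]
    have : Real.log (stretchedGauss p 1 x) = Real.log (gaussConst p 1) - x ^ conjExp p := by
      rw [e, Real.log_mul ha.ne' (Real.exp_pos _).ne', Real.log_exp]
      ring
    rw [this, abs_of_pos hx]
    ring

lemma integrable_stretchedGauss_one_mul_log (h : EntClassical p 1) :
    Integrable fun x => stretchedGauss p 1 x * Real.log (stretchedGauss p 1 x) := by
  simp_rw [stretchedGauss_one_mul_log h]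
  exact ((integrable_stretchedGauss h).const_mul _).sub (integrable_rpow_mul_stretchedGauss h)

lemma integral_stretchedGauss_one_mul_log (h : EntClassical p 1) :
    ∫ x, stretchedGauss p 1 x * Real.log (stretchedGauss p 1 x) =
      Real.log (gaussConst p 1) - gaussMoment p 1 := by
  simp_rw [stretchedGauss_one_mul_log h]
  rw [integral_sub ((integrable_stretchedGauss h).const_mul _)
    (integrable_rpow_mul_stretchedGauss h), integral_const_mul, integral_stretchedGauss h,
    integral_rpow_mul_stretchedGauss h, mul_one]

lemma renyiPower_stretchedGauss (h : EntClassical p l) :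
    renyiPower l (stretchedGauss p l) =
      if l = 1 then ENNReal.ofReal (Real.exp (gaussMoment p l - Real.log (gaussConst p l)))
      else ENNReal.ofReal (gaussPowerInt p l) ^ (1 / (1 - l)) := by
  rw [renyiPower]
  split_ifs with hl
  · subst hl
    rw [integral_stretchedGauss_one_mul_log h, neg_sub]
  · rw [lintegral_stretchedGauss_rpow h]

lemma renyiPower_stretchedGauss_ne (h : EntClassical p l) :
    renyiPower l (stretchedGauss p l) ≠ 0 ∧ renyiPower l (stretchedGauss p l) ≠ ∞ := by
  rw [renyiPower_stretchedGauss h]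
  split_ifs with hl
  · exact ⟨by simpa using Real.exp_pos _, ENNReal.ofReal_ne_top⟩
  · have h1 := gaussPowerInt_pos h
    rw [ENNReal.ofReal_rpow_of_pos h1]
    exact ⟨by simpa using Real.rpow_pos_of_pos h1 _, ENNReal.ofReal_ne_top⟩

lemma deviation_stretchedGauss_ne (h : EntClassical p l) :
    deviation (conjExp p) (stretchedGauss p l) ≠ 0 ∧
      deviation (conjExp p) (stretchedGauss p l) ≠ ∞ := by
  rw [deviation_stretchedGauss h, ENNReal.ofReal_rpow_of_pos (gaussMoment_pos h)]
  exact ⟨by simpa using Real.rpow_pos_of_pos (gaussMoment_pos h) _, ENNReal.ofReal_ne_top⟩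

/-- The moment-entropy inequality in the classical range. -/
lemma deviation_div_renyiPower_le {μ : Measure ℝ} [IsProbabilityMeasure μ] [NullSingletonClass μ]
    {w : ℝ → ℝ} (h : EntClassical p l) (hw : Measurable w) (hpos : ∀ᵐ x ∂μ, 0 < w x)
    (hlog : l = 1 → Integrable (fun x => Real.log (w x)) μ)
    (hex : ¬ (tailMoment μ (conjExp p) w ^ (1 / conjExp p) = ∞ ∧ weightPower μ l w = ∞)) :
    deviation (conjExp p) (stretchedGauss p l) / renyiPower l (stretchedGauss p l) ≤
      tailMoment μ (conjExp p) w ^ (1 / conjExp p) / weightPower μ l w := by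
  have hN := renyiPower_stretchedGauss_ne h
  have ha := gaussConst_pos h
  have hX := gaussMoment_pos h
  refine div_le_tailMoment_div hw hpos h.1 hN.1 hN.2 (fun hB => ?_) hex
  rw [deviation_stretchedGauss h]
  refine mul_weightPower_le_of_normalized hX h.1 ?_ hw hpos hlog hB
  intro v hv hvpos hvlog hvB
  rw [renyiPower_stretchedGauss h, weightPower]
  have hk := (Real.rpow_pos_of_pos ha (l - 1)).le
  rcases lt_trichotomy l 1 with hl | rfl | hl
  · rw [if_neg hl.ne, if_neg hl.ne]
    refine ENNReal.rpow_le_rpow ?_ (one_div_nonneg.2 (by linarith))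
    have hsupp : ∀ u : ℝ, 0 < u → 0 < stretchedGauss p l u := fun u hu => by
      rw [stretchedGauss_pos_iff h]
      refine ⟨hu, ?_⟩
      have : 0 < (1 - l) * u ^ conjExp p := mul_pos (by linarith) (Real.rpow_pos_of_pos hu _)
      linarith
    exact lintegral_rpow_le_of_lt_one hv hvpos h.pos hl h.1 hk hX.le measurable_stretchedGauss
      hsupp (fun u hu => stretchedGauss_rpow h (hsupp u hu))
      (lintegral_Ioi_stretchedGauss_rpow h) hvB
  · rw [if_pos rfl, if_pos rfl]
    refine ENNReal.ofReal_le_ofReal (Real.exp_le_exp.2 ?_)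
    refine integral_log_le hv hvpos h.1 ha hX.le (hvlog rfl) ?_ hvB
    rw [← lintegral_stretchedGauss h, lintegral_Ioi_eq_of_nonpos (F := fun x => ENNReal.ofReal _)
      fun x hx => by rw [stretchedGauss_of_nonpos hx, ENNReal.ofReal_zero]]
    refine setLIntegral_congr_fun measurableSet_Ioi fun u hu => ?_
    rw [stretchedGauss_eq, gaussProfile_one hu]
  · rw [if_neg hl.ne', if_neg hl.ne']
    -- For l > 1 the outer exponent 1/(1-l) is negative, so a lower bound on the integral is needed.
    refine ENNReal.rpow_le_rpow_of_exponent_nonpos (one_div_nonpos.2 (by linarith)) ?_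
    refine lintegral_rpow_ge_of_one_lt hv hvpos hl h.1 hk hX.le measurable_stretchedGauss
      (stretchedGauss_nonneg h) (fun u hu => ?_) (gaussPowerInt_pos h).le
      (lintegral_Ioi_stretchedGauss_rpow h) hvB
    by_cases hu' : 0 < stretchedGauss p l u
    · exact (stretchedGauss_rpow h hu').ge
    -- Beyond the support the affine function is nonpositive, hence still a minorant.
    · have h1 : ¬ 0 < 1 - (l - 1) * u ^ conjExp p := fun h2 =>
        hu' ((stretchedGauss_pos_iff h).2 ⟨hu, h2⟩)
      exact (mul_nonpos_of_nonneg_of_nonpos hk (not_lt.1 h1)).trans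
        (Real.rpow_nonneg (stretchedGauss_nonneg h u) _)

end Stretched

/-! ### The stretched Gaussian as a decreasing profile -/

section Profile

variable {p l : ℝ}

/-- The form obtained by differentiating the affine relation for g^(l-1). It covers l = 1, and its
factor g^(2-l) combines with the powers of g in down transforms and in the Fisher information. -/
lemma hasDerivAt_stretchedGauss (h : EntClassical p l) {x : ℝ} (hx : 0 < stretchedGauss p l x) :
    HasDerivAt (stretchedGauss p l) (-(conjExp p * gaussConst p l ^ (l - 1) * x ^ (conjExp p - 1) *
      stretchedGauss p l x ^ (2 - l))) x := by
  have ha := gaussConst_pos h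
  obtain ⟨hx0, hx1⟩ := (stretchedGauss_pos_iff h).1 hx
  have hpow : HasDerivAt (fun x : ℝ => x ^ conjExp p) (conjExp p * x ^ (conjExp p - 1)) x :=
    Real.hasDerivAt_rpow_const (Or.inl hx0.ne')
  by_cases hl : l = 1
  · subst hl
    have h1 := (hpow.neg.exp).const_mul (gaussConst p 1)
    refine (h1.congr_of_eventuallyEq ?_).congr_deriv ?_
    · filter_upwards [Ioi_mem_nhds hx0] with y hy
      rw [stretchedGauss_eq, gaussProfile_one hy]
      rfl
    · rw [stretchedGauss_eq, gaussProfile_one hx0]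
      norm_num
      ring
  · have hl1 : l - 1 ≠ 0 := sub_ne_zero.2 hl
    have hbase : HasDerivAt (fun x : ℝ => 1 - (l - 1) * x ^ conjExp p)
        (-((l - 1) * (conjExp p * x ^ (conjExp p - 1)))) x :=
      (hpow.const_mul (l - 1)).const_sub 1
    have h1 := (hbase.rpow_const (p := 1 / (l - 1)) (Or.inl hx1.ne')).const_mul (gaussConst p l)
    refine (h1.congr_of_eventuallyEq ?_).congr_deriv ?_
    · have hev := hbase.continuousAt.eventually (lt_mem_nhds hx1)
      filter_upwards [Ioi_mem_nhds hx0, hev] with y hy hy1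
      rw [stretchedGauss_eq, gaussProfile_of_ne hl hy, max_eq_right hy1.le]
    · rw [stretchedGauss_eq, gaussProfile_of_ne hl hx0, max_eq_right hx1.le,
        Real.mul_rpow ha.le (Real.rpow_nonneg hx1.le _), ← Real.rpow_mul hx1.le]
      have e1 : gaussConst p l ^ (l - 1) * gaussConst p l ^ (2 - l) = gaussConst p l := by
        rw [← Real.rpow_add ha, show l - 1 + (2 - l) = 1 by ring, Real.rpow_one]
      have e2 : 1 / (l - 1) * (2 - l) = 1 / (l - 1) - 1 := by field_simp; ring
      rw [e2]
      generalize (1 - (l - 1) * x ^ conjExp p) ^ (1 / (l - 1) - 1) = E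
      calc _ = -(gaussConst p l * conjExp p * x ^ (conjExp p - 1) * E) := by field_simp
        _ = -((gaussConst p l ^ (l - 1) * gaussConst p l ^ (2 - l)) * conjExp p *
              x ^ (conjExp p - 1) * E) := by rw [e1]
        _ = _ := by ring

lemma isDecreasingProfile_stretchedGauss (h : EntClassical p l) :
    IsDecreasingProfile (stretchedGauss p l) where
  measurable := measurable_stretchedGauss
  nonneg := stretchedGauss_nonneg h
  ordConnected := by
    refine ⟨fun x hx y hy z hz => ?_⟩
    have hx' := (stretchedGauss_pos_iff h).1 hx
    have hy' := (stretchedGauss_pos_iff h).1 hy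
    have hz0 : 0 < z := hx'.1.trans_le hz.1
    refine (stretchedGauss_pos_iff h).2 ⟨hz0, ?_⟩
    have hzr := Real.rpow_pos_of_pos hz0 (conjExp p)
    have hzy : z ^ conjExp p ≤ y ^ conjExp p := Real.rpow_le_rpow hz0.le hz.2 h.1.le
    rcases le_or_gt l 1 with hl | hl
    · nlinarith
    · nlinarith [hy'.2]
  deriv_neg := fun x hx => by
    rw [(hasDerivAt_stretchedGauss h hx).deriv]
    have hx0 := ((stretchedGauss_pos_iff h).1 hx).1
    have ha := gaussConst_pos h
    have hr := h.1
    have h1 := Real.rpow_pos_of_pos ha (l - 1)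
    have h2 := Real.rpow_pos_of_pos hx (2 - l)
    have h3 := Real.rpow_pos_of_pos hx0 (conjExp p - 1)
    exact neg_neg_of_pos (by positivity)

/-- The bound fixes the left end of the support of the mirrored Gaussian. -/
lemma stretchedGauss_lt_gaussConst (h : EntClassical p l) {x : ℝ} (hx : 0 < x) :
    stretchedGauss p l x < gaussConst p l := by
  have ha := gaussConst_pos h
  have hxr := Real.rpow_pos_of_pos hx (conjExp p)
  rw [stretchedGauss_eq]
  refine mul_lt_of_lt_one_right ha ?_
  by_cases hpos : 0 < gaussProfile p l x
  swap
  · linarith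
  obtain ⟨-, hx1⟩ := gaussProfile_pos_iff.1 hpos
  rcases lt_trichotomy l 1 with hl | rfl | hl
  · rw [gaussProfile_of_ne hl.ne hx, max_eq_right hx1.le]
    refine Real.rpow_lt_one_of_one_lt_of_neg ?_ (one_div_neg.2 (by linarith))
    nlinarith
  · rw [gaussProfile_one hx, Real.exp_lt_one_iff]
    linarith
  · rw [gaussProfile_of_ne hl.ne' hx, max_eq_right hx1.le]
    refine Real.rpow_lt_one hx1.le ?_ (one_div_pos.2 (by linarith))
    nlinarith

end Profile

/-! ### The mirrored stretched Gaussians -/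

section Mirrored

variable {p l : ℝ}

/-- As p* = 1 + 1/(p-1) and (l-1)/l > 0, p > 1 would make the two signs opposite. So p < 1, and the
sign condition then says (l-1)/l + p* > 0. -/
lemma EntMirrored.facts (h : EntMirrored p l) : l < 0 ∧ p ≠ 0 ∧ p < 1 ∧
    0 < (l - 1) / l + conjExp p := by
  obtain ⟨hp0, hp1, hl, hs⟩ := h
  have hm : 0 < (l - 1) / l := div_pos_of_neg_of_neg (by linarith) hl
  have hp1' : p - 1 ≠ 0 := sub_ne_zero.2 hp1
  have hr : conjExp p = 1 + 1 / (p - 1) := by rw [conjExp]; field_simp; ring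
  rcases lt_or_gt_of_ne hp1 with hlt | hgt
  · have h1 : 1 / (p - 1) < 0 := one_div_neg.2 (by linarith)
    have h2 : 0 < 1 - conjExp p := by rw [hr]; linarith
    rw [sign_pos h2] at hs
    exact ⟨hl, hp0, hlt, sign_eq_one_iff.1 hs⟩
  · have h1 : 0 < 1 / (p - 1) := one_div_pos.2 (by linarith)
    have h2 : 1 - conjExp p < 0 := by rw [hr]; linarith
    have h3 : 0 < (l - 1) / l + conjExp p := by rw [hr]; linarith
    rw [sign_neg h2, sign_pos h3] at hs
    exact absurd hs (by decide)

lemma conjExp_one_sub (l : ℝ) : conjExp (1 - l) = (l - 1) / l := by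
  rw [conjExp, show 1 - l - 1 = -l by ring, ← neg_sub l 1, neg_div_neg_eq]

/-- With m = (l-1)/l, the conjugate exponent of 1-l, and (1-p)p* = -p, the classical condition
(1-p)(1+m) > 1 is (1-p)(m + p*) > 0. -/
lemma EntMirrored.entClassical (h : EntMirrored p l) : EntClassical (1 - l) (1 - p) := by
  obtain ⟨hl, hp0, hp1, hmr⟩ := h.facts
  have hm : 0 < (l - 1) / l := div_pos_of_neg_of_neg (by linarith) hl
  rw [EntClassical, conjExp_one_sub]
  refine ⟨hm, ?_⟩
  rw [div_lt_iff₀ (by positivity)]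
  have hq : 0 < 1 - p := by linarith
  have e : conjExp p = -p / (1 - p) := by
    rw [conjExp, show p - 1 = -(1 - p) by ring, div_neg, neg_div]
  rw [e] at hmr
  have := mul_pos hq hmr
  have h2 : (1 - p) * ((l - 1) / l + -p / (1 - p)) = (1 - p) * ((l - 1) / l) - p := by
    field_simp
    ring
  linarith

/-- The length of the support of the mirrored stretched Gaussian. -/
noncomputable def mirrorWidth (p l : ℝ) : ℝ := gaussConst (1 - l) (1 - p) ^ (1 - p) / (1 - p)

/-- The amplitude of the mirrored stretched Gaussian. -/
noncomputable def mirrorConst (p l : ℝ) : ℝ := gaussConst (1 - l) (1 - p) ^ p * (l / (l - 1))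

/-- The base of the mirrored stretched Gaussian. -/
noncomputable def mirrorBase (p l s : ℝ) : ℝ := ((|s| / mirrorWidth p l) ^ conjExp p - 1) / p

lemma mirrorWidth_pos (h : EntMirrored p l) : 0 < mirrorWidth p l :=
  div_pos (Real.rpow_pos_of_pos (gaussConst_pos h.entClassical) _) (by linarith [h.facts.2.2.1])

lemma mirrorConst_pos (h : EntMirrored p l) : 0 < mirrorConst p l :=
  mul_pos (Real.rpow_pos_of_pos (gaussConst_pos h.entClassical) _)
    (div_pos_of_neg_of_neg h.facts.1 (by linarith [h.facts.1]))

lemma EntMirrored.conjExp_pos_or (h : EntMirrored p l) :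
    (p < 0 ∧ 0 < conjExp p) ∨ (0 < p ∧ conjExp p < 0) := by
  obtain ⟨hl, hp0, hp1, hmr⟩ := h.facts
  rcases lt_or_gt_of_ne hp0 with hp | hp
  · exact Or.inl ⟨hp, div_pos_of_neg_of_neg hp (by linarith)⟩
  · exact Or.inr ⟨hp, div_neg_of_pos_of_neg hp (by linarith)⟩

/-- The exponents p and p* have opposite signs, so (t^p* - 1)/p is positive exactly for t < 1. -/
lemma mirrorBase_pos_iff (h : EntMirrored p l) {s : ℝ} (hs : s ≠ 0) :
    0 < mirrorBase p l s ↔ |s| < mirrorWidth p l := by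
  have hS := mirrorWidth_pos h
  have ht : 0 < |s| / mirrorWidth p l := div_pos (abs_pos.2 hs) hS
  rw [mirrorBase]
  rcases h.conjExp_pos_or with ⟨hp, hr⟩ | ⟨hp, hr⟩
  · rw [← neg_div_neg_eq, div_pos_iff_of_pos_right (neg_pos.2 hp), neg_pos, sub_neg, Real.rpow_lt_one_iff_of_pos ht, div_lt_one hS,
      one_lt_div hS]
    constructor
    · rintro (h1 | h1)
      · linarith
      · exact h1.1
    · exact fun h1 => Or.inr ⟨h1, hr⟩
  · rw [div_pos_iff_of_pos_right hp, sub_pos, Real.one_lt_rpow_iff_of_pos ht, div_lt_one hS,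
      one_lt_div hS]
    constructor
    · rintro (h1 | h1)
      · linarith
      · exact h1.1
    · exact fun h1 => Or.inr ⟨h1, hr⟩

lemma EntMirrored.conjExp_mul (h : EntMirrored p l) : conjExp p * (1 - p) = -p := by
  have : 1 - p ≠ 0 := by linarith [h.facts.2.2.1]
  rw [conjExp, show p - 1 = -(1 - p) by ring, div_neg]
  field_simp

lemma EntMirrored.conj_pos (h : EntMirrored p l) : 0 < (l - 1) / l :=
  div_pos_of_neg_of_neg (by linarith [h.facts.1]) h.facts.1

lemma one_add_mul_mirrorBase (h : EntMirrored p l) (s : ℝ) :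
    1 + p * mirrorBase p l s = (|s| / mirrorWidth p l) ^ conjExp p := by
  have := h.facts.2.1
  rw [mirrorBase]
  field_simp
  ring

/-- The equation s(x) = s reads g(x)^(1-p) = (1-p)|s|. Since g^(-p) is affine in x^m with m =
(l-1)/l, it solves to x^m = `mirrorBase p l s`. -/
lemma exists_downVar_eq (h : EntMirrored p l) {s : ℝ} (hs : s ∈ Ioo (-mirrorWidth p l) 0) :
    0 < stretchedGauss (1 - l) (1 - p) (mirrorBase p l s ^ (l / (l - 1))) ∧
      downVar (1 + p) (stretchedGauss (1 - l) (1 - p) (mirrorBase p l s ^ (l / (l - 1)))) = s := by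
  obtain ⟨hl, hp0, hp1, hmr⟩ := h.facts
  have hS := mirrorWidth_pos h
  have hC := h.entClassical
  have ha := gaussConst_pos hC
  have hs0 : 0 < |s| := abs_pos.2 hs.2.ne
  have hb : 0 < mirrorBase p l s := (mirrorBase_pos_iff h hs.2.ne).2 (by
    rw [abs_of_neg hs.2]; linarith [hs.1])
  have ht : 0 < |s| / mirrorWidth p l := div_pos hs0 hS
  set x := mirrorBase p l s ^ (l / (l - 1)) with hx
  have hx0 : 0 < x := Real.rpow_pos_of_pos hb _
  have hl1 : l - 1 ≠ 0 := by linarith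
  have hl0 := hl.ne
  have hxm : x ^ conjExp (1 - l) = mirrorBase p l s := by
    rw [conjExp_one_sub, hx, ← Real.rpow_mul hb.le, show l / (l - 1) * ((l - 1) / l) = 1 by
      field_simp, Real.rpow_one]
  have hbase : 1 - (1 - p - 1) * x ^ conjExp (1 - l) = (|s| / mirrorWidth p l) ^ conjExp p := by
    rw [hxm, ← one_add_mul_mirrorBase h]
    ring
  have hpos : 0 < stretchedGauss (1 - l) (1 - p) x :=
    (stretchedGauss_pos_iff hC).2 ⟨hx0, by rw [hbase]; exact Real.rpow_pos_of_pos ht _⟩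
  refine ⟨hpos, ?_⟩
  have h1p : 0 < 1 - p := by linarith
  have hval : stretchedGauss (1 - l) (1 - p) x ^ (1 - p) = (1 - p) * |s| := by
    rw [stretchedGauss_eq, gaussProfile_of_ne (fun h1 => hp0 (by linarith)) hx0, hbase,
      max_eq_right (Real.rpow_nonneg ht.le _), ← Real.rpow_mul ht.le,
      Real.mul_rpow ha.le (Real.rpow_nonneg ht.le _), ← Real.rpow_mul ht.le]
    have e : conjExp p * (1 / (1 - p - 1)) * (1 - p) = 1 := by
      rw [mul_right_comm, h.conjExp_mul, show 1 - p - 1 = -p by ring]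
      field_simp
    have ha1 := Real.rpow_pos_of_pos ha (1 - p)
    rw [e, Real.rpow_one, mirrorWidth]
    field_simp
  rw [downVar_of_ne (fun h2 => by linarith), show 2 - (1 + p) = 1 - p by ring, hval, abs_of_neg hs.2,
    show 1 + p - 2 = -(1 - p) by ring]
  field_simp

/-- The order 1+p is the one for which g^(1+p) cancels against the same power of g in |g'|; only a
power of x survives. -/
lemma mirroredGauss_downVar (h : EntMirrored p l) {x : ℝ}
    (hx : 0 < stretchedGauss (1 - l) (1 - p) x) :
    mirroredGauss p l (downVar (1 + p) (stretchedGauss (1 - l) (1 - p) x)) =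
      mirrorConst p l * x ^ (1 / l) := by
  have hC := h.entClassical
  have ha := gaussConst_pos hC
  have hx0 := ((stretchedGauss_pos_iff hC).1 hx).1
  have hm := h.conj_pos
  have hl := h.facts.1
  rw [mirroredGauss, (isDecreasingProfile_stretchedGauss hC).downTransform_downVar _ hx,
    (hasDerivAt_stretchedGauss hC hx).deriv, conjExp_one_sub, abs_neg,
    show 2 - (1 - p) = 1 + p by ring]
  have h1 := Real.rpow_pos_of_pos ha (1 - p - 1)
  have h2 := Real.rpow_pos_of_pos hx (1 + p)
  have h3 := Real.rpow_pos_of_pos hx0 ((l - 1) / l - 1)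
  rw [abs_of_pos (by positivity), mirrorConst]
  have e1 : gaussConst (1 - l) (1 - p) ^ p = (gaussConst (1 - l) (1 - p) ^ (1 - p - 1))⁻¹ := by
    rw [← Real.rpow_neg ha.le]
    congr 1
    ring
  have e2 : x ^ (1 / l) = (x ^ ((l - 1) / l - 1))⁻¹ := by
    rw [← Real.rpow_neg hx0.le]
    congr 1
    have := hl.ne
    field_simp
    ring
  have hl1 : l - 1 ≠ 0 := by linarith
  have hl0 := hl.ne
  rw [e1, e2]
  field_simp

lemma mirroredGauss_eq (h : EntMirrored p l) {s : ℝ} (hs : s ∈ Ioo (-mirrorWidth p l) 0) :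
    mirroredGauss p l s = mirrorConst p l * mirrorBase p l s ^ (1 / (l - 1)) := by
  obtain ⟨h1, h2⟩ := exists_downVar_eq h hs
  have hb : 0 < mirrorBase p l s := (mirrorBase_pos_iff h hs.2.ne).2 (by
    rw [abs_of_neg hs.2]; linarith [hs.1])
  have h3 := mirroredGauss_downVar h h1
  rw [h2] at h3
  have hl := h.facts.1.ne
  rw [h3, ← Real.rpow_mul hb.le]
  congr 2
  field_simp

lemma downVar_stretchedGauss_mem (h : EntMirrored p l) {x : ℝ}
    (hx : 0 < stretchedGauss (1 - l) (1 - p) x) :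
    downVar (1 + p) (stretchedGauss (1 - l) (1 - p) x) ∈ Ioo (-mirrorWidth p l) 0 := by
  have hC := h.entClassical
  have hx0 := ((stretchedGauss_pos_iff hC).1 hx).1
  have h1p : 0 < 1 - p := by linarith [h.facts.2.2.1]
  have hlt := Real.rpow_lt_rpow hx.le (stretchedGauss_lt_gaussConst hC hx0) h1p
  have hpos := Real.rpow_pos_of_pos hx (1 - p)
  rw [downVar_of_ne (fun h2 => by linarith), show 2 - (1 + p) = 1 - p by ring,
    show 1 + p - 2 = -(1 - p) by ring, div_neg, mirrorWidth]
  exact ⟨neg_lt_neg (by gcongr), neg_neg_of_pos (by positivity)⟩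

lemma mirroredGauss_of_notMem (h : EntMirrored p l) {s : ℝ}
    (hs : s ∉ Ioo (-mirrorWidth p l) 0) : mirroredGauss p l s = 0 := by
  refine IsDecreasingProfile.downTransform_of_notMem _ ?_
  rintro ⟨x, hx, rfl⟩
  exact hs (downVar_stretchedGauss_mem h hx)

lemma mirrorBase_pos (h : EntMirrored p l) {s : ℝ} (hs : s ∈ Ioo (-mirrorWidth p l) 0) :
    0 < mirrorBase p l s := (mirrorBase_pos_iff h hs.2.ne).2 (by
  rw [abs_of_neg hs.2]; linarith [hs.1])

lemma mirroredGauss_pos_iff (h : EntMirrored p l) {s : ℝ} :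
    0 < mirroredGauss p l s ↔ s ∈ Ioo (-mirrorWidth p l) 0 := by
  refine ⟨fun h1 => ?_, fun hs => ?_⟩
  · by_contra hs
    rw [mirroredGauss_of_notMem h hs] at h1
    exact lt_irrefl _ h1
  · rw [mirroredGauss_eq h hs]
    exact mul_pos (mirrorConst_pos h) (Real.rpow_pos_of_pos (mirrorBase_pos h hs) _)

lemma mirroredGauss_support (h : EntMirrored p l) :
    {s | 0 < mirroredGauss p l s} = Ioo (-mirrorWidth p l) 0 :=
  Set.ext fun _ => mirroredGauss_pos_iff h

lemma mirroredGauss_nonneg (h : EntMirrored p l) (s : ℝ) : 0 ≤ mirroredGauss p l s :=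
  IsDecreasingProfile.downTransform_nonneg' (stretchedGauss_nonneg h.entClassical) _ _

/-- The base is affine in |s|^p*, so the mirrored Gaussian has the property required of a reference
profile. -/
lemma mirroredGauss_rpow (h : EntMirrored p l) {s : ℝ} (hs : s ∈ Ioo (-mirrorWidth p l) 0) :
    mirroredGauss p l s ^ (l - 1) = mirrorConst p l ^ (l - 1) * mirrorBase p l s := by
  have hb := mirrorBase_pos h hs
  have hl1 : l - 1 ≠ 0 := by linarith [h.facts.1]
  rw [mirroredGauss_eq h hs, Real.mul_rpow (mirrorConst_pos h).le (Real.rpow_nonneg hb.le _),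
    ← Real.rpow_mul hb.le, one_div_mul_cancel hl1, Real.rpow_one]

/-- The positive constant in the logarithmic derivative of the mirrored stretched Gaussian. -/
noncomputable def mirrorSlope (p l : ℝ) : ℝ :=
  mirrorConst p l ^ (l - 1) / ((1 - l) * ((1 - p) * mirrorWidth p l ^ conjExp p))

lemma mirrorSlope_pos (h : EntMirrored p l) : 0 < mirrorSlope p l := by
  have h1 := Real.rpow_pos_of_pos (mirrorConst_pos h) (l - 1)
  have h2 := Real.rpow_pos_of_pos (mirrorWidth_pos h) (conjExp p)
  have h3 : 0 < 1 - l := by linarith [h.facts.1]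
  have h4 : 0 < 1 - p := by linarith [h.facts.2.2.1]
  rw [mirrorSlope]
  positivity

/-- The derivative obeys the same law as that of the stretched Gaussian, which lets one computation
treat both down transforms. The sign comes from p*/p = -1/(1-p), for either sign of p. -/
lemma hasDerivAt_mirroredGauss (h : EntMirrored p l) {s : ℝ}
    (hs : s ∈ Ioo (-mirrorWidth p l) 0) :
    HasDerivAt (mirroredGauss p l) (-(mirrorSlope p l * |s| ^ (conjExp p - 1) *
      mirroredGauss p l s ^ (2 - l))) s := by
  obtain ⟨hl, hp0, hp1, hmr⟩ := h.facts
  have hb := mirrorBase_pos h hs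
  have hS := mirrorWidth_pos h
  have hcC := mirrorConst_pos h
  have hns : 0 < -s := by linarith [hs.2]
  have ht : 0 < -s / mirrorWidth p l := div_pos hns hS
  have h1 : HasDerivAt (fun s : ℝ => -s / mirrorWidth p l) (-1 / mirrorWidth p l) s :=
    (hasDerivAt_id s).neg.div_const _
  have h2 := (((h1.rpow_const (p := conjExp p) (Or.inl ht.ne')).sub_const 1).div_const p)
  have hbb : mirrorBase p l s = ((-s / mirrorWidth p l) ^ conjExp p - 1) / p := by
    rw [mirrorBase, abs_of_neg hs.2]
  have h3 := (h2.rpow_const (p := 1 / (l - 1)) (Or.inl (by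
    rw [← hbb]; exact hb.ne'))).const_mul (mirrorConst p l)
  refine (h3.congr_of_eventuallyEq ?_).congr_deriv ?_
  · filter_upwards [isOpen_Ioo.mem_nhds hs] with y hy
    rw [mirroredGauss_eq h hy, mirrorBase, abs_of_neg hy.2]
  · rw [← hbb, mirroredGauss_eq h hs, Real.mul_rpow hcC.le (Real.rpow_nonneg hb.le _),
      ← Real.rpow_mul hb.le, abs_of_neg hs.2, Real.div_rpow hns.le hS.le, mirrorSlope]
    have hl1 : l - 1 ≠ 0 := by linarith
    have hl2 : 1 - l ≠ 0 := by linarith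
    have hp2 : 1 - p ≠ 0 := by linarith
    have e1 : mirrorConst p l ^ (l - 1) * mirrorConst p l ^ (2 - l) = mirrorConst p l := by
      rw [← Real.rpow_add hcC, show l - 1 + (2 - l) = 1 by ring, Real.rpow_one]
    have e2 : 1 / (l - 1) * (2 - l) = 1 / (l - 1) - 1 := by field_simp; ring
    have e3 : mirrorWidth p l ^ conjExp p = mirrorWidth p l ^ (conjExp p - 1) *
        mirrorWidth p l := by rw [Real.rpow_sub_one hS.ne', div_mul_cancel₀ _ hS.ne']
    have e4 : conjExp p = -p / (1 - p) := by
      rw [eq_div_iff hp2]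
      exact h.conjExp_mul
    have hW := Real.rpow_pos_of_pos hS (conjExp p - 1)
    rw [e2, e3]
    generalize mirrorBase p l s ^ (1 / (l - 1) - 1) = E
    generalize (-s) ^ (conjExp p - 1) = T
    calc _ = -(mirrorConst p l / ((1 - l) * ((1 - p) * (mirrorWidth p l ^ (conjExp p - 1) *
          mirrorWidth p l))) * T * E) := by
          rw [show l - 1 = -(1 - l) by ring]
          generalize mirrorWidth p l ^ (conjExp p - 1) = W at hW ⊢
          rw [e4]
          field_simp
      _ = -((mirrorConst p l ^ (l - 1) * mirrorConst p l ^ (2 - l)) /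
          ((1 - l) * ((1 - p) * (mirrorWidth p l ^ (conjExp p - 1) *
          mirrorWidth p l))) * T * E) := by rw [e1]
      _ = _ := by ring

lemma isDecreasingProfile_mirroredGauss (h : EntMirrored p l) :
    IsDecreasingProfile (mirroredGauss p l) where
  measurable := (isDecreasingProfile_stretchedGauss h.entClassical).measurable_downTransform _
  nonneg := mirroredGauss_nonneg h
  ordConnected := by
    rw [mirroredGauss_support h]
    exact ordConnected_Ioo
  deriv_neg := fun s hs => by
    have hs' := (mirroredGauss_pos_iff h).1 hs
    rw [(hasDerivAt_mirroredGauss h hs').deriv]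
    have h1 := mirrorSlope_pos h
    have h2 := Real.rpow_pos_of_pos (abs_pos.2 hs'.2.ne) (conjExp p - 1)
    have h3 := Real.rpow_pos_of_pos hs (2 - l)
    exact neg_neg_of_pos (by positivity)

lemma lintegral_mirroredGauss (h : EntMirrored p l) :
    ∫⁻ s, ENNReal.ofReal (mirroredGauss p l s) = 1 :=
  ((isDecreasingProfile_stretchedGauss h.entClassical).lintegral_downTransform _).trans
    (lintegral_stretchedGauss h.entClassical)

/-- The moment of order `p*` of the mirrored stretched Gaussian. -/
noncomputable def mirrorMoment (p l : ℝ) : ℝ :=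
  (1 - p) ^ (-conjExp p) * gaussPowerInt (1 - l) (1 - p)

/-- The integral `∫ g^l` for the mirrored stretched Gaussian. -/
noncomputable def mirrorPowerInt (p l : ℝ) : ℝ :=
  mirrorConst p l ^ (l - 1) * gaussMoment (1 - l) (1 - p)

lemma mirrorMoment_pos (h : EntMirrored p l) : 0 < mirrorMoment p l :=
  mul_pos (Real.rpow_pos_of_pos (by linarith [h.facts.2.2.1]) _) (gaussPowerInt_pos h.entClassical)

lemma mirrorPowerInt_pos (h : EntMirrored p l) : 0 < mirrorPowerInt p l :=
  mul_pos (Real.rpow_pos_of_pos (mirrorConst_pos h) _) (gaussMoment_pos h.entClassical)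

/-- At s = s(x), |s|^p* is a multiple of g(x)^(-p): the moment of the mirrored density is a power
integral of the original one. -/
lemma lintegral_abs_rpow_mul_mirroredGauss (h : EntMirrored p l) :
    ∫⁻ s, ENNReal.ofReal |s| ^ conjExp p * ENNReal.ofReal (mirroredGauss p l s) =
      ENNReal.ofReal (mirrorMoment p l) := by
  have hC := h.entClassical
  have h1p : 0 < 1 - p := by linarith [h.facts.2.2.1]
  rw [mirroredGauss, (isDecreasingProfile_stretchedGauss hC).lintegral_mul_downTransform (1 + p)
    fun s => ENNReal.ofReal |s| ^ conjExp p, mirrorMoment,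
    ENNReal.ofReal_mul (Real.rpow_nonneg h1p.le _), ← lintegral_stretchedGauss_rpow hC,
    ← lintegral_const_mul' _ _ ENNReal.ofReal_ne_top]
  refine setLIntegral_congr_fun
    (isDecreasingProfile_stretchedGauss hC).measurableSet_support fun x hx => ?_
  have hx' : 0 < stretchedGauss (1 - l) (1 - p) x := hx
  have hpos := Real.rpow_pos_of_pos hx' (1 - p)
  have hq := div_pos hpos h1p
  rw [downVar_of_ne (fun h2 => by linarith), show 2 - (1 + p) = 1 - p by ring,
    show 1 + p - 2 = -(1 - p) by ring, div_neg, abs_neg, abs_of_pos hq,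
    ENNReal.ofReal_rpow_of_pos hq, ENNReal.ofReal_rpow_of_pos hx',
    ← ENNReal.ofReal_mul (Real.rpow_nonneg hq.le _),
    ← ENNReal.ofReal_mul (Real.rpow_nonneg h1p.le _)]
  congr 1
  rw [Real.div_rpow hpos.le h1p.le, ← Real.rpow_mul hx'.le, mul_comm (1 - p), h.conjExp_mul,
    Real.rpow_neg h1p.le, div_mul_eq_mul_div, ← Real.rpow_add_one hx'.ne',
    show -p + 1 = 1 - p by ring]
  ring

/-- Conversely, the (l-1)-th power of the mirrored density at s(x) is a multiple of x^((l-1)/l), so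
its power integral is a moment of the original. -/
lemma lintegral_mirroredGauss_rpow (h : EntMirrored p l) :
    ∫⁻ s in {s | 0 < mirroredGauss p l s}, ENNReal.ofReal (mirroredGauss p l s) ^ l =
      ENNReal.ofReal (mirrorPowerInt p l) := by
  have hC := h.entClassical
  have hg := isDecreasingProfile_stretchedGauss hC
  have hcC := mirrorConst_pos h
  have hl := h.facts.1
  have e0 : ∫⁻ s in {s | 0 < mirroredGauss p l s}, ENNReal.ofReal (mirroredGauss p l s) ^ l =
      ∫⁻ s, ENNReal.ofReal (mirroredGauss p l s) ^ (l - 1) *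
        ENNReal.ofReal (mirroredGauss p l s) := by
    rw [← lintegral_indicator (isDecreasingProfile_mirroredGauss h).measurableSet_support]
    refine lintegral_congr fun s => ?_
    by_cases hs : 0 < mirroredGauss p l s
    · rw [indicator_of_mem (show s ∈ {s | 0 < mirroredGauss p l s} from hs),
        ENNReal.ofReal_rpow_of_pos hs, ENNReal.ofReal_rpow_of_pos hs,
        ← ENNReal.ofReal_mul (Real.rpow_nonneg hs.le _), ← Real.rpow_add_one hs.ne',
        sub_add_cancel]
    · rw [indicator_of_notMem (show s ∉ {s | 0 < mirroredGauss p l s} from hs),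
        ENNReal.ofReal_of_nonpos (not_lt.1 hs), mul_zero]
  have e1 := hg.lintegral_mul_downTransform (1 + p) fun s =>
    ENNReal.ofReal (mirroredGauss p l s) ^ (l - 1)
  rw [e0]
  refine e1.trans ?_
  rw [mirrorPowerInt, ENNReal.ofReal_mul (Real.rpow_nonneg hcC.le _),
    ← lintegral_rpow_mul_stretchedGauss hC, ← lintegral_const_mul' _ _ ENNReal.ofReal_ne_top,
    ← lintegral_indicator hg.measurableSet_support, ← lintegral_indicator measurableSet_Ioi]
  refine lintegral_congr fun x => ?_
  by_cases hx : 0 < stretchedGauss (1 - l) (1 - p) x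
  · have hx0 := ((stretchedGauss_pos_iff hC).1 hx).1
    have hpos : 0 < mirrorConst p l * x ^ (1 / l) := by positivity
    rw [indicator_of_mem (show x ∈ {x | 0 < stretchedGauss (1 - l) (1 - p) x} from hx),
      indicator_of_mem (show x ∈ Ioi 0 from hx0), mirroredGauss_downVar h hx,
      ENNReal.ofReal_rpow_of_pos hpos, ← ENNReal.ofReal_mul (Real.rpow_nonneg hpos.le _),
      ← ENNReal.ofReal_mul (Real.rpow_nonneg hcC.le _),
      Real.mul_rpow hcC.le (Real.rpow_nonneg hx0.le _), ← Real.rpow_mul hx0.le, conjExp_one_sub,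
      mul_assoc, show 1 / l * (l - 1) = (l - 1) / l by ring]
  · rw [indicator_of_notMem (show x ∉ {x | 0 < stretchedGauss (1 - l) (1 - p) x} from hx)]
    have h0 : stretchedGauss (1 - l) (1 - p) x = 0 :=
      le_antisymm (not_lt.1 hx) (stretchedGauss_nonneg hC x)
    by_cases hx0 : 0 < x
    · rw [indicator_of_mem (show x ∈ Ioi 0 from hx0), h0]
      simp
    · rw [indicator_of_notMem (show x ∉ Ioi 0 from hx0)]

lemma mirrorWidth_rpow (h : EntMirrored p l) : mirrorWidth p l ^ conjExp p =
    (1 - p) ^ (-conjExp p) * gaussConst (1 - l) (1 - p) ^ (-p) := by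
  have ha := gaussConst_pos h.entClassical
  have h1p : 0 < 1 - p := by linarith [h.facts.2.2.1]
  rw [mirrorWidth, Real.div_rpow (Real.rpow_nonneg ha.le _) h1p.le, ← Real.rpow_mul ha.le,
    mul_comm (1 - p), h.conjExp_mul, Real.rpow_neg h1p.le]
  ring

lemma mirrorMoment_div (h : EntMirrored p l) : mirrorMoment p l / mirrorWidth p l ^ conjExp p =
    1 + p * gaussMoment (1 - l) (1 - p) := by
  have ha := gaussConst_pos h.entClassical
  have h1p : 0 < 1 - p := by linarith [h.facts.2.2.1]
  have h1 := Real.rpow_pos_of_pos h1p (-conjExp p)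
  have h2 := Real.rpow_pos_of_pos ha (-p)
  rw [mirrorWidth_rpow h, mirrorMoment, gaussPowerInt, show 1 - p - 1 = -p by ring]
  field_simp
  ring

lemma deviation_mirroredGauss (h : EntMirrored p l) :
    deviation (conjExp p) (mirroredGauss p l) =
      ENNReal.ofReal (mirrorMoment p l) ^ (1 / conjExp p) := by
  have : conjExp p ≠ 0 := by
    rcases h.conjExp_pos_or with h1 | h1
    · exact h1.2.ne'
    · exact h1.2.ne
  rw [deviation, if_neg this, lintegral_abs_rpow_mul_mirroredGauss h]

lemma renyiPower_mirroredGauss (h : EntMirrored p l) :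
    renyiPower l (mirroredGauss p l) = ENNReal.ofReal (mirrorPowerInt p l) ^ (1 / (1 - l)) := by
  rw [renyiPower, if_neg (by linarith [h.facts.1]), lintegral_mirroredGauss_rpow h]

/-- The moment-entropy inequality in the mirrored range. -/
lemma tailMoment_div_le_deviation_div {μ : Measure ℝ} [IsProbabilityMeasure μ]
    [NullSingletonClass μ] {w : ℝ → ℝ} (h : EntMirrored p l) (hw : Measurable w)
    (hpos : ∀ᵐ x ∂μ, 0 < w x)
    (hex : ¬ (tailMoment μ (conjExp p) w ^ (1 / conjExp p) = ∞ ∧ weightPower μ l w = ∞)) :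
    tailMoment μ (conjExp p) w ^ (1 / conjExp p) / weightPower μ l w ≤
      deviation (conjExp p) (mirroredGauss p l) / renyiPower l (mirroredGauss p l) := by
  obtain ⟨hl, hp0, hp1, hmr⟩ := h.facts
  have hS := mirrorWidth_pos h
  have hneg : ∀ u ∈ Ioo 0 (mirrorWidth p l), -u ∈ Ioo (-mirrorWidth p l) 0 := fun u hu =>
    ⟨neg_lt_neg hu.2, neg_neg_of_pos hu.1⟩
  have hbase : ∀ u ∈ Ioo 0 (mirrorWidth p l),
      ((u / mirrorWidth p l) ^ conjExp p - 1) / p = mirrorBase p l (-u) := fun u hu => by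
    rw [mirrorBase, abs_neg, abs_of_pos hu.1]
  have hr0 : conjExp p ≠ 0 := by
    rcases h.conjExp_pos_or with h1 | h1
    · exact h1.2.ne'
    · exact h1.2.ne
  rw [deviation_mirroredGauss h, renyiPower_mirroredGauss h]
  -- Tails are positive while the mirrored Gaussian lives on (-S, 0), so the reference profile is
  -- its reflection.
  refine tailMoment_div_le (G := fun u => mirroredGauss p l (-u)) hl hr0 (Or.inr (by linarith)) hS
    (Real.rpow_pos_of_pos (mirrorConst_pos h) (l - 1)) (p := p) ?_ ?_ (mirrorPowerInt_pos h) ?_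
    ((isDecreasingProfile_mirroredGauss h).measurable.comp measurable_neg) ?_ ?_ ?_ hw hpos hex
  · rw [mirrorMoment_div h, gaussMoment, conjExp_one_sub]
    have hden := h.entClassical.den_pos
    rw [conjExp_one_sub] at hden
    have e4 : conjExp p = -p / (1 - p) := by
      rw [eq_div_iff (by linarith)]
      exact h.conjExp_mul
    rw [e4] at hmr ⊢
    generalize (l - 1) / l = m at hmr hden ⊢
    have h1p : 1 - p ≠ 0 := by linarith
    have h2 := hmr.ne'
    have h3 := hden.ne'
    have h4 : m + -p / (1 - p) = (1 - p - 1 + (1 - p) * m) / (1 - p) := by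
      field_simp
      ring
    rw [h4]
    field_simp
    ring
  · rw [mirrorMoment_div h, mirrorPowerInt]
    field_simp
    ring
  · intro u hu
    rw [hbase u hu]
    exact mirrorBase_pos h (hneg u hu)
  · intro u hu
    exact (mirroredGauss_pos_iff h).2 (hneg u hu)
  · intro u hu
    rw [hbase u hu]
    exact mirroredGauss_rpow h (hneg u hu)
  · rw [← lintegral_mirroredGauss_rpow h, mirroredGauss_support h,
      ← lintegral_indicator measurableSet_Ioo, ← lintegral_indicator measurableSet_Ioo,
      ← lintegral_neg_arg]
    refine lintegral_congr fun u => ?_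
    by_cases hu : u ∈ Ioo (-mirrorWidth p l) 0
    · have hu' : -u ∈ Ioo 0 (mirrorWidth p l) := ⟨by linarith [hu.2], by linarith [hu.1]⟩
      rw [indicator_of_mem hu', indicator_of_mem hu, neg_neg,
        ENNReal.ofReal_rpow_of_pos ((mirroredGauss_pos_iff h).2 hu)]
    · have hu' : -u ∉ Ioo 0 (mirrorWidth p l) := fun h1 =>
        hu ⟨by linarith [h1.2], by linarith [h1.1]⟩
      rw [indicator_of_notMem hu', indicator_of_notMem hu]

end Mirrored

/-! ### The constant of the moment-entropy inequality -/

section Kappa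

variable {p l : ℝ}

lemma EntClassical.extremalGauss_eq (h : EntClassical p l) :
    extremalGauss p l = stretchedGauss p l := by
  rw [extremalGauss, if_neg (not_lt.2 h.pos.le)]

lemma EntMirrored.extremalGauss_eq (h : EntMirrored p l) :
    extremalGauss p l = mirroredGauss p l := by
  rw [extremalGauss, if_pos h.facts.1]

lemma EntClassical.theta0_eq (h : EntClassical p l) : theta0 p l = 1 := by
  rw [theta0, if_neg (not_lt.2 h.pos.le)]

lemma EntMirrored.theta0_eq (h : EntMirrored p l) : theta0 p l = conjExp p - 1 := by
  rw [theta0, if_pos h.facts.1]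

lemma EntMirrored.conjExp_sub_one (h : EntMirrored p l) : conjExp p - 1 = -(1 / (1 - p)) := by
  have : 1 - p ≠ 0 := by linarith [h.facts.2.2.1]
  rw [conjExp, show p - 1 = -(1 - p) by ring, div_neg]
  field_simp
  ring

lemma extremalGauss_functionals_ne (h : EntClassical p l ∨ EntMirrored p l) :
    (deviation (conjExp p) (extremalGauss p l) ≠ 0 ∧
      deviation (conjExp p) (extremalGauss p l) ≠ ∞) ∧
    (renyiPower l (extremalGauss p l) ≠ 0 ∧ renyiPower l (extremalGauss p l) ≠ ∞) := by
  rcases h with h | h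
  · rw [h.extremalGauss_eq]
    exact ⟨deviation_stretchedGauss_ne h, renyiPower_stretchedGauss_ne h⟩
  · rw [h.extremalGauss_eq, deviation_mirroredGauss h, renyiPower_mirroredGauss h,
      ENNReal.ofReal_rpow_of_pos (mirrorMoment_pos h),
      ENNReal.ofReal_rpow_of_pos (mirrorPowerInt_pos h)]
    exact ⟨⟨by simpa using Real.rpow_pos_of_pos (mirrorMoment_pos h) _, ENNReal.ofReal_ne_top⟩,
      ⟨by simpa using Real.rpow_pos_of_pos (mirrorPowerInt_pos h) _, ENNReal.ofReal_ne_top⟩⟩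

/-- In |g^(-1-p) g'| the powers of g cancel and a power of x remains, so the Fisher integral is a
moment of g, the same one as in the power integral of the mirrored Gaussian. -/
lemma fisherDev_stretchedGauss (h : EntMirrored p l) :
    fisherDev (1 - l) (1 - p) (stretchedGauss (1 - l) (1 - p)) =
      ENNReal.ofReal (mirrorPowerInt p l) ^ (1 / ((1 - l) * (1 - p))) := by
  have hC := h.entClassical
  have hg := isDecreasingProfile_stretchedGauss hC
  have hcC := mirrorConst_pos h
  have ha := gaussConst_pos hC
  have hm := h.conj_pos
  have hl := h.facts.1
  rw [fisherDev]
  congr 1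
  rw [mirrorPowerInt, ENNReal.ofReal_mul (Real.rpow_nonneg hcC.le _),
    ← lintegral_rpow_mul_stretchedGauss hC, ← lintegral_const_mul' _ _ ENNReal.ofReal_ne_top,
    ← lintegral_indicator hg.measurableSet_support, ← lintegral_indicator measurableSet_Ioi]
  refine lintegral_congr fun x => ?_
  by_cases hx : 0 < stretchedGauss (1 - l) (1 - p) x
  · have hx0 := ((stretchedGauss_pos_iff hC).1 hx).1
    rw [indicator_of_mem (show x ∈ {x | 0 < stretchedGauss (1 - l) (1 - p) x} from hx),
      indicator_of_mem (show x ∈ Ioi 0 from hx0), (hasDerivAt_stretchedGauss hC hx).deriv,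
      conjExp_one_sub]
    have h1 := Real.rpow_pos_of_pos ha (1 - p - 1)
    have h2 := Real.rpow_pos_of_pos hx (2 - (1 - p))
    have h3 := Real.rpow_pos_of_pos hx0 ((l - 1) / l - 1)
    have e1 : |stretchedGauss (1 - l) (1 - p) x ^ (1 - p - 2) *
        -((l - 1) / l * gaussConst (1 - l) (1 - p) ^ (1 - p - 1) * x ^ ((l - 1) / l - 1) *
          stretchedGauss (1 - l) (1 - p) x ^ (2 - (1 - p)))| =
        (mirrorConst p l)⁻¹ * x ^ (-(1 / l)) := by
      have e2 : stretchedGauss (1 - l) (1 - p) x ^ (1 - p - 2) =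
          (stretchedGauss (1 - l) (1 - p) x ^ (2 - (1 - p)))⁻¹ := by
        rw [← Real.rpow_neg hx.le]
        congr 1
        ring
      have e3 : gaussConst (1 - l) (1 - p) ^ (1 - p - 1) =
          (gaussConst (1 - l) (1 - p) ^ p)⁻¹ := by
        rw [← Real.rpow_neg ha.le]
        congr 1
        ring
      have e4 : -(1 / l) = (l - 1) / l - 1 := by
        have := hl.ne
        field_simp
        ring
      rw [abs_mul, abs_neg, abs_of_pos (Real.rpow_pos_of_pos hx _), abs_of_pos (by positivity), e2,
        e3, mirrorConst, e4]
      have := Real.rpow_pos_of_pos ha p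
      have hl0 := hl.ne
      have hl1 : l - 1 ≠ 0 := by linarith
      field_simp
    have hpos : 0 < (mirrorConst p l)⁻¹ * x ^ (-(1 / l)) := by positivity
    rw [e1, ENNReal.ofReal_rpow_of_pos hpos, ← ENNReal.ofReal_mul (Real.rpow_nonneg hpos.le _),
      ← ENNReal.ofReal_mul (Real.rpow_nonneg hcC.le _)]
    congr 1
    rw [Real.mul_rpow (inv_nonneg.2 hcC.le) (Real.rpow_nonneg hx0.le _), ← Real.rpow_mul hx0.le,
      Real.inv_rpow hcC.le, ← Real.rpow_neg hcC.le, neg_sub,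
      show -(1 / l) * (1 - l) = (l - 1) / l by ring, mul_assoc]
  · rw [indicator_of_notMem (show x ∉ {x | 0 < stretchedGauss (1 - l) (1 - p) x} from hx)]
    have h0 : stretchedGauss (1 - l) (1 - p) x = 0 :=
      le_antisymm (not_lt.1 hx) (stretchedGauss_nonneg hC x)
    by_cases hx0 : 0 < x
    · rw [indicator_of_mem (show x ∈ Ioi 0 from hx0), h0]
      simp
    · rw [indicator_of_notMem (show x ∉ Ioi 0 from hx0)]

/-- Gives both ranges one form. In the mirrored range the Fisher factor is the power N^(1-p*) of the
mirrored density, and the remaining factors are the power σ^(p*-1) of its deviation. -/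
lemma kappa0_eq (h : EntClassical p l ∨ EntMirrored p l) :
    kappa0 p l = (deviation (conjExp p) (extremalGauss p l) /
      renyiPower l (extremalGauss p l)) ^ theta0 p l := by
  rcases h with h | h
  · rw [kappa0, if_neg (not_lt.2 h.pos.le), h.extremalGauss_eq, h.theta0_eq, ENNReal.rpow_one]
  · obtain ⟨hl, hp0, hp1, hmr⟩ := h.facts
    have hB := mirrorMoment_pos h
    have hA := mirrorPowerInt_pos h
    have hY := gaussPowerInt_pos h.entClassical
    have h1p : 0 < 1 - p := by linarith
    have hl1 : 0 < 1 - l := by linarith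
    have hAr := Real.rpow_pos_of_pos hA (1 / (1 - l))
    have hBr := Real.rpow_pos_of_pos hB (1 / conjExp p)
    have hr0 : conjExp p ≠ 0 := by
      rcases h.conjExp_pos_or with h1 | h1
      · exact h1.2.ne'
      · exact h1.2.ne
    rw [kappa0, if_pos hl, h.extremalGauss_eq, h.theta0_eq, fisherDev_stretchedGauss h,
      deviation_mirroredGauss h, renyiPower_mirroredGauss h, renyiPower, if_neg (by
        intro h1; exact hp0 (by linarith)), lintegral_stretchedGauss_rpow h.entClassical,
      sub_sub_cancel, ENNReal.ofReal_rpow_of_pos hA, ENNReal.ofReal_rpow_of_pos hB,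
      ENNReal.ofReal_rpow_of_pos hA, ENNReal.ofReal_rpow_of_pos hY,
      ← ENNReal.ofReal_div_of_pos hAr, ENNReal.ofReal_rpow_of_pos (div_pos hBr hAr),
      ← ENNReal.ofReal_mul (by positivity), ← ENNReal.ofReal_mul (by positivity)]
    congr 1
    have hrm := h.conjExp_mul
    have e1 : mirrorMoment p l ^ (1 / conjExp p * (conjExp p - 1)) =
        (1 - p) ^ (1 / (1 - p)) * gaussPowerInt (1 - l) (1 - p) ^ (1 / p) := by
      have e : 1 / conjExp p * (conjExp p - 1) = 1 / p := by
        rw [h.conjExp_sub_one, eq_div_of_mul_eq h1p.ne' hrm]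
        field_simp
      rw [e, mirrorMoment, Real.mul_rpow (Real.rpow_nonneg h1p.le _) hY.le,
        ← Real.rpow_mul h1p.le, eq_div_of_mul_eq h1p.ne' hrm]
      congr 2
      field_simp
    have e2 : |conjExp p - 1| ^ (conjExp p - 1) = (1 - p) ^ (1 / (1 - p)) := by
      rw [h.conjExp_sub_one, abs_neg, abs_of_pos (by positivity), one_div, Real.inv_rpow h1p.le,
        Real.rpow_neg h1p.le, inv_inv]
    have e3 : mirrorPowerInt p l ^ (1 / ((1 - l) * (1 - p))) =
        (mirrorPowerInt p l ^ (1 / (1 - l) * (conjExp p - 1)))⁻¹ := by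
      rw [← Real.rpow_neg hA.le, h.conjExp_sub_one]
      congr 1
      field_simp
    rw [Real.div_rpow hBr.le hAr.le, ← Real.rpow_mul hB.le, ← Real.rpow_mul hA.le, e1, e2, e3]
    ring

lemma kappa0_pos (h : EntClassical p l ∨ EntMirrored p l) : 0 < kappa0 p l := by
  obtain ⟨⟨h1, h2⟩, h3, h4⟩ := extremalGauss_functionals_ne h
  rw [kappa0_eq h]
  exact ENNReal.rpow_pos (ENNReal.div_pos h1 h4) (ENNReal.div_ne_top h2 h3)

lemma kappa0_lt_top (h : EntClassical p l ∨ EntMirrored p l) : kappa0 p l < ∞ := by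
  obtain ⟨⟨h1, h2⟩, h3, h4⟩ := extremalGauss_functionals_ne h
  rw [kappa0_eq h]
  exact (ENNReal.rpow_ne_top_of_ne_zero (ENNReal.div_pos h1 h4).ne'
    (ENNReal.div_ne_top h2 h3)).lt_top

/-- The moment-entropy inequality. -/
lemma kappa0_le {μ : Measure ℝ} [IsProbabilityMeasure μ] [NullSingletonClass μ]
    {w : ℝ → ℝ} (h : EntClassical p l ∨ EntMirrored p l) (hw : Measurable w)
    (hpos : ∀ᵐ x ∂μ, 0 < w x) (hlog : l = 1 → Integrable (fun x => Real.log (w x)) μ)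
    (hex : ¬ (tailMoment μ (conjExp p) w ^ (1 / conjExp p) = ∞ ∧ weightPower μ l w = ∞)) :
    kappa0 p l ≤
      (tailMoment μ (conjExp p) w ^ (1 / conjExp p) / weightPower μ l w) ^ theta0 p l := by
  rw [kappa0_eq h]
  rcases h with h | h
  · rw [h.theta0_eq, h.extremalGauss_eq, ENNReal.rpow_one, ENNReal.rpow_one]
    exact deviation_div_renyiPower_le h hw hpos hlog hex
  · rw [h.theta0_eq, h.extremalGauss_eq]
    -- The exponent p* - 1 = -1/(1-p) is negative and reverses the upper bound.
    refine ENNReal.rpow_le_rpow_of_exponent_nonpos ?_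
      (tailMoment_div_le_deviation_div h hw hpos hex)
    rw [h.conjExp_sub_one]
    have : 0 < 1 - p := by linarith [h.facts.2.2.1]
    exact neg_nonpos.2 (by positivity)

end Kappa

/-! ### Upper-moments as moments of tails -/

/-- The probability measure with density `f`. -/
noncomputable def densMeasure (f : ℝ → ℝ) : Measure ℝ :=
  volume.withDensity fun x => ENNReal.ofReal (f x)

instance (f : ℝ → ℝ) : NullSingletonClass (densMeasure f) :=
  nullSingletonClass_withDensity volume fun x => ENNReal.ofReal (f x)

section Density

variable {f : ℝ → ℝ}

lemma IsProbDensity.isProbabilityMeasure (hf : IsProbDensity f) :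
    IsProbabilityMeasure (densMeasure f) :=
  ⟨by rw [densMeasure, withDensity_apply _ MeasurableSet.univ, Measure.restrict_univ,
    hf.lintegral_eq_one]⟩

lemma lintegral_densMeasure (hf : Measurable f) {F : ℝ → ℝ≥0∞} (hF : Measurable F) :
    ∫⁻ x, F x ∂densMeasure f = ∫⁻ x, F x * ENNReal.ofReal (f x) := by
  rw [densMeasure, lintegral_withDensity_ofReal hf hF]

lemma integrable_densMeasure (hf : Measurable f) (hf0 : ∀ x, 0 ≤ f x) {F : ℝ → ℝ} :
    Integrable F (densMeasure f) ↔ Integrable fun x => f x * F x := by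
  rw [densMeasure, integrable_withDensity_iff hf.ennreal_ofReal
    (Filter.Eventually.of_forall fun _ => ENNReal.ofReal_lt_top)]
  simp_rw [ENNReal.toReal_ofReal (hf0 _), mul_comm]

lemma integral_densMeasure (hf : Measurable f) (hf0 : ∀ x, 0 ≤ f x) (F : ℝ → ℝ) :
    ∫ x, F x ∂densMeasure f = ∫ x, f x * F x := by
  rw [densMeasure, integral_withDensity_eq_integral_toReal_smul hf.ennreal_ofReal
    (Filter.Eventually.of_forall fun _ => ENNReal.ofReal_lt_top)]
  simp_rw [ENNReal.toReal_ofReal (hf0 _), smul_eq_mul]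

lemma upVar_eq_tailInt (hf : Measurable f) (α x : ℝ) :
    upVar α f x = tailInt (densMeasure f) (upWeight α) x := by
  rw [upVar, tailInt, densMeasure, restrict_withDensity measurableSet_Ioi,
    lintegral_withDensity_ofReal (μ := volume.restrict (Ioi x)) hf
      (measurable_upWeight α).ennreal_ofReal]

lemma upperMoment_eq_tailMoment (hf : Measurable f) (p α : ℝ) :
    upperMoment p α f = tailMoment (densMeasure f) p (upWeight α) := by
  rw [upperMoment, tailMoment, lintegral_densMeasure hf ((measurable_tailInt _ _).pow_const p)]
  simp_rw [upVar_eq_tailInt hf]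

lemma ae_densMeasure_ne_zero (f : ℝ → ℝ) : ∀ᵐ x ∂densMeasure f, x ≠ 0 := by
  simp [ae_iff]

lemma upWeight_pos {α x : ℝ} (h : α = 2 ∨ x ≠ 0) : 0 < upWeight α x := by
  rw [upWeight]
  split_ifs with hα
  · exact Real.exp_pos x
  · have hx : x ≠ 0 := h.resolve_left hα
    exact Real.rpow_pos_of_pos (abs_pos.2 (mul_ne_zero (sub_ne_zero.2 hα) hx)) _

lemma ae_upWeight_pos (α : ℝ) (f : ℝ → ℝ) : ∀ᵐ x ∂densMeasure f, 0 < upWeight α x :=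
  (ae_densMeasure_ne_zero f).mono fun _ hx => upWeight_pos (Or.inr hx)

lemma log_upWeight {α x : ℝ} (hα : α ≠ 2) (hx : x ≠ 0) :
    Real.log (upWeight α x) = 1 / (α - 2) * (Real.log |α - 2| + Real.log |x|) := by
  have h2 : α - 2 ≠ 0 := sub_ne_zero.2 hα
  rw [upWeight, if_neg hα, Real.log_rpow (abs_pos.2 (mul_ne_zero h2 hx)), abs_mul,
    Real.log_mul (abs_ne_zero.2 h2) (abs_ne_zero.2 hx)]

lemma integrable_log_upWeight (hf : IsProbDensity f) {α : ℝ} (hα : α ≠ 2)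
    (hlog : Integrable fun x => f x * Real.log |x|) :
    Integrable (fun x => Real.log (upWeight α x)) (densMeasure f) := by
  have := hf.isProbabilityMeasure
  have h1 := (integrable_densMeasure hf.measurable hf.nonneg).2 hlog
  refine (((integrable_const (Real.log |α - 2|)).add h1).const_mul (1 / (α - 2))).congr ?_
  filter_upwards [ae_densMeasure_ne_zero f] with x hx
  rw [log_upWeight hα hx, Pi.add_apply]

/-- Here 1 - l = (α-2)q, so w_α^(1-l) = |(α-2)x|^q; for q = 0 the geometric mean of w_α gives the
logarithmic moment. -/
lemma weightPower_upWeight (hf : IsProbDensity f) {α q : ℝ} (hα : α ≠ 2)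
    (hlog : q = 0 → Integrable fun x => f x * Real.log |x|) :
    weightPower (densMeasure f) (1 + (2 - α) * q) (upWeight α) =
      ENNReal.ofReal (|α - 2| ^ (1 / (α - 2))) * deviation q f ^ (1 / (α - 2)) := by
  have := hf.isProbabilityMeasure
  have h2 : α - 2 ≠ 0 := sub_ne_zero.2 hα
  have habs : 0 < |α - 2| := abs_pos.2 h2
  by_cases hq : q = 0
  · subst hq
    have h1 := (integrable_densMeasure hf.measurable hf.nonneg).2 (hlog rfl)
    rw [mul_zero, add_zero, weightPower, if_pos rfl, deviation, if_pos rfl,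
      ENNReal.ofReal_rpow_of_pos (Real.exp_pos _),
      ← ENNReal.ofReal_mul (Real.rpow_nonneg habs.le _)]
    congr 1
    have e : ∫ x, Real.log (upWeight α x) ∂densMeasure f =
        ∫ x, 1 / (α - 2) * (Real.log |α - 2| + Real.log |x|) ∂densMeasure f := by
      refine integral_congr_ae ?_
      filter_upwards [ae_densMeasure_ne_zero f] with x hx
      exact log_upWeight hα hx
    rw [e, integral_const_mul, integral_add (integrable_const _) h1, integral_const,
      integral_densMeasure hf.measurable hf.nonneg, Real.rpow_def_of_pos habs, ← Real.exp_mul,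
      ← Real.exp_add]
    congr 1
    simp
    ring
  · have hl : 1 + (2 - α) * q ≠ 1 := by
      intro h
      have : (2 - α) * q = 0 := by linarith
      rcases mul_eq_zero.1 this with h | h
      · exact hα (by linarith)
      · exact hq h
    have e1 : 1 - (1 + (2 - α) * q) = (α - 2) * q := by ring
    rw [weightPower, if_neg hl, deviation, if_neg hq, e1,
      lintegral_densMeasure hf.measurable ((measurable_upWeight α).ennreal_ofReal.pow_const _)]
    have e2 : ∫⁻ x, ENNReal.ofReal (upWeight α x) ^ ((α - 2) * q) * ENNReal.ofReal (f x) =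
        ENNReal.ofReal (|α - 2| ^ q) * ∫⁻ x, ENNReal.ofReal |x| ^ q * ENNReal.ofReal (f x) := by
      rw [← lintegral_const_mul' _ _ ENNReal.ofReal_ne_top]
      -- At 0 the real power in `upWeight` defaults to 0 even for a negative exponent, so the
      -- identity can fail there.
      have h0 : ∀ᵐ x : ℝ, x ≠ 0 := by simp [ae_iff]
      refine lintegral_congr_ae ?_
      filter_upwards [h0] with x hx
      have hx' : 0 < |x| := abs_pos.2 hx
      rw [← mul_assoc, ENNReal.ofReal_rpow_of_pos (upWeight_pos (Or.inr hx)),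
        ENNReal.ofReal_rpow_of_pos hx', ← ENNReal.ofReal_mul (Real.rpow_nonneg habs.le _), upWeight,
        if_neg hα, ← Real.rpow_mul (abs_nonneg _), abs_mul, Real.mul_rpow habs.le hx'.le]
      have : 1 / (α - 2) * ((α - 2) * q) = q := by field_simp
      rw [this]
    rw [e2, ENNReal.ofReal_mul_rpow (Real.rpow_pos_of_pos habs _), ← ENNReal.rpow_mul,
      ← Real.rpow_mul habs.le]
    congr 3 <;> field_simp

lemma ENNReal.div_rpow_of_ne {a b : ℝ≥0∞} (h0 : ¬ (a = 0 ∧ b = 0)) (h1 : ¬ (a = ∞ ∧ b = ∞))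
    (z : ℝ) : (a / b) ^ z = a ^ z / b ^ z := by
  rw [div_eq_mul_inv, div_eq_mul_inv, ENNReal.mul_rpow_eq_ite, if_neg, ENNReal.inv_rpow]
  rintro ⟨h | h, -⟩
  · exact h0 ⟨h.1, ENNReal.inv_eq_top.1 h.2⟩
  · exact h1 ⟨h.1, ENNReal.inv_eq_zero.1 h.2⟩

lemma upperDeviation_eq (r α : ℝ) (f : ℝ → ℝ) :
    upperDeviation r α f = (upperMoment r α f ^ (1 / r)) ^ (α - 2) := by
  rw [upperDeviation, ← ENNReal.rpow_mul]
  congr 1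
  ring

/-- The power e relates the quotient m/σ to the one with the unraised moment; when e = α - 2 is
negative the two excluded forms are interchanged. -/
lemma forms_of_upperDeviation {s d : ℝ≥0∞} {e : ℝ} (he : e ≠ 0)
    (h0 : ¬ (s ^ e = 0 ∧ d = 0)) (h1 : ¬ (s ^ e = ∞ ∧ d = ∞)) :
    ¬ (s = 0 ∧ d ^ (1 / e) = 0) ∧ ¬ (s = ∞ ∧ d ^ (1 / e) = ∞) := by
  have hd : d = (d ^ (1 / e)) ^ e := by
    rw [← ENNReal.rpow_mul, one_div_mul_cancel he, ENNReal.rpow_one]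
  rcases lt_or_gt_of_ne he with h | h
  · refine ⟨fun ⟨h2, h3⟩ => h1 ?_, fun ⟨h2, h3⟩ => h0 ?_⟩
    · rw [h3] at hd
      rw [hd, h2, ENNReal.zero_rpow_of_neg h]
      simp
    · rw [h3] at hd
      rw [hd, h2, ENNReal.top_rpow_of_neg h]
      simp
  · refine ⟨fun ⟨h2, h3⟩ => h0 ?_, fun ⟨h2, h3⟩ => h1 ?_⟩
    · rw [h3] at hd
      rw [hd, h2, ENNReal.zero_rpow_of_pos h]
      simp
    · rw [h3] at hd
      rw [hd, h2, ENNReal.top_rpow_of_pos h]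
      simp

/-- The exponent Θ₁ is θ₀ divided by α - 2, which absorbs the power α - 2 in m; the powers of |α -
2| coming from the weight balance the prefactor. -/
lemma upperDeviation_div_rpow (hf : IsProbDensity f) {p α q : ℝ} (hα : α ≠ 2)
    (hlog : q = 0 → Integrable fun x => f x * Real.log |x|)
    (h0 : ¬ (upperDeviation (conjExp p) α f = 0 ∧ deviation q f = 0))
    (h1 : ¬ (upperDeviation (conjExp p) α f = ∞ ∧ deviation q f = ∞)) :
    (upperDeviation (conjExp p) α f / deviation q f) ^ theta1 p α q =
      ENNReal.ofReal (|2 - α| ^ theta1 p α q) *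
        (tailMoment (densMeasure f) (conjExp p) (upWeight α) ^ (1 / conjExp p) /
          weightPower (densMeasure f) (1 + (2 - α) * q) (upWeight α)) ^
            theta0 p (1 + (2 - α) * q) := by
  have h2 : α - 2 ≠ 0 := sub_ne_zero.2 hα
  have habs : 0 < |α - 2| := abs_pos.2 h2
  rw [weightPower_upWeight hf hα hlog, ← upperMoment_eq_tailMoment hf.measurable]
  rw [upperDeviation_eq] at h0 h1 ⊢
  obtain ⟨h3, h4⟩ := forms_of_upperDeviation h2 h0 h1
  set s := upperMoment (conjExp p) α f ^ (1 / conjExp p)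
  set d := deviation q f
  have hd : d = (d ^ (1 / (α - 2))) ^ (α - 2) := by
    rw [← ENNReal.rpow_mul, one_div_mul_cancel h2, ENNReal.rpow_one]
  set D := d ^ (1 / (α - 2))
  have hc : 0 < |α - 2| ^ (1 / (α - 2)) := Real.rpow_pos_of_pos habs _
  have e1 : ∀ c : ℝ, 0 < c → s / (ENNReal.ofReal c * D) = ENNReal.ofReal c⁻¹ * (s / D) := by
    intro c hc
    rw [div_eq_mul_inv, div_eq_mul_inv, ENNReal.mul_inv (Or.inl (by simpa using hc))
      (Or.inl ENNReal.ofReal_ne_top), ENNReal.ofReal_inv_of_pos hc]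
    ring
  rw [hd, ← ENNReal.div_rpow_of_ne h3 h4, ← ENNReal.rpow_mul, e1 _ hc,
    ENNReal.ofReal_mul_rpow (inv_pos.2 hc), ← mul_assoc,
    ← ENNReal.ofReal_mul (Real.rpow_nonneg (abs_nonneg _) _), abs_sub_comm 2 α]
  have e2 : (α - 2) * theta1 p α q = theta0 p (1 + (2 - α) * q) := by
    rw [theta1]
    field_simp
  have e3 : |α - 2| ^ theta1 p α q *
      (|α - 2| ^ (1 / (α - 2)))⁻¹ ^ theta0 p (1 + (2 - α) * q) = 1 := by
    rw [Real.inv_rpow hc.le, ← Real.rpow_mul habs.le, theta1, div_eq_mul_one_div, mul_comm (1 / _),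
      mul_inv_cancel₀ (Real.rpow_pos_of_pos habs _).ne']
  rw [e2, e3, ENNReal.ofReal_one, one_mul]

end Density

/-! ### The minimizers -/

lemma measurable_downVar (α : ℝ) : Measurable (downVar α) := by
  unfold downVar
  split_ifs
  · fun_prop
  · fun_prop

section Image

variable {g : ℝ → ℝ}

/-- If X has density g, then s(X) has density D_α[g]. -/
lemma densMeasure_downTransform (hg : IsDecreasingProfile g) (α : ℝ) :
    densMeasure (downTransform α g) = (densMeasure g).map fun x => downVar α (g x) := by
  have hφ : Measurable fun x => downVar α (g x) := (measurable_downVar α).comp hg.measurable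
  refine Measure.ext_of_lintegral _ fun F hF => ?_
  rw [lintegral_map hF hφ, lintegral_densMeasure (hg.measurable_downTransform α) hF,
    lintegral_densMeasure hg.measurable (F := fun x => F (downVar α (g x))) (hF.comp hφ),
    hg.lintegral_mul_downTransform,
    ← lintegral_indicator hg.measurableSet_support]
  refine lintegral_congr fun x => ?_
  by_cases hx : 0 < g x
  · rw [indicator_of_mem (show x ∈ {x | 0 < g x} from hx)]
  · rw [indicator_of_notMem (show x ∉ {x | 0 < g x} from hx),
      ENNReal.ofReal_of_nonpos (not_lt.1 hx), mul_zero]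

lemma densMeasure_comp_neg {f : ℝ → ℝ} (hf : Measurable f) :
    densMeasure (fun x => f (-x)) = (densMeasure f).map fun x => -x := by
  refine Measure.ext_of_lintegral _ fun F hF => ?_
  rw [lintegral_map hF measurable_neg,
    lintegral_densMeasure (f := fun x => f (-x)) (hf.comp measurable_neg) hF,
    lintegral_densMeasure hf (F := fun x => F (-x)) (hF.comp measurable_neg), ← lintegral_neg_arg]
  simp

lemma weightPower_map {μ : Measure ℝ} {φ w : ℝ → ℝ} (hφ : Measurable φ) (hw : Measurable w)
    (l : ℝ) : weightPower (μ.map φ) l w = weightPower μ l (w ∘ φ) := by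
  unfold weightPower
  split_ifs
  · rw [integral_map hφ.aemeasurable hw.log.aestronglyMeasurable]
    rfl
  · rw [lintegral_map (hw.ennreal_ofReal.pow_const _) hφ]
    rfl

lemma weightPower_congr {μ : Measure ℝ} {v w : ℝ → ℝ} (h : v =ᵐ[μ] w) (l : ℝ) :
    weightPower μ l v = weightPower μ l w := by
  unfold weightPower
  split_ifs
  · rw [integral_congr_ae (h.mono fun x hx => by rw [hx])]
  · rw [lintegral_congr_ae (h.mono fun x hx => by rw [hx])]

lemma ae_densMeasure_pos (hg : Measurable g) : ∀ᵐ x ∂densMeasure g, 0 < g x := by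
  rw [densMeasure, ae_withDensity_iff hg.ennreal_ofReal]
  exact Filter.Eventually.of_forall fun x hx => by simpa using hx

/-- Because (1/g)^(1-l)·g = g^l: after the down transform the power mean of w_α is the Rényi power
of g. -/
lemma weightPower_inv (hg : IsDecreasingProfile g) (l : ℝ) :
    weightPower (densMeasure g) l (fun x => (g x)⁻¹) = renyiPower l g := by
  unfold weightPower renyiPower
  split_ifs
  · rw [integral_densMeasure hg.measurable hg.nonneg]
    simp_rw [Real.log_inv, mul_neg]
    rw [integral_neg]
  · congr 1
    rw [lintegral_densMeasure hg.measurable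
        (F := fun x => ENNReal.ofReal ((fun x => (g x)⁻¹) x) ^ (1 - l))
        (hg.measurable.inv.ennreal_ofReal.pow_const _),
      ← lintegral_indicator hg.measurableSet_support]
    refine lintegral_congr fun x => ?_
    by_cases hx : 0 < g x
    · rw [indicator_of_mem (show x ∈ {x | 0 < g x} from hx),
        ENNReal.ofReal_rpow_of_pos (inv_pos.2 hx), ENNReal.ofReal_rpow_of_pos hx,
        ← ENNReal.ofReal_mul (Real.rpow_nonneg (inv_nonneg.2 hx.le) _), Real.inv_rpow hx.le,
        ← Real.rpow_neg hx.le, ← Real.rpow_add_one hx.ne']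
      congr 2
      ring
    · rw [indicator_of_notMem (show x ∉ {x | 0 < g x} from hx),
        ENNReal.ofReal_of_nonpos (not_lt.1 hx), mul_zero]

lemma weightPower_downTransform (hg : IsDecreasingProfile g) (α l : ℝ) :
    weightPower (densMeasure (downTransform α g)) l (upWeight α) = renyiPower l g := by
  have hφ : Measurable fun x => downVar α (g x) := (measurable_downVar α).comp hg.measurable
  rw [densMeasure_downTransform hg, weightPower_map hφ (measurable_upWeight α),
    ← weightPower_inv hg]
  refine weightPower_congr ?_ l
  filter_upwards [ae_densMeasure_pos hg.measurable] with x hx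
  exact upWeight_downVar α hx

lemma weightPower_downTransform_neg (hg : IsDecreasingProfile g) {α : ℝ} (hα : α ≠ 2) (l : ℝ) :
    weightPower (densMeasure fun x => downTransform α g (-x)) l (upWeight α) =
      renyiPower l g := by
  rw [densMeasure_comp_neg (hg.measurable_downTransform α),
    weightPower_map measurable_neg (measurable_upWeight α), ← weightPower_downTransform hg α]
  congr 1
  ext x
  exact upWeight_neg hα x

lemma integrable_log_downTransform (hg : IsDecreasingProfile g)
    (h1 : ∫⁻ x, ENNReal.ofReal (g x) = 1)
    (hlog : Integrable fun x => g x * Real.log (g x)) {α : ℝ} (hα : α ≠ 2) :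
    Integrable fun x => downTransform α g x * Real.log |x| := by
  have hφ : Measurable fun x => downVar α (g x) := (measurable_downVar α).comp hg.measurable
  have hprob : IsProbabilityMeasure (densMeasure g) :=
    IsProbDensity.isProbabilityMeasure ⟨hg.measurable, hg.nonneg, h1⟩
  have h2 : α - 2 ≠ 0 := sub_ne_zero.2 hα
  have hL : Measurable fun x : ℝ => Real.log |x| :=
    Real.measurable_log.comp continuous_abs.measurable
  rw [← integrable_densMeasure (hg.measurable_downTransform α)
    (IsDecreasingProfile.downTransform_nonneg' hg.nonneg α), densMeasure_downTransform hg,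
    integrable_map_measure hL.aestronglyMeasurable hφ.aemeasurable]
  have h3 := (integrable_densMeasure hg.measurable hg.nonneg).2 hlog
  refine ((h3.const_mul (2 - α)).sub (integrable_const (Real.log |α - 2|))).congr ?_
  filter_upwards [ae_densMeasure_pos hg.measurable] with x hx
  have hx2 := Real.rpow_pos_of_pos hx (2 - α)
  simp only [Pi.sub_apply, Function.comp_apply]
  rw [downVar_of_ne hα, abs_div, Real.log_div (abs_pos.2 hx2.ne').ne' (abs_ne_zero.2 h2),
    abs_of_pos hx2, Real.log_rpow hx]

/-- The upper-moment of a down transform supported on the right of its profile. -/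
lemma upperMoment_downTransform (hg : IsDecreasingProfile g) {S : ℝ}
    (hS : {x | 0 < g x} = Ioo (-S) 0) (r α : ℝ) :
    upperMoment r α (downTransform α g) =
      ∫⁻ x, ENNReal.ofReal |x| ^ r * ENNReal.ofReal (g x) := by
  rw [upperMoment, hg.lintegral_mul_downTransform α fun s => upVar α (downTransform α g) s ^ r,
    ← lintegral_indicator hg.measurableSet_support]
  refine lintegral_congr fun t => ?_
  by_cases ht : 0 < g t
  · rw [indicator_of_mem (show t ∈ {x | 0 < g x} from ht)]
    congr 2
    rw [upVar, hg.lintegral_upWeight_mul_downTransform α measurableSet_Ioi]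
    have hmem : t ∈ Ioo (-S) 0 := hS ▸ (show t ∈ {x | 0 < g x} from ht)
    -- As s is increasing, the points beyond s(t) come from the support to the right of t, an
    -- interval of length |t|.
    have : {x | 0 < g x} ∩ {x | downVar α (g x) ∈ Ioi (downVar α (g t))} = Ioo t 0 := by
      ext x
      constructor
      · rintro ⟨hx, hlt⟩
        have hx' : x ∈ Ioo (-S) 0 := hS ▸ hx
        exact ⟨((hg.strictMonoOn_downVar α).lt_iff_lt ht hx).1 hlt, hx'.2⟩
      · rintro ⟨h1, h2⟩
        have hx : x ∈ {x | 0 < g x} := by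
          rw [hS]
          exact ⟨hmem.1.trans h1, h2⟩
        exact ⟨hx, ((hg.strictMonoOn_downVar α).lt_iff_lt ht hx).2 h1⟩
    rw [this, Real.volume_Ioo, abs_of_neg hmem.2, zero_sub]
  · rw [indicator_of_notMem (show t ∉ {x | 0 < g x} from ht),
      ENNReal.ofReal_of_nonpos (not_lt.1 ht), mul_zero]

/-- The upper-moment of a reflected down transform. -/
lemma upperMoment_downTransform_neg (hg : IsDecreasingProfile g)
    (hS : ∀ x, 0 < g x → 0 < x ∧ ∀ y, 0 < y → y < x → 0 < g y) (r : ℝ) {α : ℝ} (hα : α ≠ 2) :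
    upperMoment r α (fun x => downTransform α g (-x)) =
      ∫⁻ x, ENNReal.ofReal |x| ^ r * ENNReal.ofReal (g x) := by
  rw [upperMoment, ← lintegral_neg_arg]
  simp_rw [neg_neg]
  rw [hg.lintegral_mul_downTransform α
    fun s => upVar α (fun x => downTransform α g (-x)) (-s) ^ r,
    ← lintegral_indicator hg.measurableSet_support]
  refine lintegral_congr fun t => ?_
  by_cases ht : 0 < g t
  · rw [indicator_of_mem (show t ∈ {x | 0 < g x} from ht)]
    congr 2
    -- Reflection turns the upper tail into a lower one, whose source is (0, t), of length t.
    have e : upVar α (fun x => downTransform α g (-x)) (-downVar α (g t)) =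
        ∫⁻ v in Iio (downVar α (g t)),
          ENNReal.ofReal (upWeight α v) * ENNReal.ofReal (downTransform α g v) := by
      rw [upVar, ← lintegral_indicator measurableSet_Ioi, ← lintegral_indicator measurableSet_Iio,
        ← lintegral_neg_arg]
      refine lintegral_congr fun v => ?_
      by_cases hv : v < downVar α (g t)
      · rw [indicator_of_mem (show -v ∈ Ioi (-downVar α (g t)) from neg_lt_neg hv),
          indicator_of_mem (show v ∈ Iio (downVar α (g t)) from hv), upWeight_neg hα, neg_neg]
      · rw [indicator_of_notMem (show -v ∉ Ioi (-downVar α (g t)) from fun h =>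
          hv (neg_lt_neg_iff.1 h)), indicator_of_notMem (show v ∉ Iio (downVar α (g t)) from hv)]
    rw [e, hg.lintegral_upWeight_mul_downTransform α measurableSet_Iio]
    have : {x | 0 < g x} ∩ {x | downVar α (g x) ∈ Iio (downVar α (g t))} = Ioo 0 t := by
      ext x
      constructor
      · rintro ⟨hx, hlt⟩
        exact ⟨(hS x hx).1, ((hg.strictMonoOn_downVar α).lt_iff_lt hx ht).1 hlt⟩
      · rintro ⟨h1, h2⟩
        have hx : x ∈ {x | 0 < g x} := (hS t ht).2 x h1 h2
        exact ⟨hx, ((hg.strictMonoOn_downVar α).lt_iff_lt hx ht).2 h2⟩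
    rw [this, Real.volume_Ioo, abs_of_pos (hS t ht).1, sub_zero]
  · rw [indicator_of_notMem (show t ∉ {x | 0 < g x} from ht),
      ENNReal.ofReal_of_nonpos (not_lt.1 ht), mul_zero]

end Image

section Minimizer

variable {p l α : ℝ}

lemma stretchedGauss_pos_of_lt (h : EntClassical p l) {x : ℝ} (hx : 0 < stretchedGauss p l x) :
    0 < x ∧ ∀ y, 0 < y → y < x → 0 < stretchedGauss p l y := by
  have hx' := (stretchedGauss_pos_iff h).1 hx
  refine ⟨hx'.1, fun y hy hyx => (stretchedGauss_pos_iff h).2 ⟨hy, ?_⟩⟩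
  have h1 := Real.rpow_pos_of_pos hy (conjExp p)
  have h2 : y ^ conjExp p ≤ x ^ conjExp p := Real.rpow_le_rpow hy.le hyx.le h.1.le
  rcases le_or_gt l 1 with hl | hl
  · nlinarith
  · nlinarith [hx'.2]

lemma EntClassical.upperMinimizer_eq (h : EntClassical p l) :
    upperMinimizer p α l = fun x => downTransform α (stretchedGauss p l) (-x) := by
  ext x
  rw [upperMinimizer, if_neg (not_lt.2 h.pos.le), h.extremalGauss_eq]

lemma EntMirrored.upperMinimizer_eq (h : EntMirrored p l) :
    upperMinimizer p α l = downTransform α (mirroredGauss p l) := by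
  ext x
  rw [upperMinimizer, if_pos h.facts.1, h.extremalGauss_eq]

lemma isProbDensity_upperMinimizer (h : EntClassical p l ∨ EntMirrored p l) :
    IsProbDensity (upperMinimizer p α l) := by
  rcases h with h | h
  · rw [h.upperMinimizer_eq]
    exact ((isDecreasingProfile_stretchedGauss h).isProbDensity_downTransform α
      (lintegral_stretchedGauss h)).comp_neg
  · rw [h.upperMinimizer_eq]
    exact (isDecreasingProfile_mirroredGauss h).isProbDensity_downTransform α
      (lintegral_mirroredGauss h)

lemma upperMoment_upperMinimizer (h : EntClassical p l ∧ α ≠ 2 ∨ EntMirrored p l) :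
    upperMoment (conjExp p) α (upperMinimizer p α l) ^ (1 / conjExp p) =
      deviation (conjExp p) (extremalGauss p l) := by
  rcases h with ⟨h, hα⟩ | h
  · rw [h.upperMinimizer_eq, h.extremalGauss_eq, deviation, if_neg h.1.ne',
      upperMoment_downTransform_neg (isDecreasingProfile_stretchedGauss h)
        (fun x hx => stretchedGauss_pos_of_lt h hx) _ hα]
  · have : conjExp p ≠ 0 := by
      rcases h.conjExp_pos_or with h1 | h1
      · exact h1.2.ne'
      · exact h1.2.ne
    rw [h.upperMinimizer_eq, h.extremalGauss_eq, deviation, if_neg this,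
      upperMoment_downTransform (isDecreasingProfile_mirroredGauss h) (mirroredGauss_support h)]

lemma weightPower_upperMinimizer (h : EntClassical p l ∧ α ≠ 2 ∨ EntMirrored p l) :
    weightPower (densMeasure (upperMinimizer p α l)) l (upWeight α) =
      renyiPower l (extremalGauss p l) := by
  rcases h with ⟨h, hα⟩ | h
  · rw [h.upperMinimizer_eq, h.extremalGauss_eq,
      weightPower_downTransform_neg (isDecreasingProfile_stretchedGauss h) hα]
  · rw [h.upperMinimizer_eq, h.extremalGauss_eq,
      weightPower_downTransform (isDecreasingProfile_mirroredGauss h)]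

lemma integrable_log_upperMinimizer (h : EntClassical p 1) (hα : α ≠ 2) :
    Integrable fun x => upperMinimizer p α 1 x * Real.log |x| := by
  rw [h.upperMinimizer_eq]
  have := (integrable_log_downTransform (isDecreasingProfile_stretchedGauss h)
    (lintegral_stretchedGauss h) (integrable_stretchedGauss_one_mul_log h) hα).comp_neg
  simpa using this

end Minimizer

/-! ### The parameter ranges -/

section Ranges

variable {p α q : ℝ}

lemma UpClassical.entClassical (h : UpClassical p α q) : EntClassical p (1 + (2 - α) * q) := by
  obtain ⟨hr, h2⟩ := h
  refine ⟨hr, ?_⟩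
  have e : conjExp p / (conjExp p + 1) = 1 - 1 / (1 + conjExp p) := by
    field_simp
    ring
  rw [e] at h2
  linarith

/-- The expression in the sign condition is L times (L-1)/L + p* with L = 1 + (2-α)q < 0, so both
signs flip. -/
lemma UpMirrored.entMirrored (h : UpMirrored p α q) : EntMirrored p (1 + (2 - α) * q) := by
  obtain ⟨hp0, hp1, hl, hs⟩ := h
  have hl' : 1 + (2 - α) * q < 0 := by linarith
  refine ⟨hp0, hp1, hl', ?_⟩
  generalize hL : 1 + (2 - α) * q = L at hl' ⊢
  have e : (2 - α) * q * (1 + conjExp p) + conjExp p = L * ((L - 1) / L + conjExp p) := by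
    have := hl'.ne
    rw [← hL] at this ⊢
    field_simp
    ring
  rw [e, sign_mul, sign_neg hl'] at hs
  rw [show 1 - conjExp p = -(conjExp p - 1) by ring, Left.sign_neg, ← hs]
  simp

lemma entRange_of_upRange (h : UpClassical p α q ∨ UpMirrored p α q) :
    EntClassical p (1 + (2 - α) * q) ∨ EntMirrored p (1 + (2 - α) * q) :=
  h.imp UpClassical.entClassical UpMirrored.entMirrored

lemma entClassical_one (h : 0 < conjExp p) : EntClassical p 1 :=
  ⟨h, by rw [div_lt_one (by linarith)]; linarith⟩

end Ranges

/-! ### The down transforms of the extremal densities are generalized Beta densities -/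

section GenBeta

variable {g : ℝ → ℝ} {p α l q r K ρ k e₀ e₁ : ℝ}

/-- By `hd`, g^α/|g'| = K⁻¹ g^(α+l-2) |x|^(1-r). Since g^(2-α) = |α-2||s|, the factor g^(α+l-2) is a
power of |s| and g^(l-1) = (|α-2||s|)^q, whence `hpow` turns |x|^(1-r) into a power of e₀ +
e₁(|s|/b)^q. `hsurj` identifies the range of s. -/
lemma downTransform_eq_of_power (hg : IsDecreasingProfile g) (hα : α ≠ 2) (hq : q ≠ 0)
    (hlq : (2 - α) * q = l - 1) (hr : r ≠ 0) (hK : 0 < K) (hρ : 0 < ρ) (hk : 0 < k)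
    (hx0 : ∀ x, 0 < g x → x ≠ 0)
    (hd : ∀ x, 0 < g x → deriv g x = -(K * |x| ^ (r - 1) * g x ^ (2 - l)))
    (hpow : ∀ x, 0 < g x → |x| ^ r = ρ * (e₀ + e₁ * (g x ^ (l - 1) / k)))
    (hsurj : ∀ y, 0 < y → 0 < e₀ + e₁ * (y ^ (l - 1) / k) → ∃ x, g x = y) :
    ∃ b C : ℝ, 0 < b ∧ 0 < C ∧ ∀ s, downTransform α g s =
      if 0 < (α - 2) * s ∧ 0 < e₀ + e₁ * (|s| / b) ^ q then
        C * |s| ^ (l / (2 - α) - 1) * (e₀ + e₁ * (|s| / b) ^ q) ^ (1 / r - 1) else 0 := by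
  have h2 : α - 2 ≠ 0 := sub_ne_zero.2 hα
  have h2' : 2 - α ≠ 0 := sub_ne_zero.2 hα.symm
  have hA : 0 < |α - 2| := abs_pos.2 h2
  have hb : 0 < k ^ (1 / q) / |α - 2| := div_pos (Real.rpow_pos_of_pos hk _) hA
  refine ⟨k ^ (1 / q) / |α - 2|, |α - 2| ^ (l / (2 - α) - 1) * K⁻¹ * ρ ^ (1 / r - 1), hb,
    by positivity, fun s => ?_⟩
  have hz : ∀ t : ℝ, 0 ≤ t → (t / (k ^ (1 / q) / |α - 2|)) ^ q = (|α - 2| * t) ^ q / k := by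
    intro t ht
    have e : t / (k ^ (1 / q) / |α - 2|) = |α - 2| * t / k ^ (1 / q) := by
      field_simp
    rw [e, Real.div_rpow (mul_nonneg hA.le ht) (Real.rpow_nonneg hk.le _), ← Real.rpow_mul hk.le,
      one_div_mul_cancel hq, Real.rpow_one]
  have hdv : ∀ y, 0 < y → |α - 2| * |downVar α y| = y ^ (2 - α) := by
    intro y hy
    rw [← abs_mul, downVar_of_ne hα, mul_div_cancel₀ _ h2, abs_of_pos (Real.rpow_pos_of_pos hy _)]
  have hzy : ∀ y, 0 < y → (|α - 2| * |downVar α y|) ^ q = y ^ (l - 1) := by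
    intro y hy
    rw [hdv y hy, ← Real.rpow_mul hy.le, hlq]
  rw [hz _ (abs_nonneg s)]
  by_cases hs : s ∈ (fun x => downVar α (g x)) '' {x | 0 < g x}
  · obtain ⟨x, hx, rfl⟩ := hs
    have hx' : 0 < g x := hx
    have hxa := abs_pos.2 (hx0 x hx)
    have hpos : 0 < e₀ + e₁ * (g x ^ (l - 1) / k) := by
      have h3 := Real.rpow_pos_of_pos hxa r
      rw [hpow x hx] at h3
      exact pos_of_mul_pos_right h3 hρ.le
    beta_reduce
    rw [hzy _ hx', if_pos ⟨by
      rw [downVar_of_ne hα, mul_div_cancel₀ _ h2]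
      exact Real.rpow_pos_of_pos hx' _, hpos⟩, hg.downTransform_downVar α hx, hd x hx, abs_neg]
    have h4 := Real.rpow_pos_of_pos hxa (r - 1)
    have h5 := Real.rpow_pos_of_pos hx' (2 - l)
    rw [abs_of_pos (by positivity)]
    have e1 : (|x| ^ (r - 1))⁻¹ = ρ ^ (1 / r - 1) *
        (e₀ + e₁ * (g x ^ (l - 1) / k)) ^ (1 / r - 1) := by
      rw [← Real.mul_rpow hρ.le hpos.le, ← hpow x hx, ← Real.rpow_mul hxa.le,
        ← Real.rpow_neg hxa.le]
      congr 1
      field_simp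
      ring
    have e2 : |α - 2| ^ (l / (2 - α) - 1) * |downVar α (g x)| ^ (l / (2 - α) - 1) =
        g x ^ α * (g x ^ (2 - l))⁻¹ := by
      rw [← Real.mul_rpow hA.le (abs_nonneg _), hdv _ hx', ← Real.rpow_mul hx'.le,
        ← Real.rpow_neg hx'.le, ← Real.rpow_add hx']
      congr 1
      field_simp
      ring
    calc _ = (g x ^ α * (g x ^ (2 - l))⁻¹) * K⁻¹ * (|x| ^ (r - 1))⁻¹ := by
          rw [mul_inv, mul_inv]
          ring
      _ = _ := by
          rw [← e2, e1]
          ring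
  · rw [IsDecreasingProfile.downTransform_of_notMem α hs, if_neg]
    rintro ⟨h3, h4⟩
    have hy : 0 < ((α - 2) * s) ^ (1 / (2 - α)) := Real.rpow_pos_of_pos h3 _
    have hsy : downVar α (((α - 2) * s) ^ (1 / (2 - α))) = s := by
      rw [downVar_of_ne hα, ← Real.rpow_mul h3.le, one_div_mul_cancel h2', Real.rpow_one,
        mul_div_cancel_left₀ _ h2]
    have h5 := hzy _ hy
    rw [hsy] at h5
    rw [h5] at h4
    obtain ⟨x, hx⟩ := hsurj _ hy h4
    exact hs ⟨x, by rw [mem_ofPred_eq, hx]; exact hy, by beta_reduce; rw [hx, hsy]⟩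

lemma lintegral_half_line (hα : α ≠ 2) (G : ℝ → ℝ) :
    ∫⁻ s, ENNReal.ofReal (if 0 < (α - 2) * s then G |s| else 0) =
      ∫⁻ y in Ioi 0, ENNReal.ofReal (G y) := by
  rw [← lintegral_indicator measurableSet_Ioi]
  rcases lt_or_gt_of_ne hα with h | h
  · rw [← lintegral_neg_arg]
    refine lintegral_congr fun s => ?_
    by_cases hs : 0 < s
    · rw [indicator_of_mem (show s ∈ Ioi 0 from hs), if_pos (by nlinarith), abs_neg,
        abs_of_pos hs]
    · rw [indicator_of_notMem (show s ∉ Ioi 0 from hs), if_neg (by nlinarith),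
        ENNReal.ofReal_zero]
  · refine lintegral_congr fun s => ?_
    by_cases hs : 0 < s
    · rw [indicator_of_mem (show s ∈ Ioi 0 from hs), if_pos (by nlinarith), abs_of_pos hs]
    · rw [indicator_of_notMem (show s ∉ Ioi 0 from hs), if_neg (by nlinarith),
        ENNReal.ofReal_zero]

/-- A probability density proportional to a generalized Beta density is equal to it. -/
lemma eq_genBeta_of_proportional {D : ℝ → ℝ} (hD : ∫⁻ s, ENNReal.ofReal (D s) = 1) (hα : α ≠ 2)
    {a b c P Q C : ℝ} (ha : a ≠ 0) (hb : 0 < b) (hc : c = 0 ∨ c = 1) (hP : 0 < P) (hQ : 0 < Q)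
    (hC : 0 < C)
    (h : ∀ s, D s = if 0 < (α - 2) * s then C * genBeta a b c P Q |s| else 0) (s : ℝ) :
    D s = if 0 < (α - 2) * s then genBeta a b c P Q |s| else 0 := by
  simp_rw [h] at hD
  rw [lintegral_half_line hα fun y => C * genBeta a b c P Q y] at hD
  simp_rw [ENNReal.ofReal_mul hC.le] at hD
  rw [lintegral_const_mul' _ _ ENNReal.ofReal_ne_top, lintegral_genBeta ha hb hc hP hQ, mul_one,
    ENNReal.ofReal_eq_one] at hD
  rw [h, hD, one_mul]

lemma eq_genBeta_of_one_sub {D : ℝ → ℝ} (hD : ∫⁻ s, ENNReal.ofReal (D s) = 1) (hα : α ≠ 2)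
    (hq : q ≠ 0) (hlq : (2 - α) * q = l - 1) (hr : 0 < r) (hP : 0 < l / (l - 1)) {b C : ℝ}
    (hb : 0 < b) (hC : 0 < C)
    (h : ∀ s, D s = if 0 < (α - 2) * s ∧ 0 < 1 + -1 * (|s| / b) ^ q then
        C * |s| ^ (l / (2 - α) - 1) * (1 + -1 * (|s| / b) ^ q) ^ (1 / r - 1) else 0) (s : ℝ) :
    D s = if 0 < (α - 2) * s then genBeta q b 0 (l / (l - 1)) (1 / r) |s| else 0 := by
  have hQ : 0 < 1 / r := one_div_pos.2 hr
  have hB := ProbabilityTheory.beta_pos hP hQ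
  have hbp := Real.rpow_pos_of_pos hb (q * (l / (l - 1)))
  have hqa := abs_pos.2 hq
  refine eq_genBeta_of_proportional hD hα hq hb (Or.inl rfl) hP hQ
    (C := C * (b ^ (q * (l / (l - 1))) * ProbabilityTheory.beta (l / (l - 1)) (1 / r)) / |q|)
    (by positivity) (fun s => ?_) s
  rw [h]
  by_cases hs : 0 < (α - 2) * s
  · have hs0 : 0 < |s| := abs_pos.2 (right_ne_zero_of_mul hs.ne')
    rw [if_pos hs, genBeta]
    by_cases hz : (|s| / b) ^ q < 1
    · rw [if_pos ⟨hs, by linarith⟩, if_pos ⟨hs0, by linarith⟩]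
      have e : l / (2 - α) = q * (l / (l - 1)) := by
        have h2 : 2 - α ≠ 0 := sub_ne_zero.2 hα.symm
        rw [← hlq]
        field_simp
      rw [e, show 1 + -1 * (|s| / b) ^ q = 1 - (1 - 0) * (|s| / b) ^ q by ring]
      simp only [zero_mul, add_zero, Real.one_rpow, mul_one]
      field_simp
    · rw [if_neg (fun h' => hz (by linarith [h'.2])), if_neg (fun h' => hz (by linarith [h'.2])),
        mul_zero]
  · rw [if_neg hs, if_neg (fun h' => hs h'.1)]

/-- With z = (|s|/b)^q, factoring z - 1 = z(1 - 1/z) gives a density of the first kind in 1/z,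
whence a = -q. -/
lemma eq_genBeta_of_sub_one {D : ℝ → ℝ} (hD : ∫⁻ s, ENNReal.ofReal (D s) = 1) (hα : α ≠ 2)
    (hq : q ≠ 0) (hlq : (2 - α) * q = l - 1) (hr : 0 < r) (hP : 0 < 1 / (1 - l) - 1 / r)
    {b C : ℝ} (hb : 0 < b) (hC : 0 < C)
    (h : ∀ s, D s = if 0 < (α - 2) * s ∧ 0 < -1 + 1 * (|s| / b) ^ q then
        C * |s| ^ (l / (2 - α) - 1) * (-1 + 1 * (|s| / b) ^ q) ^ (1 / r - 1) else 0) (s : ℝ) :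
    D s = if 0 < (α - 2) * s then genBeta (-q) b 0 (1 / (1 - l) - 1 / r) (1 / r) |s| else 0 := by
  have h2 : 2 - α ≠ 0 := sub_ne_zero.2 hα.symm
  have hl1 : l - 1 ≠ 0 := hlq ▸ mul_ne_zero h2 hq
  have hQ : 0 < 1 / r := one_div_pos.2 hr
  have hB := ProbabilityTheory.beta_pos hP hQ
  have hbp := Real.rpow_pos_of_pos hb (-q * (1 / (1 - l) - 1 / r))
  have hbq := Real.rpow_pos_of_pos hb (q * (1 / r - 1))
  have hqa := abs_pos.2 hq
  refine eq_genBeta_of_proportional hD hα (neg_ne_zero.2 hq) hb (Or.inl rfl) hP hQ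
    (C := C * (b ^ (-q * (1 / (1 - l) - 1 / r)) *
      ProbabilityTheory.beta (1 / (1 - l) - 1 / r) (1 / r)) / |q| / b ^ (q * (1 / r - 1)))
    (by positivity) (fun s => ?_) s
  rw [h]
  by_cases hs : 0 < (α - 2) * s
  · have hs0 : 0 < |s| := abs_pos.2 (right_ne_zero_of_mul hs.ne')
    have ht : 0 < |s| / b := div_pos hs0 hb
    have hz0 := Real.rpow_pos_of_pos ht q
    have hinv : (|s| / b) ^ (-q) = ((|s| / b) ^ q)⁻¹ := Real.rpow_neg ht.le q
    rw [if_pos hs, genBeta]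
    by_cases hz : 1 < (|s| / b) ^ q
    · have hz1 : ((|s| / b) ^ q)⁻¹ < 1 := inv_lt_one_of_one_lt₀ hz
      rw [if_pos ⟨hs, by linarith⟩, if_pos ⟨hs0, by rw [hinv]; linarith⟩, abs_neg]
      have e1 : -1 + 1 * (|s| / b) ^ q = (|s| / b) ^ q * (1 - ((|s| / b) ^ q)⁻¹) := by
        field_simp
        ring
      have e2 : |s| ^ (-q * (1 / (1 - l) - 1 / r) - 1) =
          |s| ^ (l / (2 - α) - 1) * |s| ^ (q * (1 / r - 1)) := by
        rw [← Real.rpow_add hs0]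
        congr 1
        have h3 : q = (l - 1) / (2 - α) := by
          rw [← hlq]
          field_simp
        have hl2 : 1 - l ≠ 0 := fun h => hl1 (by linarith)
        rw [h3]
        field_simp
        ring
      rw [e1, Real.mul_rpow hz0.le (by linarith), ← Real.rpow_mul ht.le,
        Real.div_rpow hs0.le hb.le, e2, hinv]
      generalize ProbabilityTheory.beta (1 / (1 - l) - 1 / r) (1 / r) = B at hB ⊢
      simp only [zero_mul, add_zero, Real.one_rpow, mul_one, sub_zero, one_mul]
      field_simp
    · rw [if_neg (fun h' => hz (by linarith [h'.2])), if_neg, mul_zero]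
      rintro ⟨-, h'⟩
      rw [hinv, sub_zero, one_mul, inv_lt_one₀ hz0] at h'
      exact hz h'
  · rw [if_neg hs, if_neg (fun h' => hs h'.1)]

/-- The two parameters sum to 1 - 1/r, so the factor (1 + z)^(1/r - 1) is the denominator of the
second kind. -/
lemma eq_genBeta_of_one_add {D : ℝ → ℝ} (hD : ∫⁻ s, ENNReal.ofReal (D s) = 1) (hα : α ≠ 2)
    (hq : q ≠ 0) (hlq : (2 - α) * q = l - 1) (hP : 0 < l / (l - 1))
    (hQ : 0 < 1 / (1 - l) - 1 / r) {b C : ℝ} (hb : 0 < b) (hC : 0 < C)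
    (h : ∀ s, D s = if 0 < (α - 2) * s ∧ 0 < 1 + 1 * (|s| / b) ^ q then
        C * |s| ^ (l / (2 - α) - 1) * (1 + 1 * (|s| / b) ^ q) ^ (1 / r - 1) else 0) (s : ℝ) :
    D s = if 0 < (α - 2) * s then genBeta q b 1 (l / (l - 1)) (1 / (1 - l) - 1 / r) |s|
      else 0 := by
  have h2 : 2 - α ≠ 0 := sub_ne_zero.2 hα.symm
  have hl1 : l - 1 ≠ 0 := hlq ▸ mul_ne_zero h2 hq
  have hB := ProbabilityTheory.beta_pos hP hQ
  have hbp := Real.rpow_pos_of_pos hb (q * (l / (l - 1)))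
  have hqa := abs_pos.2 hq
  refine eq_genBeta_of_proportional hD hα hq hb (Or.inr rfl) hP hQ
    (C := C * (b ^ (q * (l / (l - 1))) *
      ProbabilityTheory.beta (l / (l - 1)) (1 / (1 - l) - 1 / r)) / |q|)
    (by positivity) (fun s => ?_) s
  rw [h]
  by_cases hs : 0 < (α - 2) * s
  · have hs0 : 0 < |s| := abs_pos.2 (right_ne_zero_of_mul hs.ne')
    have hz0 := Real.rpow_pos_of_pos (div_pos hs0 hb) q
    rw [if_pos hs, genBeta, if_pos ⟨hs, by linarith⟩, if_pos ⟨hs0, by linarith⟩]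
    have e : l / (2 - α) = q * (l / (l - 1)) := by
      rw [← hlq]
      field_simp
    have e2 : (1 + 1 * (|s| / b) ^ q) ^ (1 / r - 1) =
        ((1 + 1 * (|s| / b) ^ q) ^ (l / (l - 1) + (1 / (1 - l) - 1 / r)))⁻¹ := by
      rw [← Real.rpow_neg (by linarith)]
      congr 1
      have h3 : l / (l - 1) = 1 - 1 / (1 - l) := by
        have hl2 : 1 - l ≠ 0 := fun h => hl1 (by linarith)
        field_simp
        ring
      rw [h3]
      ring
    have h4 := Real.rpow_pos_of_pos (show 0 < 1 + 1 * (|s| / b) ^ q by linarith)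
      (l / (l - 1) + (1 / (1 - l) - 1 / r))
    rw [e, e2]
    simp only [sub_self, zero_mul, sub_zero, Real.one_rpow, mul_one]
    field_simp
  · rw [if_neg hs, if_neg (fun h' => hs h'.1)]

/-- With z = (g/a)^(l-1), where a = `gaussConst p l`, one has x^p* = (1 - z)/(l - 1). Thus l > 1
gives the shape 1 - z and l < 1 the shape z - 1, both of the first kind. -/
lemma EntClassical.exists_genBeta (h : EntClassical p l) (hα : α ≠ 2) (hq : q ≠ 0)
    (hlq : (2 - α) * q = l - 1) : ∃ a b c P Q : ℝ, a ≠ 0 ∧ 0 < b ∧ 0 ≤ c ∧ c ≤ 1 ∧ 0 < P ∧ 0 < Q ∧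
      ∀ s, downTransform α (stretchedGauss p l) s =
        if 0 < (α - 2) * s then genBeta a b c P Q |s| else 0 := by
  have h2 : 2 - α ≠ 0 := sub_ne_zero.2 hα.symm
  have hl1 : l - 1 ≠ 0 := hlq ▸ mul_ne_zero h2 hq
  have hg := isDecreasingProfile_stretchedGauss h
  have hD := (hg.lintegral_downTransform α).trans (lintegral_stretchedGauss h)
  have hk := Real.rpow_pos_of_pos (gaussConst_pos h) (l - 1)
  have hr := h.1
  have hK := mul_pos hr hk
  have hx0 : ∀ x, 0 < stretchedGauss p l x → 0 < x := fun x hx =>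
    ((stretchedGauss_pos_iff h).1 hx).1
  have hd : ∀ x, 0 < stretchedGauss p l x → deriv (stretchedGauss p l) x =
      -(conjExp p * gaussConst p l ^ (l - 1) * |x| ^ (conjExp p - 1) *
        stretchedGauss p l x ^ (2 - l)) := fun x hx => by
    rw [abs_of_pos (hx0 x hx)]
    exact (hasDerivAt_stretchedGauss h hx).deriv
  have hsurj : ∀ y, 0 < y → 0 < (1 - y ^ (l - 1) / gaussConst p l ^ (l - 1)) / (l - 1) →
      ∃ x, stretchedGauss p l x = y := by
    intro y hy hb
    set B := (1 - y ^ (l - 1) / gaussConst p l ^ (l - 1)) / (l - 1) with hB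
    have hxr : (B ^ (1 / conjExp p)) ^ conjExp p = B := by
      rw [← Real.rpow_mul hb.le, one_div_mul_cancel hr.ne', Real.rpow_one]
    have e : 1 - (l - 1) * B = y ^ (l - 1) / gaussConst p l ^ (l - 1) := by
      rw [hB]
      field_simp
      ring
    have hyl := Real.rpow_pos_of_pos hy (l - 1)
    have hpos : 0 < stretchedGauss p l (B ^ (1 / conjExp p)) :=
      (stretchedGauss_pos_iff h).2 ⟨Real.rpow_pos_of_pos hb _, by rw [hxr, e]; positivity⟩
    refine ⟨B ^ (1 / conjExp p), ?_⟩
    have h3 := stretchedGauss_rpow h hpos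
    rw [hxr, e, mul_div_cancel₀ _ hk.ne'] at h3
    exact (Real.rpow_left_inj hpos.le hy.le hl1).1 h3
  have hpow : ∀ x, 0 < stretchedGauss p l x → |x| ^ conjExp p =
      (1 - stretchedGauss p l x ^ (l - 1) / gaussConst p l ^ (l - 1)) / (l - 1) := fun x hx => by
    rw [abs_of_pos (hx0 x hx), stretchedGauss_rpow h hx]
    field_simp
    ring
  have hne : ∀ x, 0 < stretchedGauss p l x → x ≠ 0 := fun x hx => (hx0 x hx).ne'
  rcases lt_or_gt_of_ne hl1 with hl | hl
  · have hl' : 0 < 1 - l := by linarith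
    have hl2 := hl'.ne'
    obtain ⟨b, C, hb, hC, hbC⟩ := downTransform_eq_of_power (e₀ := -1) (e₁ := 1) hg hα hq hlq hr.ne'
      hK (one_div_pos.2 hl') hk hne hd
      (fun x hx => by rw [hpow x hx, show l - 1 = -(1 - l) by ring]; field_simp; ring)
      (fun y hy h3 => hsurj y hy (div_pos_of_neg_of_neg (by linarith) hl))
    have hP : 0 < 1 / (1 - l) - 1 / conjExp p := by
      have h3 := h.2
      rw [div_lt_iff₀ (by linarith)] at h3
      rw [sub_pos]
      exact one_div_lt_one_div_of_lt hl' (by nlinarith [h.pos])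
    exact ⟨-q, b, 0, _, _, neg_ne_zero.2 hq, hb, le_rfl, zero_le_one, hP, one_div_pos.2 hr,
      eq_genBeta_of_sub_one hD hα hq hlq hr hP hb hC hbC⟩
  · obtain ⟨b, C, hb, hC, hbC⟩ := downTransform_eq_of_power (e₀ := 1) (e₁ := -1) hg hα hq hlq hr.ne'
      hK (one_div_pos.2 hl) hk hne hd
      (fun x hx => by rw [hpow x hx]; field_simp; ring)
      (fun y hy h3 => hsurj y hy (div_pos (by linarith) hl))
    have hP : 0 < l / (l - 1) := div_pos h.pos hl
    exact ⟨q, b, 0, _, _, hq, hb, le_rfl, zero_le_one, hP, one_div_pos.2 hr,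
      eq_genBeta_of_one_sub hD hα hq hlq hr hP hb hC hbC⟩

/-- Here |x|^p* is proportional to 1 + p·z, with z proportional to g^(l-1). After absorbing |p| into
the scale, p < 0 gives the first kind and p > 0 the second. -/
lemma EntMirrored.exists_genBeta (h : EntMirrored p l) (hα : α ≠ 2) (hq : q ≠ 0)
    (hlq : (2 - α) * q = l - 1) : ∃ a b c P Q : ℝ, a ≠ 0 ∧ 0 < b ∧ 0 ≤ c ∧ c ≤ 1 ∧ 0 < P ∧ 0 < Q ∧
      ∀ s, downTransform α (mirroredGauss p l) s =
        if 0 < (α - 2) * s then genBeta a b c P Q |s| else 0 := by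
  obtain ⟨hl, hp0, hp1, -⟩ := h.facts
  have hl1 : l - 1 ≠ 0 := by linarith
  have hg := isDecreasingProfile_mirroredGauss h
  have hD := (hg.lintegral_downTransform α).trans (lintegral_mirroredGauss h)
  have hmc := Real.rpow_pos_of_pos (mirrorConst_pos h) (l - 1)
  have hS := mirrorWidth_pos h
  have hW := Real.rpow_pos_of_pos hS (conjExp p)
  have hK := mirrorSlope_pos h
  have hmem : ∀ x, 0 < mirroredGauss p l x → x ∈ Ioo (-mirrorWidth p l) 0 := fun x hx =>
    (mirroredGauss_pos_iff h).1 hx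
  have hr : conjExp p ≠ 0 := by
    rcases h.conjExp_pos_or with h1 | h1
    · exact h1.2.ne'
    · exact h1.2.ne
  have hne : ∀ x, 0 < mirroredGauss p l x → x ≠ 0 := fun x hx => (hmem x hx).2.ne
  have hd : ∀ x, 0 < mirroredGauss p l x → deriv (mirroredGauss p l) x =
      -(mirrorSlope p l * |x| ^ (conjExp p - 1) * mirroredGauss p l x ^ (2 - l)) := fun x hx =>
    (hasDerivAt_mirroredGauss h (hmem x hx)).deriv
  have hpow : ∀ x, 0 < mirroredGauss p l x → |x| ^ conjExp p = mirrorWidth p l ^ conjExp p *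
      (1 + p * (mirroredGauss p l x ^ (l - 1) / mirrorConst p l ^ (l - 1))) := fun x hx => by
    rw [mirroredGauss_rpow h (hmem x hx), mul_div_cancel_left₀ _ hmc.ne', one_add_mul_mirrorBase h,
      ← Real.mul_rpow hS.le (by positivity), mul_div_cancel₀ _ hS.ne']
  have hsurj : ∀ y, 0 < y → 0 < 1 + p * (y ^ (l - 1) / mirrorConst p l ^ (l - 1)) →
      ∃ x, mirroredGauss p l x = y := by
    intro y hy hb
    set B := 1 + p * (y ^ (l - 1) / mirrorConst p l ^ (l - 1)) with hB
    have ht := Real.rpow_pos_of_pos hb (1 / conjExp p)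
    have hs : 0 < mirrorWidth p l * B ^ (1 / conjExp p) := mul_pos hS ht
    have hbase : mirrorBase p l (-(mirrorWidth p l * B ^ (1 / conjExp p))) =
        y ^ (l - 1) / mirrorConst p l ^ (l - 1) := by
      rw [mirrorBase, abs_neg, abs_of_pos hs, mul_div_cancel_left₀ _ hS.ne', ← Real.rpow_mul hb.le,
        one_div_mul_cancel hr, Real.rpow_one, hB]
      field_simp
      ring
    have hyl := Real.rpow_pos_of_pos hy (l - 1)
    have hlt := (mirrorBase_pos_iff h (neg_ne_zero.2 hs.ne')).1 (by rw [hbase]; positivity)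
    rw [abs_neg, abs_of_pos hs] at hlt
    have hm : -(mirrorWidth p l * B ^ (1 / conjExp p)) ∈ Ioo (-mirrorWidth p l) 0 :=
      ⟨neg_lt_neg hlt, neg_neg_of_pos hs⟩
    refine ⟨_, (Real.rpow_left_inj (mirroredGauss_nonneg h _) hy.le hl1).1
      ((mirroredGauss_rpow h hm).trans ?_)⟩
    rw [hbase, mul_div_cancel₀ _ hmc.ne']
  have hP : 0 < l / (l - 1) := div_pos_of_neg_of_neg hl (by linarith)
  rcases h.conjExp_pos_or with ⟨hp, hr'⟩ | ⟨hp, hr'⟩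
  · have hp' : 0 < -p := neg_pos.2 hp
    obtain ⟨b, C, hb, hC, hbC⟩ := downTransform_eq_of_power (e₀ := 1) (e₁ := -1) hg hα hq hlq hr
      hK hW (div_pos hmc hp') hne hd
      (fun x hx => by rw [hpow x hx]; field_simp)
      (fun y hy h3 => hsurj y hy (by convert h3 using 1; field_simp))
    exact ⟨q, b, 0, _, _, hq, hb, le_rfl, zero_le_one, hP, one_div_pos.2 hr',
      eq_genBeta_of_one_sub hD hα hq hlq hr' hP hb hC hbC⟩
  · obtain ⟨b, C, hb, hC, hbC⟩ := downTransform_eq_of_power (e₀ := 1) (e₁ := 1) hg hα hq hlq hr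
      hK hW (div_pos hmc hp) hne hd
      (fun x hx => by rw [hpow x hx]; field_simp)
      (fun y hy h3 => hsurj y hy (by convert h3 using 1; field_simp))
    have hQ : 0 < 1 / (1 - l) - 1 / conjExp p := by
      have h3 : 0 < 1 / (1 - l) := one_div_pos.2 (by linarith)
      have h4 : 1 / conjExp p < 0 := one_div_neg.2 hr'
      linarith
    exact ⟨q, b, 1, _, _, hq, hb, zero_le_one, le_rfl, hP, hQ,
      eq_genBeta_of_one_add hD hα hq hlq hP hQ hb hC hbC⟩

lemma exists_genBeta_extremalGauss (h : EntClassical p l ∨ EntMirrored p l) (hα : α ≠ 2)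
    (hq : q ≠ 0) (hlq : (2 - α) * q = l - 1) :
    ∃ a b c P Q : ℝ, a ≠ 0 ∧ 0 < b ∧ 0 ≤ c ∧ c ≤ 1 ∧ 0 < P ∧ 0 < Q ∧
      ∀ s, downTransform α (extremalGauss p l) s =
        if 0 < (α - 2) * s then genBeta a b c P Q |s| else 0 := by
  rcases h with h | h
  · rw [h.extremalGauss_eq]
    exact h.exists_genBeta hα hq hlq
  · rw [h.extremalGauss_eq]
    exact h.exists_genBeta hα hq hlq

end GenBeta

/-! ### The upper-moment inequalities -/

section UpperMoment

variable {p α q l : ℝ} {f : ℝ → ℝ}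

lemma kappaUp_pos_and_lt_top (hα : α ≠ 2) (h : UpClassical p α q ∨ UpMirrored p α q) :
    0 < kappaUp p α q ∧ kappaUp p α q < ∞ := by
  have hc : 0 < |2 - α| ^ theta1 p α q :=
    Real.rpow_pos_of_pos (abs_pos.2 (sub_ne_zero.2 hα.symm)) _
  exact ⟨ENNReal.mul_pos (ENNReal.ofReal_pos.2 hc).ne' (kappa0_pos (entRange_of_upRange h)).ne',
    ENNReal.mul_lt_top ENNReal.ofReal_lt_top (kappa0_lt_top (entRange_of_upRange h))⟩

lemma eq_zero_of_entropy_index_eq_one (hα : α ≠ 2) (h : 1 + (2 - α) * q = 1) : q = 0 :=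
  (mul_eq_zero.1 (add_eq_left.1 h)).resolve_left (sub_ne_zero.2 hα.symm)

/-- The upper-moment--moment inequality. -/
lemma kappaUp_le (hα : α ≠ 2) (h : UpClassical p α q ∨ UpMirrored p α q) (hf : IsProbDensity f)
    (hlog : q = 0 → Integrable fun x => f x * Real.log |x|)
    (h0 : ¬ (upperDeviation (conjExp p) α f = 0 ∧ deviation q f = 0))
    (h1 : ¬ (upperDeviation (conjExp p) α f = ∞ ∧ deviation q f = ∞)) :
    kappaUp p α q ≤ (upperDeviation (conjExp p) α f / deviation q f) ^ theta1 p α q := by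
  have := hf.isProbabilityMeasure
  rw [upperDeviation_div_rpow hf hα hlog h0 h1, kappaUp]
  gcongr
  refine kappa0_le (entRange_of_upRange h) (measurable_upWeight α) (ae_upWeight_pos α f)
    (fun hl => integrable_log_upWeight hf hα (hlog (eq_zero_of_entropy_index_eq_one hα hl))) ?_
  rw [upperDeviation_eq] at h0 h1
  rw [weightPower_upWeight hf hα hlog, ← upperMoment_eq_tailMoment hf.measurable]
  rintro ⟨h2, h3⟩
  refine (forms_of_upperDeviation (sub_ne_zero.2 hα) h0 h1).2 ⟨h2, ?_⟩
  by_contra h4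
  exact ENNReal.mul_ne_top ENNReal.ofReal_ne_top h4 h3

/-- The minimizers of the upper-moment--moment inequality. -/
lemma upperMinimizer_attains (hα : α ≠ 2) (h : UpClassical p α q ∨ UpMirrored p α q) :
    IsProbDensity (upperMinimizer p α (1 + (2 - α) * q)) ∧
      (q = 0 → Integrable
        (fun x => upperMinimizer p α (1 + (2 - α) * q) x * Real.log |x|)) ∧
      (upperDeviation (conjExp p) α (upperMinimizer p α (1 + (2 - α) * q)) /
        deviation q (upperMinimizer p α (1 + (2 - α) * q))) ^ theta1 p α q = kappaUp p α q := by
  have hE := entRange_of_upRange h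
  have hE' := hE.imp_left fun h => And.intro h hα
  have hD := isProbDensity_upperMinimizer (α := α) hE
  have hlog : q = 0 → Integrable
      fun x => upperMinimizer p α (1 + (2 - α) * q) x * Real.log |x| := by
    rintro rfl
    rw [mul_zero, add_zero] at hE ⊢
    exact integrable_log_upperMinimizer
      (hE.resolve_right fun h => absurd h.facts.1 (by norm_num)) hα
  have hm := upperMoment_upperMinimizer hE'
  obtain ⟨⟨h1, h2⟩, -⟩ := extremalGauss_functionals_ne hE
  refine ⟨hD, hlog, ?_⟩
  have hdev := upperDeviation_eq (conjExp p) α (upperMinimizer p α (1 + (2 - α) * q))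
  rw [hm] at hdev
  have h3 := (ENNReal.rpow_pos (p := α - 2) (pos_iff_ne_zero.2 h1) h2).ne'
  have h4 := ENNReal.rpow_ne_top_of_ne_zero (y := α - 2) h1 h2
  rw [upperDeviation_div_rpow hD hα hlog (fun h => h3 (hdev ▸ h.1)) (fun h => h4 (hdev ▸ h.1)),
    ← upperMoment_eq_tailMoment hD.measurable, hm, weightPower_upperMinimizer hE', kappaUp,
    kappa0_eq hE]

/-- For α = 2, w^(1-l) = exp(-(l-1)x), while the outer exponent 1/(1-l) has the sign opposite to
that in `expDeviation`. Hence a product in the statement where α ≠ 2 has a quotient. -/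
lemma weightPower_upWeight_two (hf : IsProbDensity f) (hl : l ≠ 1) :
    weightPower (densMeasure f) l (upWeight 2) = (expDeviation (l - 1) f)⁻¹ := by
  rw [weightPower, if_neg hl, expDeviation, ← ENNReal.rpow_neg,
    lintegral_densMeasure hf.measurable ((measurable_upWeight 2).ennreal_ofReal.pow_const _)]
  congr 1
  · refine lintegral_congr fun x => ?_
    rw [upWeight, if_pos rfl, ENNReal.ofReal_rpow_of_pos (Real.exp_pos x), ← Real.exp_mul]
    congr 3
    ring
  · rw [← neg_sub l 1, one_div, one_div, inv_neg]

end UpperMoment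

theorem theorem4p1 :
    -- the case `α ≠ 2`: inequality, sharpness, minimizers
    (∀ p α q : ℝ, α ≠ 2 → UpClassical p α q ∨ UpMirrored p α q →
      (0 < kappaUp p α q ∧ kappaUp p α q < ∞) ∧
      (∀ f : ℝ → ℝ, IsProbDensity f →
        (q = 0 → Integrable (fun x => f x * Real.log |x|)) →
        ¬ (upperDeviation (conjExp p) α f = 0 ∧ deviation q f = 0) →
        ¬ (upperDeviation (conjExp p) α f = ∞ ∧ deviation q f = ∞) →
        kappaUp p α q ≤
          (upperDeviation (conjExp p) α f / deviation q f) ^ theta1 p α q) ∧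
      (IsProbDensity (upperMinimizer p α (1 + (2 - α) * q)) ∧
        (q = 0 → Integrable
          (fun x => upperMinimizer p α (1 + (2 - α) * q) x * Real.log |x|)) ∧
        (upperDeviation (conjExp p) α (upperMinimizer p α (1 + (2 - α) * q)) /
          deviation q (upperMinimizer p α (1 + (2 - α) * q))) ^ theta1 p α q =
          kappaUp p α q) ∧
      (q ≠ 0 → ∃ a b c P Q : ℝ, a ≠ 0 ∧ 0 < b ∧ 0 ≤ c ∧ c ≤ 1 ∧ 0 < P ∧ 0 < Q ∧
        ∀ᵐ s : ℝ, downTransform α (extremalGauss p (1 + (2 - α) * q)) s =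
          if 0 < (α - 2) * s then genBeta a b c P Q |s| else 0)) ∧
    -- the case `α = 2`, `l ≠ 1`: exponential moments
    (∀ p l : ℝ, l ≠ 1 → EntClassical p l ∨ EntMirrored p l →
      (0 < kappa0 p l ∧ kappa0 p l < ∞) ∧
      (∀ f : ℝ → ℝ, IsProbDensity f →
        ¬ (upperMoment (conjExp p) 2 f ^ (1 / conjExp p) = 0 ∧ expDeviation (l - 1) f = ∞) →
        ¬ (upperMoment (conjExp p) 2 f ^ (1 / conjExp p) = ∞ ∧ expDeviation (l - 1) f = 0) →
        kappa0 p l ≤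
          (upperMoment (conjExp p) 2 f ^ (1 / conjExp p) * expDeviation (l - 1) f) ^
            theta0 p l) ∧
      (EntMirrored p l →
        IsProbDensity (upperMinimizer p 2 l) ∧
        (upperMoment (conjExp p) 2 (upperMinimizer p 2 l) ^ (1 / conjExp p) *
          expDeviation (l - 1) (upperMinimizer p 2 l)) ^ theta0 p l = kappa0 p l)) ∧
    -- the Shannon case, `α ≠ 2`: logarithmic moments
    (∀ p α : ℝ, α ≠ 2 → 0 < conjExp p →
      ∀ f : ℝ → ℝ, IsProbDensity f → Integrable (fun x => f x * Real.log |x|) →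
        kappaUp p α 0 ≤
          (upperDeviation (conjExp p) α f /
            ENNReal.ofReal (Real.exp (∫ x, f x * Real.log |x|))) ^ (1 / (α - 2))) ∧
    -- the Shannon case, `α = 2`
    (∀ p : ℝ, 0 < conjExp p →
      ∀ f : ℝ → ℝ, IsProbDensity f → Integrable (fun x => x * f x) →
        kappa0 p 1 * ENNReal.ofReal (Real.exp (∫ x, x * f x)) ≤
          upperMoment (conjExp p) 2 f ^ (1 / conjExp p)) := by
  refine ⟨fun p α q hα h => ⟨kappaUp_pos_and_lt_top hα h, fun f hf hlog h0 h1 =>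
      kappaUp_le hα h hf hlog h0 h1, upperMinimizer_attains hα h, fun hq => ?_⟩,
    fun p l hl h => ⟨⟨kappa0_pos h, kappa0_lt_top h⟩, fun f hf _ h1 => ?_, fun hm =>
      ⟨isProbDensity_upperMinimizer h, ?_⟩⟩, fun p α hα hr f hf hlog => ?_,
    fun p hr f hf hint => ?_⟩
  · obtain ⟨a, b, c, P, Q, ha, hb, hc0, hc1, hP, hQ, hD⟩ :=
      exists_genBeta_extremalGauss (entRange_of_upRange h) hα hq (add_sub_cancel_left 1 _).symm
    exact ⟨a, b, c, P, Q, ha, hb, hc0, hc1, hP, hQ, Filter.Eventually.of_forall hD⟩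
  · have := hf.isProbabilityMeasure
    have hle := kappa0_le (μ := densMeasure f) h (measurable_upWeight 2) (ae_upWeight_pos 2 f)
      (fun h => absurd h hl) (by
        rw [weightPower_upWeight_two hf hl, ← upperMoment_eq_tailMoment hf.measurable,
          ENNReal.inv_eq_top]
        exact h1)
    rwa [weightPower_upWeight_two hf hl, ← upperMoment_eq_tailMoment hf.measurable,
      div_eq_mul_inv, inv_inv] at hle
  · have hD := isProbDensity_upperMinimizer (α := 2) h
    have he := weightPower_upWeight_two hD hl
    rw [weightPower_upperMinimizer (Or.inr hm)] at he
    rw [upperMoment_upperMinimizer (Or.inr hm), ← inv_inv (expDeviation _ _), ← he,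
      ← div_eq_mul_inv, kappa0_eq h]
  · have h : UpClassical p α 0 := ⟨hr, by rw [mul_zero]; positivity⟩
    have hd : deviation 0 f = ENNReal.ofReal (Real.exp (∫ x, f x * Real.log |x|)) := if_pos rfl
    have hle := kappaUp_le hα (Or.inl h) hf (fun _ => hlog)
      (by rw [hd]; exact fun h => (ENNReal.ofReal_pos.2 (Real.exp_pos _)).ne' h.2)
      (by rw [hd]; exact fun h => ENNReal.ofReal_ne_top h.2)
    rwa [hd, theta1, h.entClassical.theta0_eq] at hle
  · have := hf.isProbabilityMeasure
    have h := entClassical_one hr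
    have hint' : Integrable fun x => f x * x := by simpa only [mul_comm] using hint
    -- For α = 2 the logarithm of the weight is x itself, so the geometric mean is exp ∫ x f.
    have hw : weightPower (densMeasure f) 1 (upWeight 2) =
        ENNReal.ofReal (Real.exp (∫ x, x * f x)) := by
      rw [weightPower, if_pos rfl]
      simp only [upWeight, if_true, Real.log_exp]
      rw [integral_densMeasure hf.measurable hf.nonneg]
      simp_rw [mul_comm]
    have hle := kappa0_le (μ := densMeasure f) (Or.inl h) (measurable_upWeight 2)
      (ae_upWeight_pos 2 f) (fun _ => by
        simp only [upWeight, if_true, Real.log_exp]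
        exact (integrable_densMeasure hf.measurable hf.nonneg).2 hint')
      (by rw [hw]; exact fun h => ENNReal.ofReal_ne_top h.2)
    rw [hw, ← upperMoment_eq_tailMoment hf.measurable, h.theta0_eq, ENNReal.rpow_one] at hle
    exact ENNReal.mul_le_of_le_div hle
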